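/- Let $\Omega\subset\mathbb R^2$ be a bounded open convex set, let $M>0$, and let ``smooth'' mean $C^r$, where $1\le r\le\infty$ or $r=\omega$ is fixed. A function $u:\bar\Omega\to\mathbb R$ is piecewise smooth if the points of $\Omega$ near which it is not smooth (the singular points; the others are regular) lie on finitely many smooth arcs (jumps are allowed); a surface in $\mathbb R^3$ is piecewise smooth if, off finitely many smooth arcs, it is locally the zero set of a smooth function with non-zero gradient. For a body $B\subset\mathbb R^3$ consider a point particle that falls along the vertical line over $x\in\mathbb R^2$ with velocity $v=(0,0,-1)$, makes finitely many (maybe no) elastic reflections at regular points of $\partial B$ (points where $\partial B$, seen from the side of the particle, is a smooth surface), and finally moves freely with velocity $v^+(x;B)=(v_1^+,v_2^+,v_3^+)$. Tangential contact at a regular point, and touching the upper graph of $B$ from above, are not counted as reflections. The scattering by $B$ is regular if $v^+(\cdot\,;B)$ is defined almost everywhere in $\mathbb R^2$ and measurable; then the resistance of $B$ is $$R(B)=\int_\Omega \frac{1+v_3^+(x;B)}{2}\,dx .$$ Let $\mathcal U_{\Omega,M}$ be the class of piecewise smooth functions $u:\bar\Omega\to\mathbb R$ with $0\le u\le M$ for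 which the scattering by $B_u=\{(x,z):x\in\bar\Omega,\ 0\le z\le u(x)\}$ is regular, and put $F(u)=R(B_u)$. Let $\mathcal B_{\Omega,M}$ be the class of sets $B$ with $\bar\Omega\times\{0\}\subset B\subset\bar\Omega\times[0,M]$ such that $\partial B\setminus(\partial\Omega\times\mathbb R)$ is piecewise smooth and the scattering by $B$ is regular. Let $\Sigma_{\Omega,M}$ be the class of $B\in\mathcal B_{\Omega,M}$ whose upper envelope $u_B(x)=\sup\{z:(x,z)\in B\}$ is piecewise smooth on $\bar\Omega$ and satisfies the single impact condition (SIC): for every regular point $x\in\Omega$ of $u=u_B$ and every $t>0$ with $x-t\nabla u(x)\in\bar\Omega$, $$\frac{u(x-t\nabla u(x))-u(x)}{t}\le\frac12\bigl(1-|\nabla u(x)|^2\bigr).$$ Then $$\inf_{u\in\mathcal U_{\Omega,M}}F(u)=\phi(\Omega,M)=\inf_{B\in\Sigma_{\Omega,M}}R(B),\qquad \phi(\Omega,M)=\int_\Omega\frac12\left(1-\frac{M}{\sqrt{M^2+\operatorname{dist}^2(x,\partial\Omega)}}\right)dx .$$ -/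

import Mathlib

open Set Filter Topology MeasureTheory

noncomputable section

namespace MinRes

/-- The horizontal plane `ℝ²` with its Euclidean structure. -/
abbrev Plane := EuclideanSpace ℝ (Fin 2)

/-- The space `ℝ³ = ℝ² × ℝ`; a point is written `(x, z)`, with `z` the vertical coordinate. Only the
topology, the linear structure and `dot` below are used on it. -/
abbrev Space := Plane × ℝ

/-- The Euclidean scalar product of `ℝ³`. -/
def dot (a b : Space) : ℝ := inner ℝ a.1 b.1 + a.2 * b.2

/-- The set `N` is contained in a finite union of (possibly degenerate) `C^r` arcs. -/
def CoveredByArcs {E : Type*} [NormedAddCommGroup E] [NormedSpace ℝ E]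
    (r : WithTop ℕ∞) (N : Set E) : Prop :=
  ∃ (k : ℕ) (γ : Fin k → ℝ → E),
    (∀ i, ContDiffOn ℝ r (γ i) (Icc 0 1)) ∧ N ⊆ ⋃ i, γ i '' Icc (0 : ℝ) 1

/-- The function `f` is of class `C^r` in a neighbourhood of `x`. -/
def SmoothNear {E : Type*} [NormedAddCommGroup E] [NormedSpace ℝ E]
    (r : WithTop ℕ∞) (f : E → ℝ) (x : E) : Prop :=
  ∃ U : Set E, IsOpen U ∧ x ∈ U ∧ ContDiffOn ℝ r f U

/-! ### Functions on `closure Ω` -/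

/-- A piecewise smooth function on (the closure of) an open set `Ω`: its singular points in `Ω`,
i.e. the points near which it is not `C^r`, lie on finitely many arcs. Jumps are allowed. -/
def PiecewiseSmooth (r : WithTop ℕ∞) (Ω : Set Plane) (u : Plane → ℝ) : Prop :=
  CoveredByArcs r {x ∈ Ω | ¬ SmoothNear r u x}

/-- The single impact condition for a (piecewise smooth) function on `closure Ω`. -/
def SIC (r : WithTop ℕ∞) (Ω : Set Plane) (u : Plane → ℝ) : Prop :=
  PiecewiseSmooth r Ω u ∧
  ∀ x ∈ Ω, SmoothNear r u x → ∀ t : ℝ, 0 < t → x - t • gradient u x ∈ closure Ω →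
    (u (x - t • gradient u x) - u x) / t ≤ 1 / 2 * (1 - ‖gradient u x‖ ^ 2)

/-- The body `B_u = {(x, z) : x ∈ closure Ω, 0 ≤ z ≤ u x}`. -/
def subgraph (Ω : Set Plane) (u : Plane → ℝ) : Set Space :=
  {p | p.1 ∈ closure Ω ∧ 0 ≤ p.2 ∧ p.2 ≤ u p.1}

/-! ### Billiard scattering by a body `B ⊆ ℝ³` -/

/-- `q` is a regular point of the boundary of `B`, seen from the side to which the unit vector `n`
points: near `q` the boundary is, on this side, a `C^r` surface `h = 0` with normal `n` at `q`. The
side `h > 0` is outside `B`, and `B` contains either the side `h < 0`, or the surface itself (as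
where `B` has zero thickness, for instance at a point of `Ω × {0}` near which `B` is just
`Ω × {0}`). -/
def IsNormal (r : WithTop ℕ∞) (B : Set Space) (q n : Space) : Prop :=
  dot n n = 1 ∧ ∃ h : Space → ℝ, SmoothNear r h q ∧ h q = 0 ∧
    (∃ c : ℝ, 0 < c ∧ ∀ w : Space, fderiv ℝ h q w = c * dot n w) ∧
    (∀ᶠ p in 𝓝 q, 0 < h p → p ∉ B) ∧
    ((∀ᶠ p in 𝓝 q, h p < 0 → p ∈ B) ∨ (∀ᶠ p in 𝓝 q, h p = 0 → p ∈ B))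

/-- No point of `B` lies strictly above `q`, i.e. `q` is on or above the upper graph of `B`. -/
def NothingAbove (B : Set Space) (q : Space) : Prop :=
  ∀ z : ℝ, q.2 < z → (q.1, z) ∉ B

/-- A particle that is at `q` with velocity `w` moves on freely. Either it is away from `B`; or it
grazes the boundary of `B` tangentially at a regular point; or it touches the upper graph of `B` from
above, being on or above this graph shortly before and after (touching is not a reflection). -/
def Passes (r : WithTop ℕ∞) (B : Set Space) (q w : Space) : Prop :=
  q ∉ closure B ∨ (∃ n, IsNormal r B q n ∧ dot w n = 0) ∨
    ∀ᶠ s in 𝓝 (0 : ℝ), NothingAbove B (q + s • w)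

/-- A particle that hits the boundary of `B` at the regular point `q` with velocity `w` is reflected
elastically there and gets the velocity `w'`. -/
def Reflects (r : WithTop ℕ∞) (B : Set Space) (q w w' : Space) : Prop :=
  ∃ n, IsNormal r B q n ∧ dot w n < 0 ∧ w' = w - (2 * dot w n) • n

/-- A billiard particle that starts at `q` with velocity `w` makes finitely many (maybe no)
reflections, all at regular points of the boundary of `B`, and finally moves freely with
velocity `v`. -/
inductive Escapes (r : WithTop ℕ∞) (B : Set Space) : Space → Space → Space → Prop
  | free (q w : Space) (hfree : ∀ t : ℝ, 0 < t → Passes r B (q + t • w) w) : Escapes r B q w w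
  | reflect (q w w' v : Space) (T : ℝ) (hT : 0 < T)
      (hfree : ∀ t : ℝ, 0 < t → t < T → Passes r B (q + t • w) w)
      (hrefl : Reflects r B (q + T • w) w w')
      (hnext : Escapes r B (q + T • w) w' v) : Escapes r B q w v

/-- The initial velocity `(0, 0, -1)` of the flow. -/
def down : Space := (0, -1)

/-- The flow particle that falls along the vertical line over `x` (from above, where it has not yet
met `B`) has the final velocity `v`. -/
def ScattersTo (r : WithTop ℕ∞) (B : Set Space) (x : Plane) (v : Space) : Prop :=
  ∃ z₀ : ℝ, (∀ z ≥ z₀, ((x, z) : Space) ∉ closure B) ∧ Escapes r B (x, z₀) down v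

/-- The final velocity `v⁺(x; B)`; a junk value where it is not defined. -/
def finalVelocity (r : WithTop ℕ∞) (B : Set Space) (x : Plane) : Space :=
  Classical.epsilon (ScattersTo r B x)

/-- The billiard scattering by `B` is regular: the final velocity is defined almost everywhere
in the plane and is Lebesgue measurable. -/
def RegularScattering (r : WithTop ℕ∞) (B : Set Space) : Prop :=
  (∀ᵐ x : Plane, ∃ v, ScattersTo r B x v) ∧ AEMeasurable (finalVelocity r B)

/-- The resistance `∫_Ω (1 + v₃⁺(x; B)) / 2 dx`. -/
def resistance (r : WithTop ℕ∞) (Ω : Set Plane) (B : Set Space) : ℝ :=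
  ∫ x in Ω, (1 + (finalVelocity r B x).2) / 2

/-! ### The classes of functions and of bodies -/

/-- The class `𝓤_{Ω,M}` of piecewise smooth functions `u` on `closure Ω` with `0 ≤ u ≤ M` and regular
scattering by the body `B_u`. -/
def classU (r : WithTop ℕ∞) (Ω : Set Plane) (M : ℝ) : Set (Plane → ℝ) :=
  {u | PiecewiseSmooth r Ω u ∧ (∀ x ∈ closure Ω, 0 ≤ u x ∧ u x ≤ M) ∧
    RegularScattering r (subgraph Ω u)}

/-- A piecewise smooth surface: away from finitely many arcs it is locally the regular zero set of a
`C^r` function. -/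
def PiecewiseSmoothSurface (r : WithTop ℕ∞) (S : Set Space) : Prop :=
  CoveredByArcs r {p ∈ S | ¬ ∃ h : Space → ℝ, SmoothNear r h p ∧ fderiv ℝ h p ≠ 0 ∧
    ∀ᶠ q in 𝓝 p, (q ∈ S ↔ h q = 0)}

/-- The class `𝓑_{Ω,M}` of bodies. -/
def classB (r : WithTop ℕ∞) (Ω : Set Plane) (M : ℝ) : Set (Set Space) :=
  {B | PiecewiseSmoothSurface r (frontier B \ (frontier Ω ×ˢ univ)) ∧
    closure Ω ×ˢ {0} ⊆ B ∧ B ⊆ closure Ω ×ˢ Icc 0 M ∧ RegularScattering r B}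

/-- The upper envelope `u_B(x) = sup {z : (x, z) ∈ B}`. -/
def upperEnvelope (B : Set Space) (x : Plane) : ℝ := sSup {z : ℝ | (x, z) ∈ B}

/-- The class `Σ_{Ω,M}` of the bodies in `𝓑_{Ω,M}` whose upper envelope satisfies SIC. -/
def classSigma (r : WithTop ℕ∞) (Ω : Set Plane) (M : ℝ) : Set (Set Space) :=
  {B | B ∈ classB r Ω M ∧ SIC r Ω (upperEnvelope B)}

/-- `φ(Ω, M)`, with `d(x) = dist(x, ∂Ω)`. -/
def phi (Ω : Set Plane) (M : ℝ) : ℝ :=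
  ∫ x in Ω, 1 / 2 * (1 - M / Real.sqrt (M ^ 2 + Metric.infDist x (frontier Ω) ^ 2))

end MinRes

end

/-!
A particle reflected towards a point of `frontier Ω` at distance `d` from `x`, from a height at most
`M`, cannot descend more steeply than with slope `M / d`, and the integrand of `phi` is the value of
`(1 + v₃) / 2` for exactly this slope with `d = dist(x, ∂Ω)`.

**Lower bound.** If the body lies below a graph, every normal that a particle meets from inside the
cylinder over `closure Ω` points upwards (sideways at worst), so reflections never decrease the
vertical velocity (`Escapes.snd_le`). Hence a particle that finally descends with slope `σ` was
never less steep before; between its first reflection, at a height at most `M`, and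
`frontier Ω` it descends everywhere at least with slope `σ`, and it must not hit the floor: so
`σ * d ≤ M` (`Escapes.height_le`, an induction along the trajectory). Under the single impact
condition the final velocity is the one after a single reflection from the upper graph, since
the reflected ray stays on or above this graph (`ScattersTo.eq_reflected`); the condition itself,
at the point where the ray leaves `Ω`, bounds the slope.

**Upper bound.** The resistance `phi` would be attained if each particle could be sent from height
`M` to the nearest boundary point, but mirrors stand in each other's way. Small conical mirrors
`z = H + g * |x - a|`, with `H` slightly less than `M`, send the particles through the
vertical line over the apex `a`; a system of them works (structure `Mirrors`) if beyond the apices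
the reflected rays cross no other mirror. So one needs a family of segments that fills
almost all of `Ω`, whose directions are almost those to the nearest boundary point, and whose
continuations beyond the end points have arbitrarily small total area (structure `Fan`): then
`Ω` can be left empty there. Such a family is given by an explicit construction in the spirit
of Besicovitch and Nikodym. The unit interval is cut into `N ^ N` parts, and all segments that
start in the part with number `i` end, on the opposite side of the unit square, at the mean `p i` of
the roundings of `i / N ^ N` to the multiples of `N⁻¹, …, N⁻ᴺ`. These cells are disjoint triangles,
because `p` is monotone, and they fill half of the square. At the distance `τ` beyond this side the
segment that starts at `y` is at `(1 + τ) * p i - τ * y`; up to `O(1 / N)`, `p i` is the mean of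
a number `k` of coarse roundings of `y` and of `N - k` copies of `y`, so for
`k / N ≈ 1 / (1 + τ)` the copies of `y` cancel, and the segments from one interval of
length `N⁻ᵏ` concentrate on a set of length `O(N⁻ᵏ⁻¹)` (`exists_concentration`). Every section of
the tail therefore has length `O(1 / N)` (`volume_bundleTail_le`). Filling a fixed part of what is
left again and again exhausts every open set (`exists_fan`).

The system of mirrors that results satisfies the single impact condition. The function itself serves
for the first infimum (`Mirrors.mem_classU`), and for the second one a body without thickness, the
floor together with the mirrors (`Mirrors.sheets_mem_classSigma`).
-/

namespace MinRes

/-! ### Scalar products, normals and regular boundary points -/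

theorem dot_comm (a b : Space) : dot a b = dot b a := by
  simp only [dot, real_inner_comm]; ring

theorem dot_add_right (a b c : Space) : dot a (b + c) = dot a b + dot a c := by
  simp only [dot, Prod.fst_add, Prod.snd_add, inner_add_right]; ring

theorem dot_sub_right (a b c : Space) : dot a (b - c) = dot a b - dot a c := by
  simp only [dot, Prod.fst_sub, Prod.snd_sub, inner_sub_right]; ring

theorem dot_smul_right (a b : Space) (t : ℝ) : dot a (t • b) = t * dot a b := by
  simp only [dot, Prod.smul_fst, Prod.smul_snd, inner_smul_right, smul_eq_mul]; ring

theorem dot_self (a : Space) : dot a a = ‖a.1‖ ^ 2 + a.2 ^ 2 := by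
  simp only [dot, real_inner_self_eq_norm_sq]; ring

/-- An elastic reflection preserves the speed. -/
theorem dot_reflect {w n : Space} (hn : dot n n = 1) :
    dot (w - (2 * dot w n) • n) (w - (2 * dot w n) • n) = dot w w := by
  have h1 : dot (w - (2 * dot w n) • n) w = dot w w - 2 * dot w n * dot w n := by
    rw [dot_comm, dot_sub_right, dot_smul_right]
  have h2 : dot (w - (2 * dot w n) • n) n = dot w n - 2 * dot w n * 1 := by
    rw [dot_comm, dot_sub_right, dot_smul_right, hn, dot_comm]
  rw [dot_sub_right, dot_smul_right, h1, h2]; ring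

theorem SmoothNear.contDiffAt {E : Type*} [NormedAddCommGroup E] [NormedSpace ℝ E]
    {r : WithTop ℕ∞} {f : E → ℝ} {x : E} (h : SmoothNear r f x) : ContDiffAt ℝ r f x := by
  obtain ⟨U, hU, hx, hf⟩ := h
  exact hf.contDiffAt (hU.mem_nhds hx)

theorem SmoothNear.eventually_continuousAt {E : Type*} [NormedAddCommGroup E] [NormedSpace ℝ E]
    {r : WithTop ℕ∞} {f : E → ℝ} {x : E} (h : SmoothNear r f x) :
    ∀ᶠ y in 𝓝 x, ContinuousAt f y := by
  obtain ⟨U, hU, hx, hf⟩ := h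
  filter_upwards [hU.mem_nhds hx] with y hy
  exact (hf.continuousOn).continuousAt (hU.mem_nhds hy)

theorem SmoothNear.differentiableAt {E : Type*} [NormedAddCommGroup E] [NormedSpace ℝ E]
    {r : WithTop ℕ∞} (hr : 1 ≤ r) {f : E → ℝ} {x : E} (h : SmoothNear r f x) :
    DifferentiableAt ℝ f x :=
  h.contDiffAt.differentiableAt (by rintro rfl; simp at hr)

/-- A function with positive directional derivative at a zero is positive shortly afterwards. -/
theorem eventually_pos_of_fderiv_pos {E : Type*} [NormedAddCommGroup E] [NormedSpace ℝ E]
    {f : E → ℝ} {q w : E} (hf : DifferentiableAt ℝ f q) (h0 : f q = 0)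
    (hw : 0 < fderiv ℝ f q w) : ∀ᶠ s in 𝓝[>] (0 : ℝ), 0 < f (q + s • w) := by
  have h2 := hf.hasFDerivAt.hasLineDerivAt w
  have h3 := h2.tendsto_slope_zero_right
  filter_upwards [h3.eventually (lt_mem_nhds hw), self_mem_nhdsWithin] with s hs hs0
  rw [h0, sub_zero, smul_eq_mul] at hs
  exact pos_of_mul_pos_right hs (inv_pos.2 hs0).le

theorem eventually_neg_of_fderiv_neg {E : Type*} [NormedAddCommGroup E] [NormedSpace ℝ E]
    {f : E → ℝ} {q w : E} (hf : DifferentiableAt ℝ f q) (h0 : f q = 0)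
    (hw : fderiv ℝ f q w < 0) : ∀ᶠ s in 𝓝[>] (0 : ℝ), f (q + s • w) < 0 := by
  have h2 := hf.hasFDerivAt.hasLineDerivAt w
  have h3 := h2.tendsto_slope_zero_right
  filter_upwards [h3.eventually (gt_mem_nhds hw), self_mem_nhdsWithin] with s hs hs0
  rw [h0, sub_zero, smul_eq_mul] at hs
  exact neg_of_mul_neg_right hs (inv_pos.2 hs0).le

theorem tendsto_add_smul_zero {E : Type*} [NormedAddCommGroup E] [NormedSpace ℝ E] (q w : E) :
    Tendsto (fun s : ℝ => q + s • w) (𝓝 0) (𝓝 q) := by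
  have : Continuous fun s : ℝ => q + s • w := by fun_prop
  simpa using this.tendsto 0

/-- Every two-dimensional sector around a direction tangent to the boundary at a regular point
contains points of the body, arbitrarily close to this point: the body contains one side of
the boundary surface, or the surface itself. -/
theorem IsNormal.eventually_exists_mem {r : WithTop ℕ∞} (hr : 1 ≤ r) {B : Set Space} {q n : Space}
    (hn : IsNormal r B q n) {w m : Space} (h1 : 0 < dot n (w + m)) (h2 : dot n (w - m) < 0) :
    ∀ᶠ s in 𝓝[>] (0 : ℝ), ∃ τ ∈ Icc (-1 : ℝ) 1, q + s • (w + τ • m) ∈ B := by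
  obtain ⟨-, h, hs, h0, ⟨c, hc, hd⟩, -, hB⟩ := hn
  have hdiff := hs.differentiableAt hr
  have hpos := eventually_pos_of_fderiv_pos (w := w + m) hdiff h0
    (by rw [hd]; exact mul_pos hc h1)
  have hneg := eventually_neg_of_fderiv_neg (w := w - m) hdiff h0
    (by rw [hd]; exact mul_neg_of_pos_of_neg hc h2)
  rcases hB with hB | hB
  · have := (tendsto_add_smul_zero q (w - m)).mono_left (nhdsWithin_le_nhds (s := Ioi 0))
    filter_upwards [hneg, this.eventually hB] with s hs1 hs2
    exact ⟨-1, by simp, by simpa [sub_eq_add_neg] using hs2 hs1⟩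
  · obtain ⟨ρ, hρ, hball⟩ := Metric.eventually_nhds_iff_ball.1 (hB.and hs.eventually_continuousAt)
    have hsmall : ∀ᶠ s in 𝓝[>] (0 : ℝ), s * (‖w‖ + ‖m‖) < ρ := by
      have : Tendsto (fun s : ℝ => s * (‖w‖ + ‖m‖)) (𝓝[>] 0) (𝓝 0) := by
        have : Continuous fun s : ℝ => s * (‖w‖ + ‖m‖) := by fun_prop
        simpa using (this.tendsto 0).mono_left nhdsWithin_le_nhds
      exact this.eventually (gt_mem_nhds hρ)
    filter_upwards [hpos, hneg, hsmall, self_mem_nhdsWithin] with s hs1 hs2 hs3 hs4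
    have hmem : ∀ τ ∈ Icc (-1 : ℝ) 1, q + s • (w + τ • m) ∈ Metric.ball q ρ := by
      intro τ hτ
      rw [Metric.mem_ball, dist_eq_norm, add_sub_cancel_left, norm_smul, Real.norm_eq_abs,
        abs_of_pos hs4]
      refine lt_of_le_of_lt (mul_le_mul_of_nonneg_left ?_ (le_of_lt hs4)) hs3
      refine (norm_add_le _ _).trans (add_le_add_right ?_ _)
      rw [norm_smul, Real.norm_eq_abs]
      exact mul_le_of_le_one_left (norm_nonneg _) (abs_le.2 hτ)
    have hcont : ContinuousOn (fun τ : ℝ => h (q + s • (w + τ • m))) (Icc (-1) 1) := by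
      intro τ hτ
      refine ContinuousAt.continuousWithinAt ?_
      refine ContinuousAt.comp (f := fun τ : ℝ => q + s • (w + τ • m)) (hball _ (hmem τ hτ)).2 ?_
      fun_prop
    have := intermediate_value_Icc (by norm_num) hcont
    obtain ⟨τ, hτ, hτ0⟩ := this (show (0 : ℝ) ∈ Icc _ _ from
      ⟨by simpa [sub_eq_add_neg] using hs2.le, by simpa using hs1.le⟩)
    exact ⟨τ, hτ, (hball _ (hmem τ hτ)).1 hτ0⟩

theorem IsNormal.mem_closure {r : WithTop ℕ∞} (hr : 1 ≤ r) {B : Set Space} {q n : Space}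
    (hn : IsNormal r B q n) : q ∈ closure B := by
  have hnn := hn.1
  obtain ⟨-, h, hs, h0, ⟨c, hc, hd⟩, -, hB⟩ := hn
  rcases hB with hB | hB
  · have hneg := eventually_neg_of_fderiv_neg (w := -n) (hs.differentiableAt hr) h0
      (by rw [map_neg, hd, hnn]; linarith)
    have ht := (tendsto_add_smul_zero q (-n)).mono_left (nhdsWithin_le_nhds (s := Ioi 0))
    refine mem_closure_of_tendsto ht ?_
    filter_upwards [hneg, ht.eventually hB] with s h1 h2 using h2 h1
  · exact subset_closure (hB.self_of_nhds h0)

/-! ### Null sets in the plane -/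

/-- A `C^1` arc in the plane is a null set: it is the image of a strip under a map with everywhere
degenerate derivative. -/
theorem volume_arc_eq_zero {r : WithTop ℕ∞} (hr : 1 ≤ r) {γ : ℝ → Plane}
    (hγ : ContDiffOn ℝ r γ (Icc 0 1)) : volume (γ '' Icc (0 : ℝ) 1) = 0 := by
  let π : Plane →L[ℝ] ℝ := EuclideanSpace.proj 0
  let S : Set Plane := π ⁻¹' Icc 0 1
  have hd : DifferentiableOn ℝ γ (Icc 0 1) := hγ.differentiableOn (by rintro rfl; simp at hr)
  have himg : γ '' Icc (0 : ℝ) 1 ⊆ (γ ∘ π) '' S := by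
    rintro _ ⟨t, ht, rfl⟩
    exact ⟨EuclideanSpace.single 0 t, by simpa [S, π] using ht, by simp [π]⟩
  refine measure_mono_null himg ?_
  refine addHaar_image_eq_zero_of_det_fderivWithin_eq_zero volume (s := S)
    (f' := fun x => (fderivWithin ℝ γ (Icc 0 1) (π x)).comp π) (fun x hx => ?_) (fun x hx => ?_)
  · exact ((hd (π x) hx).hasFDerivWithinAt).comp x π.hasFDerivAt.hasFDerivWithinAt
      (fun y hy => hy)
  · by_contra hne
    set A : Plane →L[ℝ] Plane := (fderivWithin ℝ γ (Icc 0 1) (π x)).comp π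
    have hu : IsUnit (LinearMap.det (A : Plane →ₗ[ℝ] Plane)) := isUnit_iff_ne_zero.2 hne
    have hker := (LinearMap.equivOfDetNeZero _ hu.ne_zero).injective
    have h1 : A (EuclideanSpace.single 1 1) = A 0 := by simp [A, π]
    have := hker (a₁ := EuclideanSpace.single 1 1) (a₂ := 0) (by simpa using h1)
    have h2 := congrArg (fun v : Plane => v 1) this
    simp at h2

theorem CoveredByArcs.volume_eq_zero {r : WithTop ℕ∞} (hr : 1 ≤ r) {N : Set Plane}
    (h : CoveredByArcs r N) : volume N = 0 := by
  obtain ⟨k, γ, hγ, hN⟩ := h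
  exact measure_mono_null hN (measure_iUnion_null fun i => volume_arc_eq_zero hr (hγ i))

/-- A preconnected set that meets an open set and its complement meets the frontier. -/
theorem exists_mem_frontier {E : Type*} [TopologicalSpace E] {S U : Set E}
    (hS : IsPreconnected S) (hU : IsOpen U) {x y : E} (hx : x ∈ S) (hxU : x ∈ U) (hy : y ∈ S)
    (hyU : y ∉ U) : ∃ z ∈ S, z ∈ frontier U := by
  by_contra! hcon
  have hcl : ∀ z ∈ S, z ∈ closure U → z ∈ U := fun z hz hzc => by
    by_contra hzU
    exact hcon z hz ⟨hzc, fun hi => hzU (interior_subset hi)⟩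
  obtain ⟨z, hz, hz1, hz2⟩ := hS U (closure U)ᶜ hU isClosed_closure.isOpen_compl
    (fun z hz => by
      by_cases h : z ∈ closure U
      · exact Or.inl (hcl z hz h)
      · exact Or.inr h) ⟨x, hx, hxU⟩ ⟨y, hy, fun h => hyU (hcl y hy h)⟩
  exact hz2 (subset_closure hz1)

theorem mem_of_dist_lt_infDist_frontier {U : Set Plane} (hU : IsOpen U) {x y : Plane} (hx : x ∈ U)
    (h : dist x y < Metric.infDist x (frontier U)) : y ∈ U := by
  by_contra hy
  obtain ⟨z, hz, hzf⟩ := exists_mem_frontier (convex_segment x y).isPreconnected hU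
    (left_mem_segment ℝ x y) hx (right_mem_segment ℝ x y) hy
  have h1 := Metric.infDist_le_dist_of_mem (x := x) hzf
  have h2 : dist x z ≤ dist x y := by
    have := dist_add_dist_of_mem_segment hz
    linarith [dist_nonneg (x := z) (y := y)]
  linarith

end MinRes

namespace MinRes

/-! ### The floor, and billiard trajectories over a subgraph -/

/-- The normals at points of the floor are vertical. -/
theorem IsNormal.fst_eq_zero {r : WithTop ℕ∞} (hr : 1 ≤ r) {Ω : Set Plane} (hΩ : IsOpen Ω)
    {B : Set Space} (hB : closure Ω ×ˢ {0} ⊆ B) {y : Plane} (hy : y ∈ Ω) {n : Space}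
    (hn : IsNormal r B (y, 0) n) : n.1 = 0 := by
  obtain ⟨-, h, hs, h0, ⟨c, hc, hd⟩, hout, -⟩ := hn
  have hdiff := hs.differentiableAt hr
  by_contra hne
  have hpos := eventually_pos_of_fderiv_pos (w := ((n.1, 0) : Space)) hdiff h0
    (by rw [hd]; exact mul_pos hc (by
      simpa only [dot, mul_zero, add_zero] using real_inner_self_pos.2 hne))
  have ht := (tendsto_add_smul_zero ((y, 0) : Space) (n.1, 0)).mono_left
    (nhdsWithin_le_nhds (s := Ioi 0))
  have hin := (tendsto_add_smul_zero y n.1).mono_left (nhdsWithin_le_nhds (s := Ioi 0))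
  obtain ⟨s, h1, h2, h3⟩ :=
    (hpos.and ((ht.eventually hout).and (hin.eventually (hΩ.mem_nhds hy)))).exists
  exact h2 h1 (hB ⟨subset_closure h3, by simp⟩)

theorem IsNormal.snd_eq {r : WithTop ℕ∞} (hr : 1 ≤ r) {Ω : Set Plane} (hΩ : IsOpen Ω)
    {B : Set Space} (hB : closure Ω ×ˢ {0} ⊆ B) {y : Plane} (hy : y ∈ Ω) {n : Space}
    (hn : IsNormal r B (y, 0) n) : n.2 = 1 ∨ n.2 = -1 := by
  have h1 := hn.1
  rw [dot_self, hn.fst_eq_zero hr hΩ hB hy] at h1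
  have : n.2 ^ 2 = 1 := by simpa using h1
  exact mul_self_eq_one_iff.1 (by rw [← sq]; exact this)

/-- A descending particle cannot cross the floor. -/
theorem not_passes_floor {r : WithTop ℕ∞} (hr : 1 ≤ r) {Ω : Set Plane} (hΩ : IsOpen Ω)
    {B : Set Space} (hB : closure Ω ×ˢ {0} ⊆ B) {y : Plane} (hy : y ∈ Ω) {w : Space}
    (hw : w.2 < 0) : ¬ Passes r B (y, 0) w := by
  rintro (h | ⟨n, hn, hwn⟩ | h)
  · exact h (subset_closure (hB ⟨subset_closure hy, rfl⟩))
  · have h1 := hn.fst_eq_zero hr hΩ hB hy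
    rcases hn.snd_eq hr hΩ hB hy with h2 | h2 <;> simp [dot, h1, h2] at hwn <;> linarith
  · have hin := (tendsto_add_smul_zero y w.1).mono_left (nhdsWithin_le_nhds (s := Ioi 0))
    obtain ⟨s, h1, h2, h3⟩ := ((h.filter_mono (nhdsWithin_le_nhds (s := Ioi 0))).and
      ((hin.eventually (hΩ.mem_nhds hy)).and self_mem_nhdsWithin)).exists
    refine h1 0 ?_ (hB ⟨subset_closure h2, rfl⟩)
    have : s * w.2 < 0 := mul_neg_of_pos_of_neg h3 hw
    simpa using this

theorem closure_subset_prod {Ω : Set Plane} {M : ℝ} {B : Set Space}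
    (hB : B ⊆ closure Ω ×ˢ Icc 0 M) : closure B ⊆ closure Ω ×ˢ Icc 0 M :=
  closure_minimal hB (isClosed_closure.prod isClosed_Icc)

/-- If with each point the body contains the whole vertical segment down to the floor, then
the normals that a particle meets from inside the cylinder `closure Ω × [0, ∞)` never point down. -/
theorem IsNormal.snd_nonneg {r : WithTop ℕ∞} (hr : 1 ≤ r) {Ω : Set Plane} (hconv : Convex ℝ Ω)
    {M : ℝ} {B : Set Space} (hfloor : closure Ω ×ˢ {0} ⊆ B) (hB : B ⊆ closure Ω ×ˢ Icc 0 M)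
    (hcol : ∀ (y : Plane) (z z' : ℝ), (y, z) ∈ B → 0 ≤ z' → z' ≤ z → (y, z') ∈ B)
    {q w n : Space} {T : ℝ} (hT : 0 < T) (hq : q.1 ∈ closure Ω) (hq2 : 0 ≤ q.2)
    (hn : IsNormal r B (q + T • w) n) (hwn : dot w n < 0) : 0 ≤ n.2 := by
  by_contra! hneg
  have hq' := closure_subset_prod hB (hn.mem_closure hr)
  set p := q + T • w with hp
  have hp2 : p.2 = 0 := by
    -- otherwise the points just below `p`, on the outer side, belong to the column of a point of `B`
    by_contra hne
    have hpos : 0 < p.2 := lt_of_le_of_ne hq'.2.1 (Ne.symm hne)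
    obtain ⟨-, h, hs, h0, ⟨c, hc, hd⟩, hout, hin⟩ := hn
    have hdiff := hs.differentiableAt hr
    have hup := eventually_neg_of_fderiv_neg (w := ((0, 1) : Space)) hdiff h0
      (by rw [hd]; exact mul_neg_of_pos_of_neg hc (by simpa [dot] using hneg))
    have hdown := eventually_pos_of_fderiv_pos (w := ((0, -1) : Space)) hdiff h0
      (by rw [hd]; exact mul_pos hc (by simpa [dot] using hneg))
    have ht1 := (tendsto_add_smul_zero p ((0, 1) : Space)).mono_left
      (nhdsWithin_le_nhds (s := Ioi 0))
    have ht2 := (tendsto_add_smul_zero p ((0, -1) : Space)).mono_left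
      (nhdsWithin_le_nhds (s := Ioi 0))
    obtain ⟨z, hz, hzB⟩ : ∃ z, p.2 ≤ z ∧ (p.1, z) ∈ B := by
      rcases hin with hin | hin
      · obtain ⟨s, h1, h2, h3 : 0 < s⟩ :=
          (hup.and ((ht1.eventually hin).and self_mem_nhdsWithin)).exists
        exact ⟨p.2 + s, by linarith, by
          convert h2 h1 using 1
          ext <;> simp⟩
      · exact ⟨p.2, le_rfl, hin.self_of_nhds h0⟩
    have hsm : ∀ᶠ s in 𝓝[>] (0 : ℝ), s < p.2 := nhdsWithin_le_nhds (gt_mem_nhds hpos)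
    obtain ⟨s, h1, h2, h3, h4 : 0 < s⟩ :=
      (hdown.and ((ht2.eventually hout).and (hsm.and self_mem_nhdsWithin))).exists
    refine h2 h1 ?_
    have := hcol p.1 z (p.2 - s) hzB (by linarith) (by linarith)
    convert this using 1
    ext <;> simp [sub_eq_add_neg]
  -- the floor lies on the inner side, so the normal points out of the cylinder
  have hin : inner ℝ n.1 (q.1 - p.1) ≤ 0 := by
    by_contra! hpos
    obtain ⟨-, h, hs, h0, ⟨c, hc, hd⟩, hout, -⟩ := hn
    have h1 := eventually_pos_of_fderiv_pos (w := ((q.1 - p.1, 0) : Space))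
      (hs.differentiableAt hr) h0 (by rw [hd]; exact mul_pos hc (by simpa [dot] using hpos))
    have ht := (tendsto_add_smul_zero p ((q.1 - p.1, 0) : Space)).mono_left
      (nhdsWithin_le_nhds (s := Ioi 0))
    have hsm : ∀ᶠ s in 𝓝[>] (0 : ℝ), s < 1 := nhdsWithin_le_nhds (gt_mem_nhds one_pos)
    obtain ⟨s, h1, h2, h3, h4 : 0 < s⟩ :=
      (h1.and ((ht.eventually hout).and (hsm.and self_mem_nhdsWithin))).exists
    refine h2 h1 (hfloor ⟨?_, by simp [hp2]⟩)
    exact hconv.closure.add_smul_sub_mem hq'.1 hq ⟨h4.le, h3.le⟩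
  have hp1 : q.1 - p.1 = -(T • w.1) := by simp [hp]
  rw [hp1, inner_neg_right, inner_smul_right] at hin
  have h1 : 0 ≤ inner ℝ n.1 w.1 := by
    by_contra! h
    nlinarith
  rw [dot, real_inner_comm] at hwn
  have h2 : 0 < w.2 := by nlinarith
  have h3 : p.2 = q.2 + T * w.2 := by simp [hp]
  nlinarith [mul_pos hT h2]

/-- Along a trajectory over the body below a graph the vertical velocity never decreases. -/
theorem Escapes.snd_le {r : WithTop ℕ∞} (hr : 1 ≤ r) {Ω : Set Plane} (hconv : Convex ℝ Ω)
    {M : ℝ} {B : Set Space} (hfloor : closure Ω ×ˢ {0} ⊆ B) (hB : B ⊆ closure Ω ×ˢ Icc 0 M)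
    (hcol : ∀ (y : Plane) (z z' : ℝ), (y, z) ∈ B → 0 ≤ z' → z' ≤ z → (y, z') ∈ B)
    {q w v : Space} (h : Escapes r B q w v) (hq : q.1 ∈ closure Ω) (hq2 : 0 ≤ q.2) :
    w.2 ≤ v.2 := by
  induction h with
  | free => exact le_rfl
  | reflect q w w' v T hT _ hrefl _ ih =>
    obtain ⟨n, hn, hwn, rfl⟩ := hrefl
    have hq' := closure_subset_prod hB (hn.mem_closure hr)
    have hn2 := hn.snd_nonneg hr hconv hfloor hB hcol hT hq hq2 hwn
    have := ih hq'.1 hq'.2.1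
    simp only [Prod.snd_sub, Prod.smul_snd, smul_eq_mul] at this
    nlinarith

theorem Escapes.dot_self {r : WithTop ℕ∞} {B : Set Space} {q w v : Space}
    (h : Escapes r B q w v) : dot v v = dot w w := by
  induction h with
  | free => rfl
  | reflect q w w' v T _ _ hrefl _ ih =>
    obtain ⟨n, hn, -, rfl⟩ := hrefl
    rw [ih, dot_reflect hn.1]

/-- A particle that has just been reflected over a point of `Ω`, and whose final velocity points
down, is above the floor. -/
theorem pos_of_reflect {r : WithTop ℕ∞} (hr : 1 ≤ r) {Ω : Set Plane} (hΩ : IsOpen Ω)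
    {B : Set Space} (hfloor : closure Ω ×ˢ {0} ⊆ B) {q w n : Space} {v₂ : ℝ}
    (hn : IsNormal r B q n) (hwn : dot w n < 0) (hn2 : 0 ≤ n.2) (hq2 : 0 ≤ q.2)
    (hv : (w - (2 * dot w n) • n).2 ≤ v₂) (hv2 : v₂ < 0) (hq : q.1 ∈ Ω) : 0 < q.2 := by
  by_contra! hle
  have h0 : q.2 = 0 := le_antisymm hle hq2
  obtain ⟨y, z⟩ := q
  obtain rfl : z = 0 := h0
  have h1 := hn.fst_eq_zero hr hΩ hfloor hq
  have h2 : n.2 = 1 := (hn.snd_eq hr hΩ hfloor hq).resolve_right (by linarith)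
  simp only [dot, h1, h2, inner_zero_right, Prod.snd_sub, Prod.smul_snd, smul_eq_mul] at hwn hv
  linarith

/-- A particle that leaves the body below a graph with a descending velocity `v` had, after each
of its reflections, enough height to reach the boundary of `Ω` at the slope of `v`: it
could only become less steep since. -/
theorem Escapes.height_le {r : WithTop ℕ∞} (hr : 1 ≤ r) {Ω : Set Plane} (hΩ : IsOpen Ω)
    (hconv : Convex ℝ Ω)
    {M : ℝ} {B : Set Space} (hfloor : closure Ω ×ˢ {0} ⊆ B) (hB : B ⊆ closure Ω ×ˢ Icc 0 M)
    (hcol : ∀ (y : Plane) (z z' : ℝ), (y, z) ∈ B → 0 ≤ z' → z' ≤ z → (y, z') ∈ B)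
    {q w v : Space} (h : Escapes r B q w v) (hw : dot w w = 1) (hq : q.1 ∈ closure Ω)
    (hq2 : 0 ≤ q.2) (hqpos : q.1 ∈ Ω → 0 < q.2) (hv : v.2 < 0) :
    -v.2 * Metric.infDist q.1 (frontier Ω) ≤ q.2 * ‖v.1‖ := by
  induction h with
  | free q w hfree =>
    by_contra! hlt
    have hd : 0 < Metric.infDist q.1 (frontier Ω) := by
      have := mul_nonneg hq2 (norm_nonneg w.1)
      by_contra! h
      nlinarith [Metric.infDist_nonneg (x := q.1) (s := frontier Ω)]
    have hqΩ : q.1 ∈ Ω := by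
      by_contra h
      have : q.1 ∈ frontier Ω := ⟨hq, fun h' => h (interior_subset h')⟩
      rw [Metric.infDist_zero_of_mem this] at hd
      exact lt_irrefl _ hd
    have ht : 0 < q.2 / -w.2 := div_pos (hqpos hqΩ) (by linarith)
    have hy : q.1 + (q.2 / -w.2) • w.1 ∈ Ω := by
      refine mem_of_dist_lt_infDist_frontier hΩ hqΩ ?_
      rw [dist_self_add_right, norm_smul, Real.norm_eq_abs, abs_of_pos ht, div_mul_eq_mul_div,
        div_lt_iff₀ (by linarith)]
      linarith
    refine not_passes_floor hr hΩ hfloor hy hv ?_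
    convert hfree _ ht using 1
    have : w.2 ≠ 0 := hv.ne
    ext1
    · simp
    · simp only [Prod.snd_add, Prod.smul_snd, smul_eq_mul]; field_simp; ring
  | reflect q w w' v T hT hfree hrefl hnext ih =>
    obtain ⟨n, hn, hwn, rfl⟩ := hrefl
    have hq' := closure_subset_prod hB (hn.mem_closure hr)
    have hn2 := hn.snd_nonneg hr hconv hfloor hB hcol hT hq hq2 hwn
    have hle := hnext.snd_le hr hconv hfloor hB hcol hq'.1 hq'.2.1
    have hdot : dot (w - (2 * dot w n) • n) (w - (2 * dot w n) • n) = 1 := by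
      rw [dot_reflect hn.1, hw]
    have hvv : dot v v = 1 := by rw [hnext.dot_self, hdot]
    have key := ih hdot hq'.1 hq'.2.1
      (pos_of_reflect hr hΩ hfloor hn hwn hn2 hq'.2.1 hle hv) hv
    have hw2 : w.2 ≤ v.2 := by
      refine le_trans ?_ hle
      simp only [Prod.snd_sub, Prod.smul_snd, smul_eq_mul]
      nlinarith
    have hsteep : -v.2 * ‖w.1‖ ≤ -w.2 * ‖v.1‖ := by
      rw [MinRes.dot_self] at hw hvv
      refine abs_le_of_sq_le_sq' ?_ (mul_nonneg (by linarith) (norm_nonneg _)) |>.2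
      have h1 : ‖w.1‖ ^ 2 = 1 - w.2 ^ 2 := by linarith
      have h2 : ‖v.1‖ ^ 2 = 1 - v.2 ^ 2 := by linarith
      rw [mul_pow, mul_pow, h1, h2]
      nlinarith
    have hlip : Metric.infDist q.1 (frontier Ω) ≤
        Metric.infDist (q + T • w).1 (frontier Ω) + T * ‖w.1‖ := by
      have := Metric.infDist_le_infDist_add_dist (x := q.1) (y := (q + T • w).1) (s := frontier Ω)
      simpa [dist_self_add_right, norm_smul, abs_of_pos hT] using this
    have h3 : (q + T • w).2 = q.2 + T * w.2 := by simp
    rw [h3] at key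
    nlinarith [mul_le_mul_of_nonneg_left hsteep hT.le,
      mul_le_mul_of_nonneg_left hlip (by linarith : (0 : ℝ) ≤ -v.2)]

theorem dot_down_down : dot down down = 1 := by simp [dot, down]

theorem ScattersTo.dot_self {r : WithTop ℕ∞} {B : Set Space} {x : Plane} {v : Space}
    (h : ScattersTo r B x v) : dot v v = 1 := by
  obtain ⟨z₀, -, h⟩ := h
  rw [h.dot_self, dot_down_down]

/-- The body below a graph of height at most `M` cannot scatter a particle over `x` more steeply
downwards than from height `M` to the nearest point of the boundary of the floor. -/
theorem ScattersTo.slope_le {r : WithTop ℕ∞} (hr : 1 ≤ r) {Ω : Set Plane} (hΩ : IsOpen Ω)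
    (hconv : Convex ℝ Ω)
    {M : ℝ} {B : Set Space} (hfloor : closure Ω ×ˢ {0} ⊆ B) (hB : B ⊆ closure Ω ×ˢ Icc 0 M)
    (hcol : ∀ (y : Plane) (z z' : ℝ), (y, z) ∈ B → 0 ≤ z' → z' ≤ z → (y, z') ∈ B)
    {x : Plane} (hx : x ∈ Ω) {v : Space} (h : ScattersTo r B x v) (hv : v.2 < 0) :
    -v.2 * Metric.infDist x (frontier Ω) ≤ M * ‖v.1‖ := by
  obtain ⟨z₀, hz₀, h⟩ := h
  have hz₀pos : 0 < z₀ := by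
    by_contra! h0
    exact hz₀ 0 h0 (subset_closure (hfloor ⟨subset_closure hx, rfl⟩))
  generalize hq : ((x, z₀) : Space) = q at h
  generalize hw : down = w at h
  cases h with
  | free _ _ hfree =>
    refine (not_passes_floor hr hΩ hfloor hx (w := down) (by simp [down]) ?_).elim
    have := hfree z₀ hz₀pos
    rw [← hq, ← hw] at this
    convert this using 1
    ext1 <;> simp [down]
  | reflect _ _ w' _ T hT hfree hrefl hnext =>
    obtain ⟨n, hn, hwn, rfl⟩ := hrefl
    have hq1 : q.1 ∈ closure Ω := by rw [← hq]; exact subset_closure hx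
    have hq' := closure_subset_prod hB (hn.mem_closure hr)
    have hn2 := hn.snd_nonneg hr hconv hfloor hB hcol hT hq1 (by rw [← hq]; exact hz₀pos.le) hwn
    have hle := hnext.snd_le hr hconv hfloor hB hcol hq'.1 hq'.2.1
    have key := hnext.height_le hr hΩ hconv hfloor hB hcol
      (by rw [dot_reflect hn.1, ← hw, dot_down_down]) hq'.1 hq'.2.1
      (pos_of_reflect hr hΩ hfloor hn hwn hn2 hq'.2.1 hle hv) hv
    have hx' : (q + T • w).1 = x := by rw [← hq, ← hw]; simp [down]
    rw [hx'] at key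
    exact key.trans (mul_le_mul_of_nonneg_right hq'.2.2 (norm_nonneg _))

end MinRes

namespace MinRes

/-! ### The single reflection under the single impact condition -/

/-- The velocity, after one elastic reflection, of a particle that falls vertically on a graph with
gradient `g`. -/
noncomputable def reflected (g : Plane) : Space :=
  (2 / (1 + ‖g‖ ^ 2)) • ((-g, (1 - ‖g‖ ^ 2) / 2) : Space)

theorem fderiv_eq_inner_gradient {u : Plane → ℝ} {x : Plane} (w : Plane) :
    fderiv ℝ u x w = inner ℝ (gradient u x) w := by
  rw [gradient, InnerProductSpace.toDual_symm_apply]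

/-- At a point of the upper graph where this graph is smooth, every normal of the body is
a normal of the graph: otherwise the body would contain points above its upper graph. -/
theorem IsNormal.fst_eq_of_graph {r : WithTop ℕ∞} (hr : 1 ≤ r) {B : Set Space} {u : Plane → ℝ}
    (hB : ∀ p ∈ B, p.2 ≤ u p.1) {x : Plane} (hu : DifferentiableAt ℝ u x) {n : Space}
    (hn : IsNormal r B (x, u x) n) : n.1 = -n.2 • gradient u x := by
  set N : Space := (-gradient u x, 1) with hN
  set k := dot n N with hk
  set w : Space := N - k • n with hw
  have hnw : dot n w = 0 := by rw [hw, dot_sub_right, dot_smul_right, hn.1, ← hk]; ring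
  have hNw : dot N w = dot w w := by
    have h1 : dot w w = dot N w - k * dot n w := by
      rw [dot_comm w w]
      conv_lhs => rw [dot_comm]
      nth_rewrite 2 [hw]
      rw [dot_sub_right, dot_smul_right, dot_comm w N, dot_comm w n]
    rw [h1, hnw]; ring
  rcases eq_or_ne (dot w w) 0 with h0 | h0
  · rw [dot_self] at h0
    have h1 : w.1 = 0 := by
      have : ‖w.1‖ ^ 2 = 0 := le_antisymm (by nlinarith [sq_nonneg w.2]) (sq_nonneg _)
      simpa using this
    have h2 : w.2 = 0 := by
      have : w.2 ^ 2 = 0 := le_antisymm (by nlinarith [sq_nonneg ‖w.1‖]) (sq_nonneg _)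
      simpa using this
    simp only [hw, hN, Prod.fst_sub, Prod.snd_sub, Prod.smul_fst, Prod.smul_snd,
      smul_eq_mul] at h1 h2
    have h3 : gradient u x = -(k • n.1) := by
      have := sub_eq_zero.1 h1
      rw [← this, neg_neg]
    rw [h3, neg_smul, smul_neg, neg_neg, smul_smul]
    have h4 : n.2 * k = 1 := by linarith
    rw [h4, one_smul]
  exfalso
  set δ := dot w w with hδ
  have hδpos : 0 < δ := lt_of_le_of_ne (by rw [hδ, dot_self]; positivity) (Ne.symm h0)
  set κ := δ / (2 * (|k| + 1)) with hκ
  have hκpos : 0 < κ := by positivity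
  have hκk : κ * |k| ≤ δ / 2 := by
    rw [hκ, div_mul_eq_mul_div, div_le_div_iff₀ (by positivity) (by norm_num)]
    nlinarith [abs_nonneg k]
  have hmem := hn.eventually_exists_mem hr (w := w) (m := κ • n)
    (by rw [dot_add_right, hnw, dot_smul_right, hn.1]; linarith)
    (by rw [dot_sub_right, hnw, dot_smul_right, hn.1]; linarith)
  set ε := δ / (4 * (‖w‖ + ‖κ • n‖ + 1)) with hε
  have hεpos : 0 < ε := by positivity
  have hεs : ε * (‖w‖ + ‖κ • n‖) ≤ δ / 4 := by
    rw [hε, div_mul_eq_mul_div, div_le_div_iff₀ (by positivity) (by norm_num)]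
    nlinarith [norm_nonneg w, norm_nonneg (κ • n)]
  have hder := (hasFDerivAt_iff_isLittleO_nhds_zero.1 hu.hasFDerivAt).def hεpos
  obtain ⟨ρ, hρ, hball⟩ := Metric.eventually_nhds_iff_ball.1 hder
  have hsmall : ∀ᶠ s in 𝓝[>] (0 : ℝ), s * (‖w‖ + ‖κ • n‖) < ρ := by
    have : Continuous fun s : ℝ => s * (‖w‖ + ‖κ • n‖) := by fun_prop
    have := (this.tendsto 0).mono_left (nhdsWithin_le_nhds (s := Ioi 0))
    rw [zero_mul] at this
    exact this.eventually (gt_mem_nhds hρ)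
  obtain ⟨s, ⟨τ, hτ, hτB⟩, hs2, hs3 : 0 < s⟩ := (hmem.and (hsmall.and self_mem_nhdsWithin)).exists
  set d : Space := w + τ • κ • n with hd
  have hdn : ‖d‖ ≤ ‖w‖ + ‖κ • n‖ := by
    refine (norm_add_le _ _).trans (add_le_add_right ?_ _)
    rw [norm_smul, Real.norm_eq_abs]
    exact mul_le_of_le_one_left (norm_nonneg _) (abs_le.2 hτ)
  have hd1 : ‖s • d.1‖ ≤ s * (‖w‖ + ‖κ • n‖) := by
    rw [norm_smul, Real.norm_eq_abs, abs_of_pos hs3]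
    exact mul_le_mul_of_nonneg_left ((norm_fst_le d).trans hdn) hs3.le
  have h1 := hball (s • d.1) (by rw [mem_ball_zero_iff]; exact lt_of_le_of_lt hd1 hs2)
  rw [map_smul, fderiv_eq_inner_gradient, smul_eq_mul] at h1
  have h2 := hB _ hτB
  simp only [Prod.fst_add, Prod.snd_add, Prod.smul_fst, Prod.smul_snd, smul_eq_mul] at h2
  have h3 : δ / 2 ≤ dot N d := by
    rw [hd, dot_add_right, hNw, dot_smul_right, dot_smul_right, dot_comm N n, ← hk]
    have : |τ * (κ * k)| ≤ δ / 2 := by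
      rw [abs_mul, abs_mul, abs_of_pos hκpos]
      exact (mul_le_of_le_one_left (by positivity) (abs_le.2 hτ)).trans hκk
    linarith [(abs_le.1 this).1]
  have h4 : dot N d = d.2 - inner ℝ (gradient u x) d.1 := by
    simp only [dot, hN, inner_neg_left]; ring
  have h5 := (le_abs_self _).trans h1
  have h6 : ε * ‖s • d.1‖ ≤ s * (δ / 4) := by
    have := mul_le_mul_of_nonneg_left hd1 hεpos.le
    nlinarith
  nlinarith

section SingleImpact

variable {r : WithTop ℕ∞} {Ω : Set Plane} {B : Set Space} {u : Plane → ℝ} {x : Plane}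

theorem below_ray (hB : ∀ p ∈ B, p.1 ∈ closure Ω ∧ p.2 ≤ u p.1)
    (hray : ∀ t : ℝ, 0 < t → x - t • gradient u x ∈ closure Ω →
      (u (x - t • gradient u x) - u x) / t ≤ 1 / 2 * (1 - ‖gradient u x‖ ^ 2))
    {t : ℝ} (ht : 0 < t) {z : ℝ}
    (hz : (((x, u x) : Space) + t • reflected (gradient u x)).2 < z) :
    ((((x, u x) : Space) + t • reflected (gradient u x)).1, z) ∉ B := by
  intro hmem
  obtain ⟨h1, h2⟩ := hB _ hmem
  set g := gradient u x
  set k := 2 / (1 + ‖g‖ ^ 2) with hk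
  have hkpos : 0 < k := by positivity
  have h3 : (((x, u x) : Space) + t • reflected g).1 = x - (t * k) • g := by
    simp [reflected, ← hk, smul_smul, sub_eq_add_neg]
  have h4 : (((x, u x) : Space) + t • reflected g).2 = u x + t * k * ((1 - ‖g‖ ^ 2) / 2) := by
    simp [reflected, ← hk]; ring
  rw [h3] at h1 h2
  rw [h4] at hz
  have := hray (t * k) (mul_pos ht hkpos) h1
  rw [div_le_iff₀ (mul_pos ht hkpos)] at this
  simp only at h2
  nlinarith

/-- A ray that stays on or above the body is never reflected again. -/
theorem Escapes.eq_of_ray {q w v : Space} (hr : 1 ≤ r)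
    (hray : ∀ t : ℝ, 0 < t → NothingAbove B (q + t • w)) (h : Escapes r B q w v) : v = w := by
  cases h with
  | free => rfl
  | reflect _ _ w' _ T hT _ hrefl _ =>
    exfalso
    obtain ⟨n, hn, hwn, -⟩ := hrefl
    -- the vertical plane through the ray meets the boundary surface transversally, so it contains
    -- points of `B` above the ray
    set c : ℝ := -n.2 / dot n w with hc
    have hnw : dot n w < 0 := by rwa [dot_comm]
    have hup : dot n ((0, 1) : Space) = n.2 := by simp [dot]
    have h0 : dot n (((0, 1) : Space) + c • w) = 0 := by
      rw [dot_add_right, dot_smul_right, hup, hc]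
      field_simp [hnw.ne]
      ring
    have hmem := hn.eventually_exists_mem hr (w := ((0, 1) : Space) + c • w) (m := (-1 : ℝ) • w)
      (by rw [dot_add_right, h0, dot_smul_right]; linarith)
      (by rw [dot_sub_right, h0, dot_smul_right]; linarith)
    have hsmall : ∀ᶠ s in 𝓝[>] (0 : ℝ), s * (|c| + 1) < T := by
      have : Continuous fun s : ℝ => s * (|c| + 1) := by fun_prop
      have := (this.tendsto 0).mono_left (nhdsWithin_le_nhds (s := Ioi 0))
      rw [zero_mul] at this
      exact this.eventually (gt_mem_nhds hT)
    obtain ⟨s, ⟨τ, hτ, hτB⟩, hs2, hs3 : 0 < s⟩ :=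
      (hmem.and (hsmall.and self_mem_nhdsWithin)).exists
    have ht : 0 < T + s * (c - τ) := by
      have h1 : -(|c| + 1) ≤ c - τ := by linarith [neg_abs_le c, hτ.2]
      nlinarith
    refine hray _ ht ((q + (T + s * (c - τ)) • w).2 + s) (by linarith) ?_
    convert hτB using 1
    ext1
    · simp only [Prod.fst_add, Prod.smul_fst, zero_add]
      module
    · simp only [Prod.snd_add, Prod.smul_snd, smul_eq_mul]
      ring

/-- Above a continuity point of the upper graph a falling particle has not yet met the body. -/
theorem not_mem_closure_of_lt (hB : ∀ p ∈ B, p.2 ≤ u p.1) (hu : ContinuousAt u x) {z : ℝ}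
    (hz : u x < z) : ((x, z) : Space) ∉ closure B := by
  intro hcl
  have h1 : ∀ᶠ p in 𝓝 ((x, z) : Space), u p.1 < p.2 := by
    have ha : Tendsto (fun p : Space => u p.1) (𝓝 (x, z)) (𝓝 (u x)) :=
      hu.tendsto.comp continuousAt_fst
    have hb : Tendsto (fun p : Space => p.2) (𝓝 (x, z)) (𝓝 z) := continuousAt_snd
    exact ha.eventually_lt hb hz
  obtain ⟨p, hp, hpB⟩ := mem_closure_iff_nhds.1 hcl _ h1
  exact absurd (hB p hpB) (not_le.2 hp)

theorem reflected_eq {n : Space} {g : Plane} (hn : dot n n = 1) (h1 : n.1 = -n.2 • g) :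
    down - (2 * dot down n) • n = reflected g := by
  have h2 : dot down n = -n.2 := by simp [dot, down]
  have h3 : n.2 ^ 2 * (1 + ‖g‖ ^ 2) = 1 := by
    rw [dot_self, h1, norm_smul, norm_neg, mul_pow, Real.norm_eq_abs, sq_abs] at hn
    linarith
  have h4 : 2 / (1 + ‖g‖ ^ 2) = 2 * n.2 ^ 2 := by
    rw [div_eq_iff (by positivity)]; linarith
  rw [reflected, h2, h4]
  ext1
  · simp only [down, h1, Prod.fst_sub, Prod.smul_fst]
    module
  · simp only [down, Prod.snd_sub, Prod.smul_snd, smul_eq_mul]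
    linear_combination h3

/-- Under the single impact condition the final velocity over a regular point `x` of the upper graph
can only be the one after a single reflection from this graph. -/
theorem ScattersTo.eq_reflected (hr : 1 ≤ r)
    (hB : ∀ p ∈ B, p.1 ∈ closure Ω ∧ p.2 ≤ u p.1)
    (hsup : ∀ z < u x, ∃ z', z < z' ∧ ((x, z') : Space) ∈ B) (hu : SmoothNear r u x)
    (hray : ∀ t : ℝ, 0 < t → x - t • gradient u x ∈ closure Ω →
      (u (x - t • gradient u x) - u x) / t ≤ 1 / 2 * (1 - ‖gradient u x‖ ^ 2))
    {v : Space} (h : ScattersTo r B x v) : v = reflected (gradient u x) := by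
  obtain ⟨z₀, hz₀, h⟩ := h
  have hB' : ∀ p ∈ B, p.2 ≤ u p.1 := fun p hp => (hB p hp).2
  have hdiff := hu.differentiableAt hr
  have htop : ((x, u x) : Space) ∈ closure B := by
    rw [Metric.mem_closure_iff]
    intro ε hε
    obtain ⟨z', h1, h2⟩ := hsup (u x - ε) (by linarith)
    refine ⟨_, h2, ?_⟩
    have := hB' _ h2
    rw [Prod.dist_eq, dist_self, max_eq_right dist_nonneg, Real.dist_eq, abs_lt]
    simp only at this ⊢
    constructor <;> linarith
  have hlt : u x < z₀ := by
    by_contra! hle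
    exact hz₀ _ hle htop
  have hfall : ∀ t : ℝ, ((x, z₀) : Space) + t • down = (x, z₀ - t) := fun t => by
    ext1 <;> simp [down, sub_eq_add_neg]
  have hT : ((x, z₀) : Space) + (z₀ - u x) • down = (x, u x) := by rw [hfall]; simp
  have hhit : ¬ Passes r B (x, u x) down := by
    rintro (h | ⟨n, hn, h0⟩ | h)
    · exact h htop
    · have h1 := hn.fst_eq_of_graph hr hB' hdiff
      have h2 : n.2 = 0 := by simpa [dot, down] using h0
      have h3 := hn.1
      rw [MinRes.dot_self, h1, h2] at h3
      simp at h3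
    · obtain ⟨s, h1, h2 : 0 < s⟩ :=
        ((h.filter_mono (nhdsWithin_le_nhds (s := Ioi 0))).and self_mem_nhdsWithin).exists
      obtain ⟨z', h3, h4⟩ := hsup (u x - s) (by linarith)
      refine h1 z' ?_ ?_
      · simp [down]; linarith
      · simpa [down] using h4
  generalize hq : ((x, z₀) : Space) = q at h
  generalize hw : down = w at h
  cases h with
  | free _ _ hfree =>
    subst hq
    have := hfree (z₀ - u x) (by linarith)
    rw [← hw, hT] at this
    exact (hhit this).elim
  | reflect _ _ w' _ T hTpos hfree hrefl hnext =>
    subst hq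
    subst hw
    obtain ⟨n, hn, hwn, rfl⟩ := hrefl
    rcases lt_trichotomy T (z₀ - u x) with hlt' | rfl | hgt
    · have := hn.mem_closure hr
      rw [hfall] at this
      exact (not_mem_closure_of_lt hB' hdiff.continuousAt (by linarith) this).elim
    · rw [hT] at hn hnext
      rw [reflected_eq hn.1 (hn.fst_eq_of_graph hr hB' hdiff)] at hnext
      exact hnext.eq_of_ray hr fun t ht z hz => below_ray hB hray ht hz
    · have := hfree (z₀ - u x) (by linarith) hgt
      rw [hT] at this
      exact (hhit this).elim

/-- Conversely, this velocity is taken if the body contains the graph near the point of impact. -/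
theorem scattersTo_reflected (hr : 1 ≤ r)
    (hB : ∀ p ∈ B, p.1 ∈ closure Ω ∧ p.2 ≤ u p.1)
    (hgraph : ∀ᶠ y in 𝓝 x, ((y, u y) : Space) ∈ B) (hu : SmoothNear r u x)
    (hray : ∀ t : ℝ, 0 < t → x - t • gradient u x ∈ closure Ω →
      (u (x - t • gradient u x) - u x) / t ≤ 1 / 2 * (1 - ‖gradient u x‖ ^ 2)) :
    ScattersTo r B x (reflected (gradient u x)) := by
  have hB' : ∀ p ∈ B, p.2 ≤ u p.1 := fun p hp => (hB p hp).2
  have hdiff := hu.differentiableAt hr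
  set g := gradient u x with hg
  refine ⟨u x + 1, fun z hz => not_mem_closure_of_lt hB' hdiff.continuousAt (by linarith), ?_⟩
  have hfall : ∀ t : ℝ, ((x, u x + 1) : Space) + t • down = (x, u x + 1 - t) := fun t => by
    ext1 <;> simp [down, sub_eq_add_neg]
  have hT : ((x, u x + 1) : Space) + (1 : ℝ) • down = (x, u x) := by rw [hfall]; simp
  set a : ℝ := Real.sqrt (1 + ‖g‖ ^ 2) with ha
  have hapos : 0 < a := by positivity
  have ha2 : a ^ 2 = 1 + ‖g‖ ^ 2 := Real.sq_sqrt (by positivity)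
  set n : Space := a⁻¹ • ((-g, 1) : Space) with hn
  have hnn : dot n n = 1 := by
    rw [hn, dot_smul_right, dot_comm, dot_smul_right, dot_self]
    simp only [norm_neg]
    field_simp
    linarith
  have hn1 : n.1 = -n.2 • g := by simp [hn]
  refine Escapes.reflect _ _ (reflected g) _ 1 one_pos (fun t _ ht => ?_) ?_ ?_
  · left
    rw [hfall]
    exact not_mem_closure_of_lt hB' hdiff.continuousAt (by linarith)
  · rw [hT]
    refine ⟨n, ⟨hnn, fun p => p.2 - u p.1, ?_, by simp, ⟨a, hapos, fun w => ?_⟩, ?_, ?_⟩, ?_,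
      (reflected_eq hnn hn1).symm⟩
    · obtain ⟨U, hU, hxU, hf⟩ := hu
      refine ⟨Prod.fst ⁻¹' U, hU.preimage continuous_fst, hxU, ?_⟩
      exact contDiff_snd.contDiffOn.sub (hf.comp contDiff_fst.contDiffOn fun p hp => hp)
    · have h1 : HasFDerivAt (fun p : Space => p.2 - u p.1)
          (ContinuousLinearMap.snd ℝ Plane ℝ -
            (fderiv ℝ u x).comp (ContinuousLinearMap.fst ℝ Plane ℝ)) (x, u x) :=
        hasFDerivAt_snd.sub (HasFDerivAt.comp (x, u x) (by exact hdiff.hasFDerivAt) hasFDerivAt_fst)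
      rw [h1.fderiv, hn, dot_comm, dot_smul_right, dot_comm]
      simp only [_root_.sub_apply, ContinuousLinearMap.coe_snd',
        ContinuousLinearMap.comp_apply, ContinuousLinearMap.coe_fst', fderiv_eq_inner_gradient, dot,
        inner_neg_left, ← hg]
      field_simp
      ring
    · refine Eventually.of_forall fun p hp hpB => ?_
      have := hB' p hpB
      linarith
    · right
      have : Tendsto (fun p : Space => p.1) (𝓝 (x, u x)) (𝓝 x) := continuousAt_fst
      filter_upwards [this.eventually hgraph] with p hp h0
      convert hp using 1
      ext1
      · rfl
      · linarith
    · have : 0 < a⁻¹ := inv_pos.2 hapos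
      simp [dot, down, hn, hapos]
  · rw [hT]
    refine Escapes.free _ _ fun t ht => ?_
    right; right
    filter_upwards [lt_mem_nhds (show -t < 0 by linarith)] with s hs z hz
    rw [add_assoc, ← add_smul] at hz ⊢
    exact below_ray hB hray (by linarith) hz

end SingleImpact

/-- A particle that falls beside the closed body `closure B` is not deflected. -/
theorem ScattersTo.eq_down {r : WithTop ℕ∞} (hr : 1 ≤ r) {Ω : Set Plane} {B : Set Space}
    (hB : ∀ p ∈ B, p.1 ∈ closure Ω) {x : Plane} (hx : x ∉ closure Ω) {v : Space}
    (h : ScattersTo r B x v) : v = down := by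
  have hcl : ∀ z : ℝ, ((x, z) : Space) ∉ closure B := fun z hz =>
    hx (closure_minimal (s := B) (t := Prod.fst ⁻¹' closure Ω) hB
      (isClosed_closure.preimage continuous_fst) hz)
  obtain ⟨z₀, -, h⟩ := h
  refine h.eq_of_ray hr fun t _ z _ hz => hcl z (subset_closure ?_)
  simpa [down] using hz

theorem scattersTo_down {r : WithTop ℕ∞} {Ω : Set Plane} {B : Set Space}
    (hB : ∀ p ∈ B, p.1 ∈ closure Ω) {x : Plane} (hx : x ∉ closure Ω) :
    ScattersTo r B x down := by
  have hcl : ∀ z : ℝ, ((x, z) : Space) ∉ closure B := fun z hz =>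
    hx (closure_minimal (s := B) (t := Prod.fst ⁻¹' closure Ω) hB
      (isClosed_closure.preimage continuous_fst) hz)
  refine ⟨0, fun z _ => hcl z, Escapes.free _ _ fun t _ => Or.inl ?_⟩
  have : ((x, 0) : Space) + t • down = (x, -t) := by ext1 <;> simp [down]
  rw [this]
  exact hcl _

end MinRes

namespace MinRes

/-! ### The lower bound for the resistance -/

theorem integrand_le {M d : ℝ} (hM : 0 < M) {v : Space} (hv : dot v v = 1)
    (h : v.2 < 0 → -v.2 * d ≤ M * ‖v.1‖) (hd : 0 ≤ d) :
    1 / 2 * (1 - M / Real.sqrt (M ^ 2 + d ^ 2)) ≤ (1 + v.2) / 2 := by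
  have hs : 0 < Real.sqrt (M ^ 2 + d ^ 2) := by positivity
  rcases le_or_gt 0 v.2 with h0 | h0
  · have : 0 ≤ M / Real.sqrt (M ^ 2 + d ^ 2) := by positivity
    linarith
  · have h1 := h h0
    rw [dot_self] at hv
    have h2 : -v.2 ≤ M / Real.sqrt (M ^ 2 + d ^ 2) := by
      rw [le_div_iff₀ hs]
      refine le_of_sq_le_sq ?_ hM.le
      rw [mul_pow, Real.sq_sqrt (by positivity)]
      have h3 : (-v.2 * d) ^ 2 ≤ (M * ‖v.1‖) ^ 2 :=
        pow_le_pow_left₀ (mul_nonneg (by linarith) hd) h1 2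
      nlinarith
    linarith

theorem integrand_mem {M d : ℝ} (hM : 0 < M) :
    0 ≤ 1 / 2 * (1 - M / Real.sqrt (M ^ 2 + d ^ 2)) ∧
      1 / 2 * (1 - M / Real.sqrt (M ^ 2 + d ^ 2)) ≤ 1 := by
  have hs : 0 < Real.sqrt (M ^ 2 + d ^ 2) := by positivity
  have h1 : M / Real.sqrt (M ^ 2 + d ^ 2) ≤ 1 := by
    rw [div_le_one hs]
    exact Real.le_sqrt_of_sq_le (by nlinarith [sq_nonneg d])
  have h2 : 0 ≤ M / Real.sqrt (M ^ 2 + d ^ 2) := by positivity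
  constructor <;> linarith

theorem integrableOn_phi {Ω : Set Plane} (hbdd : Bornology.IsBounded Ω) {M : ℝ} (hM : 0 < M) :
    IntegrableOn (fun x => 1 / 2 * (1 - M / Real.sqrt (M ^ 2 + Metric.infDist x (frontier Ω) ^ 2)))
      Ω := by
  have : IsFiniteMeasure (volume.restrict Ω) := ⟨by simpa using hbdd.measure_lt_top⟩
  refine Integrable.of_bound (C := 1) (Continuous.aestronglyMeasurable ?_) ?_
  · have : ∀ x : Plane, Real.sqrt (M ^ 2 + Metric.infDist x (frontier Ω) ^ 2) ≠ 0 :=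
      fun x => by positivity
    fun_prop (disch := exact this _)
  · refine Eventually.of_forall fun x => ?_
    have := integrand_mem (d := Metric.infDist x (frontier Ω)) hM
    rw [Real.norm_eq_abs, abs_le]
    constructor <;> linarith

theorem snd_mem_of_dot_self {v : Space} (hv : dot v v = 1) : |v.2| ≤ 1 := by
  rw [dot_self] at hv
  rw [← sq_le_one_iff_abs_le_one]
  nlinarith [sq_nonneg ‖v.1‖]

theorem finalVelocity_spec {r : WithTop ℕ∞} {B : Set Space} {x : Plane}
    (h : ∃ v, ScattersTo r B x v) : ScattersTo r B x (finalVelocity r B x) :=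
  Classical.epsilon_spec h

theorem phi_le_resistance {r : WithTop ℕ∞} {Ω : Set Plane} (hbdd : Bornology.IsBounded Ω) {M : ℝ}
    (hM : 0 < M) {B : Set Space} (hreg : RegularScattering r B)
    (h : ∀ᵐ x ∂volume.restrict Ω, ∀ v, ScattersTo r B x v → v.2 < 0 →
      -v.2 * Metric.infDist x (frontier Ω) ≤ M * ‖v.1‖) :
    phi Ω M ≤ resistance r Ω B := by
  have : IsFiniteMeasure (volume.restrict Ω) := ⟨by simpa using hbdd.measure_lt_top⟩
  have hex : ∀ᵐ x ∂volume.restrict Ω, ScattersTo r B x (finalVelocity r B x) :=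
    (ae_restrict_of_ae hreg.1).mono fun x hx => finalVelocity_spec hx
  refine integral_mono_ae (integrableOn_phi hbdd hM) ?_ ?_
  · refine Integrable.of_bound (C := 1) ?_ ?_
    · exact (((measurable_snd.comp_aemeasurable hreg.2).const_add 1).div_const
        2).restrict.aestronglyMeasurable
    · filter_upwards [hex] with x hx
      have := abs_le.1 (snd_mem_of_dot_self hx.dot_self)
      rw [Real.norm_eq_abs, abs_le]
      constructor <;> linarith
  · filter_upwards [hex, h] with x hx hx'
    exact integrand_le hM hx.dot_self (hx' _ hx) Metric.infDist_nonneg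

theorem phi_le_of_mem_classU {r : WithTop ℕ∞} (hr : 1 ≤ r) {Ω : Set Plane} (hconv : Convex ℝ Ω)
    (hopen : IsOpen Ω) (hbdd : Bornology.IsBounded Ω) {M : ℝ} (hM : 0 < M) {u : Plane → ℝ}
    (hu : u ∈ classU r Ω M) : phi Ω M ≤ resistance r Ω (subgraph Ω u) := by
  obtain ⟨-, hbd, hreg⟩ := hu
  refine phi_le_resistance hbdd hM hreg ?_
  refine (ae_restrict_mem hopen.measurableSet).mono fun x hx v hv hv2 => ?_
  refine hv.slope_le hr hopen hconv ?_ ?_ ?_ hx hv2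
  · rintro ⟨y, z⟩ ⟨hy, rfl⟩
    exact ⟨hy, le_rfl, (hbd y hy).1⟩
  · rintro p ⟨h1, h2, h3⟩
    exact ⟨h1, h2, h3.trans (hbd _ h1).2⟩
  · rintro y z z' ⟨h1, h2, h3⟩ h4 h5
    exact ⟨h1, h4, h5.trans h3⟩

/-- A ray from a point of a bounded open set meets the frontier. -/
theorem exists_ray_mem_frontier {Ω : Set Plane} (hopen : IsOpen Ω) (hbdd : Bornology.IsBounded Ω)
    {x g : Plane} (hx : x ∈ Ω) (hg : g ≠ 0) : ∃ t : ℝ, 0 < t ∧ x - t • g ∈ frontier Ω := by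
  obtain ⟨R, hR⟩ := hbdd.subset_closedBall x
  have hgpos : 0 < ‖g‖ := norm_pos_iff.2 hg
  have hcont : Continuous fun t : ℝ => x - t • g := by fun_prop
  have hpre : IsPreconnected ((fun t : ℝ => x - t • g) '' Ici 0) :=
    isPreconnected_Ici.image _ hcont.continuousOn
  have hout : x - ((|R| + 1) / ‖g‖) • g ∉ Ω := by
    intro h
    have h1 := hR h
    rw [Metric.mem_closedBall, dist_eq_norm, sub_sub_cancel_left, norm_neg, norm_smul,
      Real.norm_eq_abs, abs_of_pos (by positivity), div_mul_cancel₀ _ hgpos.ne'] at h1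
    linarith [le_abs_self R]
  obtain ⟨_, ⟨t, ht, rfl⟩, htf⟩ := exists_mem_frontier hpre hopen
    (x := x) ⟨0, by simp, by simp⟩ hx ⟨(|R| + 1) / ‖g‖, by simp only [mem_Ici]; positivity, rfl⟩ hout
  refine ⟨t, lt_of_le_of_ne ht ?_, htf⟩
  rintro rfl
  simp only [zero_smul, sub_zero] at htf
  exact (hopen.frontier_eq ▸ htf).2 hx

theorem upperEnvelope_isLUB {Ω : Set Plane} {M : ℝ} {B : Set Space} (h1 : closure Ω ×ˢ {0} ⊆ B)
    (h2 : B ⊆ closure Ω ×ˢ Icc 0 M) {x : Plane} (hx : x ∈ closure Ω) :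
    IsLUB {z : ℝ | ((x, z) : Space) ∈ B} (upperEnvelope B x) :=
  isLUB_csSup ⟨0, h1 ⟨hx, rfl⟩⟩ ⟨M, fun _ hz => (h2 hz).2.2⟩

theorem phi_le_of_mem_classSigma {r : WithTop ℕ∞} (hr : 1 ≤ r) {Ω : Set Plane}
    (hopen : IsOpen Ω) (hbdd : Bornology.IsBounded Ω) {M : ℝ} (hM : 0 < M)
    {B : Set Space} (hB : B ∈ classSigma r Ω M) : phi Ω M ≤ resistance r Ω B := by
  obtain ⟨⟨-, hfloor, hsub, hreg⟩, hpw, hsic⟩ := hB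
  refine phi_le_resistance hbdd hM hreg ?_
  have hsing : ∀ᵐ x : Plane, ¬ (x ∈ Ω ∧ ¬ SmoothNear r (upperEnvelope B) x) := by
    rw [ae_iff]
    simp only [not_not]
    exact CoveredByArcs.volume_eq_zero hr hpw
  filter_upwards [ae_restrict_mem hopen.measurableSet, ae_restrict_of_ae hsing] with x hx hreg v hv hv2
  have hsm : SmoothNear r (upperEnvelope B) x := by
    by_contra h
    exact hreg ⟨hx, h⟩
  set u := upperEnvelope B with hu
  set g := gradient u x with hg
  have hlub := fun y (hy : y ∈ closure Ω) => upperEnvelope_isLUB hfloor hsub hy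
  have hv' := hv.eq_reflected (u := u) hr
    (fun p hp => ⟨(hsub hp).1, (hlub p.1 (hsub hp).1).1 hp⟩)
    (fun z hz => by
      obtain ⟨z', h1, h2⟩ := (lt_isLUB_iff (hlub x (subset_closure hx))).1 hz
      exact ⟨z', h2, h1⟩) hsm (hsic x hx hsm)
  rw [← hg] at hv'
  set k := 2 / (1 + ‖g‖ ^ 2) with hk
  have hkpos : 0 < k := by positivity
  have h2 : v.2 = k * ((1 - ‖g‖ ^ 2) / 2) := by simp [hv', reflected, ← hk]
  have h1 : ‖v.1‖ = k * ‖g‖ := by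
    simp [hv', reflected, ← hk, norm_smul, abs_of_pos hkpos]
  have hg1 : 1 < ‖g‖ ^ 2 := by
    by_contra! h
    have : 0 ≤ k * ((1 - ‖g‖ ^ 2) / 2) := mul_nonneg hkpos.le (by linarith)
    linarith
  have hg0 : g ≠ 0 := by
    intro h
    rw [h] at hg1
    norm_num at hg1
  obtain ⟨t, ht, htf⟩ := exists_ray_mem_frontier hopen hbdd hx hg0
  have hd : Metric.infDist x (frontier Ω) ≤ t * ‖g‖ := by
    refine (Metric.infDist_le_dist_of_mem htf).trans_eq ?_
    rw [dist_eq_norm, sub_sub_cancel, norm_smul, Real.norm_eq_abs, abs_of_pos ht]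
  have htc : x - t • g ∈ closure Ω := frontier_subset_closure htf
  have hexit := hsic x hx hsm t ht htc
  rw [div_le_iff₀ ht, ← hg] at hexit
  have hu0 : 0 ≤ u (x - t • g) := (hlub _ htc).1 (hfloor ⟨htc, rfl⟩)
  have huM : u x ≤ M := (isLUB_le_iff (hlub x (subset_closure hx))).2 fun z hz => (hsub hz).2.2
  have hkey : (‖g‖ ^ 2 - 1) / 2 * Metric.infDist x (frontier Ω) ≤ M * ‖g‖ := by
    have := mul_le_mul_of_nonneg_left hd (by linarith : (0 : ℝ) ≤ (‖g‖ ^ 2 - 1) / 2)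
    nlinarith [norm_nonneg g]
  rw [h1, h2]
  nlinarith

/-! ### The resistance under the single impact condition -/

theorem measurable_gradient (u : Plane → ℝ) : Measurable (gradient u) :=
  (InnerProductSpace.toDual ℝ Plane).symm.continuous.measurable.comp (measurable_fderiv ℝ u)

theorem continuous_reflected : Continuous reflected := by
  have : ∀ g : Plane, 1 + ‖g‖ ^ 2 ≠ 0 := fun g => by positivity
  unfold reflected
  fun_prop (disch := exact this _)

theorem half_one_add_reflected_snd (g : Plane) :
    (1 + (reflected g).2) / 2 = 1 / (1 + ‖g‖ ^ 2) := by
  have : 1 + ‖g‖ ^ 2 ≠ 0 := by positivity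
  simp only [reflected, Prod.smul_snd, smul_eq_mul]
  field_simp
  ring

/-- Newton's formula: under the single impact condition the scattering by a body that contains the
graph of its upper envelope `u` is regular, and the resistance is the integral
of `1 / (1 + |∇u|²)`. -/
theorem regularScattering_of_SIC {r : WithTop ℕ∞} (hr : 1 ≤ r) {Ω : Set Plane}
    (hconv : Convex ℝ Ω) (hopen : IsOpen Ω) {u : Plane → ℝ} (hsic : SIC r Ω u) {B : Set Space}
    (hB : ∀ p ∈ B, p.1 ∈ closure Ω ∧ p.2 ≤ u p.1)
    (hgraph : ∀ x ∈ Ω, ((x, u x) : Space) ∈ B) :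
    RegularScattering r B ∧ resistance r Ω B = ∫ x in Ω, 1 / (1 + ‖gradient u x‖ ^ 2) := by
  obtain ⟨hpw, hsic⟩ := hsic
  have hsing : ∀ᵐ x : Plane, (x ∈ Ω ∧ SmoothNear r u x) ∨ x ∉ closure Ω := by
    have h1 := CoveredByArcs.volume_eq_zero hr hpw
    have h2 := hconv.addHaar_frontier volume
    refine measure_mono_null (fun x hx => ?_) (measure_union_null h1 h2)
    simp only [mem_compl_iff, Set.mem_ofPred_eq, not_or, not_and, not_not] at hx
    by_cases hxΩ : x ∈ Ω
    · exact Or.inl ⟨hxΩ, hx.1 hxΩ⟩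
    · exact Or.inr ⟨hx.2, fun h => hxΩ (interior_subset h)⟩
  have hin : ∀ x ∈ Ω, SmoothNear r u x → ScattersTo r B x (reflected (gradient u x)) :=
    fun x hx hs => scattersTo_reflected hr hB
      ((hopen.eventually_mem hx).mono fun y hy => hgraph y hy) hs (hsic x hx hs)
  have hin' : ∀ x ∈ Ω, SmoothNear r u x →
      finalVelocity r B x = reflected (gradient u x) := fun x hx hs =>
    (finalVelocity_spec ⟨_, hin x hx hs⟩).eq_reflected hr hB
      (fun z hz => ⟨u x, hz, hgraph x hx⟩) hs (hsic x hx hs)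
  refine ⟨⟨?_, ?_⟩, ?_⟩
  · filter_upwards [hsing] with x hx
    rcases hx with ⟨hx, hs⟩ | hx
    · exact ⟨_, hin x hx hs⟩
    · exact ⟨_, scattersTo_down (fun p hp => (hB p hp).1) hx⟩
  · classical
    refine ⟨fun x => if x ∈ Ω then reflected (gradient u x) else down, ?_, ?_⟩
    · exact Measurable.ite hopen.measurableSet
        (continuous_reflected.measurable.comp (measurable_gradient u)) measurable_const
    · filter_upwards [hsing] with x hx
      rcases hx with ⟨hx, hs⟩ | hx
      · rw [if_pos hx, hin' x hx hs]
      · rw [if_neg fun h => hx (subset_closure h)]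
        have hB' : ∀ p ∈ B, p.1 ∈ closure Ω := fun p hp => (hB p hp).1
        exact (finalVelocity_spec ⟨_, scattersTo_down hB' hx⟩).eq_down hr hB' hx
  · refine integral_congr_ae ?_
    filter_upwards [ae_restrict_mem hopen.measurableSet, ae_restrict_of_ae hsing] with x hx hs
    rcases hs with ⟨-, hs⟩ | hs
    · rw [hin' x hx hs, half_one_add_reflected_snd]
    · exact (hs (subset_closure hx)).elim

end MinRes

namespace MinRes

/-! ### Arcs, circles and cones -/

theorem coveredByArcs_of_finite {E : Type*} [NormedAddCommGroup E] [NormedSpace ℝ E]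
    {r : WithTop ℕ∞} {N : Set E} {ι : Type*} [Finite ι] (γ : ι → ℝ → E)
    (hγ : ∀ i, ContDiffOn ℝ r (γ i) (Icc 0 1)) (hN : N ⊆ ⋃ i, γ i '' Icc (0 : ℝ) 1) :
    CoveredByArcs r N := by
  obtain ⟨k, ⟨e⟩⟩ := Finite.exists_equiv_fin ι
  refine ⟨k, fun j => γ (e.symm j), fun j => hγ _, hN.trans (iUnion_subset fun i => ?_)⟩
  have := subset_iUnion (fun j => γ (e.symm j) '' Icc (0 : ℝ) 1) (e i)
  simpa using this

/-- The circle with centre `c` and radius `ρ`, run through once for `0 ≤ t ≤ 1`. -/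
noncomputable def circleArc (c : Plane) (ρ : ℝ) (t : ℝ) : Plane :=
  c + WithLp.toLp 2
    ![ρ * Real.cos (2 * Real.pi * t - Real.pi), ρ * Real.sin (2 * Real.pi * t - Real.pi)]

theorem contDiff_circleArc {r : WithTop ℕ∞} (c : Plane) (ρ : ℝ) :
    ContDiff ℝ r (circleArc c ρ) := by
  refine contDiff_const.add ?_
  rw [contDiff_euclidean]
  intro i
  fin_cases i
  · exact contDiff_const.mul (Real.contDiff_cos.comp (by fun_prop))
  · exact contDiff_const.mul (Real.contDiff_sin.comp (by fun_prop))

theorem circleArc_mem_sphere (c : Plane) {ρ : ℝ} (hρ : 0 ≤ ρ) (t : ℝ) :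
    circleArc c ρ t ∈ Metric.sphere c ρ := by
  rw [mem_sphere_iff_norm, circleArc, add_sub_cancel_left, EuclideanSpace.norm_eq]
  simp only [Fin.sum_univ_two, Real.norm_eq_abs, sq_abs]
  simp only [Matrix.cons_val_zero, Matrix.cons_val_one]
  rw [mul_pow, mul_pow, ← mul_add, Real.cos_sq_add_sin_sq, mul_one, Real.sqrt_sq hρ]

theorem sphere_subset_circleArc (c : Plane) (ρ : ℝ) :
    Metric.sphere c ρ ⊆ circleArc c ρ '' Icc (0 : ℝ) 1 := by
  intro x hx
  set z : ℂ := ⟨(x - c) 0, (x - c) 1⟩ with hz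
  have hzn : ‖z‖ = ρ := by
    rw [mem_sphere_iff_norm, EuclideanSpace.norm_eq] at hx
    simp only [Fin.sum_univ_two, Real.norm_eq_abs, sq_abs] at hx
    rw [Complex.norm_eq_sqrt_sq_add_sq]
    exact hx
  have h1 := Complex.norm_mul_cos_arg z
  have h2 := Complex.norm_mul_sin_arg z
  rw [hzn] at h1 h2
  have hpi := Real.pi_pos
  have h3 : 2 * Real.pi * ((z.arg + Real.pi) / (2 * Real.pi)) - Real.pi = z.arg := by
    field_simp; ring
  refine ⟨(z.arg + Real.pi) / (2 * Real.pi), ⟨?_, ?_⟩, ?_⟩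
  · exact div_nonneg (by linarith [Complex.neg_pi_lt_arg z]) (by positivity)
  · rw [div_le_one (by positivity)]
    linarith [Complex.arg_le_pi z]
  · rw [circleArc, h3, h1, h2]
    ext i
    fin_cases i <;> simp [hz]

theorem gradient_cone {H g : ℝ} {a x : Plane} (hx : x ≠ a) :
    gradient (fun y => H + g * dist y a) x = (g / dist x a) • (x - a) := by
  have hne : x - a ≠ 0 := sub_ne_zero.2 hx
  have hpos : 0 < ‖x - a‖ := norm_pos_iff.2 hne
  have h1 : HasFDerivAt (fun y : Plane => y - a) (ContinuousLinearMap.id ℝ Plane) x :=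
    (hasFDerivAt_id x).sub_const a
  have h2 := (h1.norm_sq.sqrt (by positivity)).const_mul g |>.const_add H
  have h3 : (fun y : Plane => H + g * Real.sqrt (‖y - a‖ ^ 2)) = fun y => H + g * dist y a := by
    funext y
    rw [Real.sqrt_sq (norm_nonneg _), dist_eq_norm]
  rw [h3] at h2
  refine ext_inner_right ℝ fun w => ?_
  rw [← fderiv_eq_inner_gradient, h2.fderiv, Real.sqrt_sq (norm_nonneg _), inner_smul_left,
    dist_eq_norm]
  simp
  field_simp
  rw [inner_sub_left]

/-! ### Finite systems of conical mirrors -/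

/-- A finite system of conical mirrors of height at least `H` and at most `M` over a convex
floor `Ω`. Over the disc with number `i` the mirror is a piece of the cone
`z = H + slope i * |x - apex i|`, so that all particles that fall on it are reflected towards the
vertical line over `apex i`. The field `ray` says that over the rays from the points of the disc
through the apex there are no mirrors, except parts of the same cone before the apex, and the
field `exit` that these rays have left `Ω` before the particles have descended by `H`. -/
structure Mirrors (Ω : Set Plane) (M H : ℝ) (ι : Type) where
  center : ι → Plane
  radius : ι → ℝ
  apex : ι → Plane
  slope : ι → ℝ
  radius_pos : ∀ i, 0 < radius i
  slope_pos : ∀ i, 0 < slope i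
  height_pos : 0 < H
  closedBall_subset : ∀ i, Metric.closedBall (center i) (radius i) ⊆ Ω
  disjoint : Pairwise fun i j =>
    Disjoint (Metric.closedBall (center i) (radius i)) (Metric.closedBall (center j) (radius j))
  apex_notMem : ∀ i, apex i ∉ Metric.closedBall (center i) (radius i)
  height_le : ∀ i, ∀ x ∈ Metric.closedBall (center i) (radius i),
    H + slope i * dist x (apex i) ≤ M
  ray : ∀ i, ∀ x ∈ Metric.ball (center i) (radius i), ∀ s < (1 : ℝ), ∀ k,
    apex i + s • (x - apex i) ∈ closure Ω →
    apex i + s • (x - apex i) ∈ Metric.ball (center k) (radius k) →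
    0 < s ∧ apex k = apex i ∧ slope k = slope i
  exit : ∀ i, ∀ x ∈ Metric.ball (center i) (radius i), ∀ s < (1 : ℝ),
    apex i + s • (x - apex i) ∈ closure Ω →
    (1 - s) * dist x (apex i) * (slope i ^ 2 - 1) ≤ 2 * slope i * H

namespace Mirrors

variable {Ω : Set Plane} {M H : ℝ} {ι : Type} (D : Mirrors Ω M H ι)

/-- The open disc over which the mirror with number `i` is placed. -/
def disc (i : ι) : Set Plane := Metric.ball (D.center i) (D.radius i)

/-- The cone that carries the mirror with number `i`. -/
noncomputable def cone (i : ι) (x : Plane) : ℝ := H + D.slope i * dist x (D.apex i)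

open Classical in
/-- The height function: the height of the mirrors over their discs, and zero elsewhere. -/
noncomputable def height (x : Plane) : ℝ := if h : ∃ i, x ∈ D.disc i then D.cone h.choose x else 0

theorem disc_subset_closedBall (i : ι) :
    D.disc i ⊆ Metric.closedBall (D.center i) (D.radius i) := Metric.ball_subset_closedBall

theorem eq_of_mem {i j : ι} {x : Plane} (hi : x ∈ Metric.closedBall (D.center i) (D.radius i))
    (hj : x ∈ Metric.closedBall (D.center j) (D.radius j)) : i = j := by
  by_contra h
  exact disjoint_left.1 (D.disjoint h) hi hj

theorem height_of_mem {i : ι} {x : Plane} (hx : x ∈ D.disc i) : D.height x = D.cone i x := by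
  have h : ∃ i, x ∈ D.disc i := ⟨i, hx⟩
  rw [height, dif_pos h,
    D.eq_of_mem (D.disc_subset_closedBall _ h.choose_spec) (D.disc_subset_closedBall _ hx)]

theorem height_of_notMem {x : Plane} (hx : ∀ i, x ∉ D.disc i) : D.height x = 0 := by
  rw [height, dif_neg fun ⟨i, h⟩ => hx i h]

theorem le_cone (i : ι) (x : Plane) : H ≤ D.cone i x :=
  le_add_of_nonneg_right (mul_nonneg (D.slope_pos i).le dist_nonneg)

theorem height_nonneg (x : Plane) : 0 ≤ D.height x := by
  by_cases h : ∃ i, x ∈ D.disc i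
  · obtain ⟨i, h⟩ := h
    rw [D.height_of_mem h]
    exact D.height_pos.le.trans (D.le_cone i x)
  · rw [D.height_of_notMem fun i hi => h ⟨i, hi⟩]

theorem height_le_top (hM : 0 ≤ M) (x : Plane) : D.height x ≤ M := by
  by_cases h : ∃ i, x ∈ D.disc i
  · obtain ⟨i, h⟩ := h
    rw [D.height_of_mem h]
    exact D.height_le i x (D.disc_subset_closedBall i h)
  · rwa [D.height_of_notMem fun i hi => h ⟨i, hi⟩]

theorem ne_apex {i : ι} {x : Plane} (hx : x ∈ Metric.closedBall (D.center i) (D.radius i)) :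
    x ≠ D.apex i := by
  rintro rfl
  exact D.apex_notMem i hx

theorem contDiffAt_cone {r : WithTop ℕ∞} {i : ι} {x : Plane}
    (hx : x ∈ Metric.closedBall (D.center i) (D.radius i)) : ContDiffAt ℝ r (D.cone i) x :=
  contDiffAt_const.add (contDiffAt_const.mul (contDiffAt_id.dist ℝ contDiffAt_const (D.ne_apex hx)))

theorem smoothNear_of_mem {r : WithTop ℕ∞} {i : ι} {x : Plane} (hx : x ∈ D.disc i) :
    SmoothNear r D.height x := by
  refine ⟨D.disc i, Metric.isOpen_ball, hx, ContDiffOn.congr (f := D.cone i) ?_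
    fun y hy => D.height_of_mem hy⟩
  exact fun y hy => (D.contDiffAt_cone (D.disc_subset_closedBall i hy)).contDiffWithinAt

theorem gradient_of_mem {i : ι} {x : Plane} (hx : x ∈ D.disc i) :
    gradient D.height x = (D.slope i / dist x (D.apex i)) • (x - D.apex i) := by
  rw [← gradient_cone (D.ne_apex (D.disc_subset_closedBall i hx)) (H := H)]
  have : D.height =ᶠ[𝓝 x] fun y => H + D.slope i * dist y (D.apex i) :=
    (Metric.isOpen_ball.eventually_mem hx).mono fun y hy => D.height_of_mem hy
  rw [gradient, gradient, this.fderiv_eq]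

theorem norm_gradient_of_mem {i : ι} {x : Plane} (hx : x ∈ D.disc i) :
    ‖gradient D.height x‖ = D.slope i := by
  have h1 : 0 < dist x (D.apex i) := dist_pos.2 (D.ne_apex (D.disc_subset_closedBall i hx))
  rw [D.gradient_of_mem hx, norm_smul, ← dist_eq_norm, Real.norm_eq_abs,
    abs_of_pos (div_pos (D.slope_pos i) h1), div_mul_cancel₀ _ h1.ne']

theorem gradient_of_notMem {x : Plane} (hx : ∀ i, x ∉ D.disc i) : gradient D.height x = 0 := by
  have : IsLocalMin D.height x := Eventually.of_forall fun y => by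
    rw [D.height_of_notMem hx]
    exact D.height_nonneg y
  rw [gradient, this.fderiv_eq_zero, map_zero]

theorem piecewiseSmooth [Finite ι] {r : WithTop ℕ∞} : PiecewiseSmooth r Ω D.height := by
  refine coveredByArcs_of_finite (fun i => circleArc (D.center i) (D.radius i))
    (fun i => (contDiff_circleArc _ _).contDiffOn) ?_
  rintro x ⟨-, hx⟩
  by_contra hcon
  refine hx ?_
  by_cases hmem : ∃ i, x ∈ Metric.closedBall (D.center i) (D.radius i)
  · obtain ⟨i, hi⟩ := hmem
    refine D.smoothNear_of_mem (i := i) ?_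
    refine lt_of_le_of_ne hi fun h => hcon (mem_iUnion.2 ⟨i, sphere_subset_circleArc _ _ h⟩)
  · refine ⟨(⋃ i, Metric.closedBall (D.center i) (D.radius i))ᶜ,
      (isClosed_iUnion_of_finite fun i => Metric.isClosed_closedBall).isOpen_compl,
      by simpa using hmem, ContDiffOn.congr (contDiffOn_const (c := 0)) fun y hy => ?_⟩
    exact D.height_of_notMem fun i hi => hy (mem_iUnion.2 ⟨i, D.disc_subset_closedBall i hi⟩)

theorem sic [Finite ι] {r : WithTop ℕ∞} : SIC r Ω D.height := by
  refine ⟨D.piecewiseSmooth, fun x _ _ t ht hy => ?_⟩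
  by_cases hx : ∃ i, x ∈ D.disc i
  · obtain ⟨i, hi⟩ := hx
    have hd : 0 < dist x (D.apex i) := dist_pos.2 (D.ne_apex (D.disc_subset_closedBall i hi))
    have hg := D.slope_pos i
    rw [D.norm_gradient_of_mem hi, div_le_iff₀ ht, D.height_of_mem hi]
    rw [D.gradient_of_mem hi] at hy ⊢
    set d := dist x (D.apex i) with hdd
    set g := D.slope i with hgg
    have hpt : x - t • (g / d) • (x - D.apex i) =
        D.apex i + (1 - t * g / d) • (x - D.apex i) := by
      rw [smul_smul, sub_smul, one_smul, mul_div_assoc]; abel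
    rw [hpt] at hy ⊢
    have hs : 1 - t * g / d < 1 := by
      have : 0 < t * g / d := by positivity
      linarith
    have hexit := D.exit i x hi _ hs hy
    have htg : (1 - (1 - t * g / d)) * d = t * g := by field_simp; ring
    rw [← hdd, htg, ← hgg] at hexit
    have hfloor : 0 ≤ H + t * (1 - g ^ 2) / 2 := by
      by_contra! h
      nlinarith
    by_cases hk : ∃ k, D.apex i + (1 - t * g / d) • (x - D.apex i) ∈ D.disc k
    · obtain ⟨k, hk⟩ := hk
      obtain ⟨hspos, h1, h2⟩ := D.ray i x hi _ hs k hy hk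
      have h3 : dist (D.apex i + (1 - t * g / d) • (x - D.apex i)) (D.apex i) = d - t * g := by
        rw [dist_eq_norm, add_sub_cancel_left, norm_smul, ← dist_eq_norm x, ← hdd,
          Real.norm_eq_abs, abs_of_pos hspos]
        field_simp
      rw [D.height_of_mem hk, cone, cone, h1, h2, h3, ← hdd, ← hgg]
      nlinarith [mul_pos ht (mul_pos hg hg)]
    · rw [D.height_of_notMem fun k h => hk ⟨k, h⟩, cone, ← hdd, ← hgg]
      nlinarith [mul_pos hg hd]
  · have hx' : ∀ i, x ∉ D.disc i := fun i hi => hx ⟨i, hi⟩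
    rw [D.gradient_of_notMem hx']
    simp

/-- The body that consists of the floor and of the mirrors, as sheets of zero thickness. -/
def sheets : Set Space := {p | p.1 ∈ closure Ω ∧ (p.2 = 0 ∨ p.2 = D.height p.1)}

theorem mem_classU [Finite ι] {r : WithTop ℕ∞} (hr : 1 ≤ r) (hconv : Convex ℝ Ω)
    (hopen : IsOpen Ω) (hM : 0 < M) :
    D.height ∈ classU r Ω M ∧
      resistance r Ω (subgraph Ω D.height) = ∫ x in Ω, 1 / (1 + ‖gradient D.height x‖ ^ 2) := by
  obtain ⟨h1, h2⟩ := regularScattering_of_SIC hr hconv hopen (D.sic (r := r))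
    (B := subgraph Ω D.height) (fun p hp => ⟨hp.1, hp.2.2⟩)
    (fun x hx => ⟨subset_closure hx, D.height_nonneg x, le_rfl⟩)
  exact ⟨⟨D.piecewiseSmooth, fun x _ => ⟨D.height_nonneg x, D.height_le_top hM.le x⟩, h1⟩, h2⟩

theorem height_eq_zero_of_notMem {x : Plane} (hx : x ∉ Ω) : D.height x = 0 :=
  D.height_of_notMem fun i hi => hx (D.closedBall_subset i (D.disc_subset_closedBall i hi))

theorem upperEnvelope_sheets : upperEnvelope D.sheets = D.height := by
  funext x
  by_cases hx : x ∈ closure Ω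
  · have : IsGreatest {z : ℝ | ((x, z) : Space) ∈ D.sheets} (D.height x) := by
      refine ⟨⟨hx, Or.inr rfl⟩, ?_⟩
      rintro z ⟨-, h | h⟩
      · simp only at h
        exact h ▸ D.height_nonneg x
      · exact h.le
    exact this.csSup_eq
  · have : {z : ℝ | ((x, z) : Space) ∈ D.sheets} = ∅ := by
      ext z
      simp [sheets, hx]
    rw [upperEnvelope, this, Real.sSup_empty,
      D.height_eq_zero_of_notMem fun h => hx (subset_closure h)]

theorem closure_sheets_subset [Finite ι] {p : Space} (hp : p ∈ closure D.sheets) :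
    p.2 = 0 ∨ ∃ i, p.1 ∈ Metric.closedBall (D.center i) (D.radius i) ∧ p.2 = D.cone i p.1 := by
  have hcl : IsClosed ({p : Space | p.2 = 0} ∪
      ⋃ i, {p : Space | p.1 ∈ Metric.closedBall (D.center i) (D.radius i) ∧
        p.2 = D.cone i p.1}) := by
    refine (isClosed_eq continuous_snd continuous_const).union
      (isClosed_iUnion_of_finite fun i => IsClosed.inter ?_ ?_)
    · exact Metric.isClosed_closedBall.preimage continuous_fst
    · refine isClosed_eq continuous_snd ?_
      unfold cone
      fun_prop
  have hsub : D.sheets ⊆ {p : Space | p.2 = 0} ∪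
      ⋃ i, {p : Space | p.1 ∈ Metric.closedBall (D.center i) (D.radius i) ∧
        p.2 = D.cone i p.1} := by
    rintro q ⟨-, hq | hq⟩
    · exact Or.inl hq
    · by_cases h : ∃ i, q.1 ∈ D.disc i
      · obtain ⟨i, hi⟩ := h
        refine Or.inr (mem_iUnion.2 ⟨i, D.disc_subset_closedBall i hi, ?_⟩)
        rw [hq, D.height_of_mem hi]
      · left
        exact hq.trans (D.height_of_notMem fun i hi => h ⟨i, hi⟩)
  rcases closure_minimal hsub hcl hp with h | h
  · exact Or.inl h
  · exact Or.inr (mem_iUnion.1 h)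

theorem frontier_sheets [Finite ι] : frontier D.sheets = closure D.sheets := by
  have : interior D.sheets = ∅ := by
    rw [eq_empty_iff_forall_notMem]
    intro p hp
    -- a vertical line meets the body in at most two points
    have hc : Tendsto (fun s : ℝ => ((p.1, p.2 + s) : Space)) (𝓝[≠] 0) (𝓝 p) := by
      have : Continuous fun s : ℝ => ((p.1, p.2 + s) : Space) := by fun_prop
      have := (this.tendsto 0).mono_left (nhdsWithin_le_nhds (s := {0}ᶜ))
      simpa using this
    have hfin : (({-p.2, D.height p.1 - p.2} : Set ℝ) \ {0}).Finite := (by simp :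
      ({-p.2, D.height p.1 - p.2} : Set ℝ).Finite).subset sdiff_subset
    have h2 : ∀ᶠ s in 𝓝[≠] (0 : ℝ), s ∉ ({-p.2, D.height p.1 - p.2} : Set ℝ) := by
      filter_upwards [nhdsWithin_le_nhds (hfin.isClosed.isOpen_compl.mem_nhds (by simp)),
        self_mem_nhdsWithin] with s hs hs0 hmem
      exact hs ⟨hmem, hs0⟩
    obtain ⟨s, h3, h4⟩ := ((hc.eventually (isOpen_interior.mem_nhds hp)).and h2).exists
    have h5 := interior_subset (s := D.sheets) h3
    refine h4 ?_
    rcases h5.2 with h | h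
    · left; simp only at h; linarith
    · right; simp only at h; rw [mem_singleton_iff]; linarith
  rw [frontier, this, sdiff_empty]

theorem piecewiseSmoothSurface_sheets [Finite ι] {r : WithTop ℕ∞} (hr : 1 ≤ r) (hopen : IsOpen Ω) :
    PiecewiseSmoothSurface r (frontier D.sheets \ (frontier Ω ×ˢ univ)) := by
  refine coveredByArcs_of_finite (fun (i : ι) t => ((circleArc (D.center i) (D.radius i) t,
    D.cone i (circleArc (D.center i) (D.radius i) t)) : Space)) (fun i => ?_) ?_
  · refine (contDiff_circleArc _ _).contDiffOn.prodMk fun t _ => ?_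
    have h := circleArc_mem_sphere (D.center i) (D.radius_pos i).le t
    exact ((D.contDiffAt_cone (Metric.sphere_subset_closedBall h)).comp t
      (contDiff_circleArc _ _).contDiffAt).contDiffWithinAt
  rintro p ⟨⟨hp, hpf⟩, hsing⟩
  rw [D.frontier_sheets] at hp hsing
  by_contra hcon
  refine hsing ?_
  have hpΩ : p.1 ∈ Ω := by
    by_contra h
    refine hpf ⟨⟨?_, fun h' => h (interior_subset h')⟩, mem_univ _⟩
    exact closure_minimal (s := D.sheets) (t := Prod.fst ⁻¹' closure Ω) (fun q hq => hq.1)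
      (isClosed_closure.preimage continuous_fst) hp
  have hnear : ∀ᶠ q in 𝓝 p, q.1 ∈ Ω := continuousAt_fst.eventually (hopen.mem_nhds hpΩ)
  have hΩf : ∀ q : Space, q.1 ∈ Ω → q ∉ frontier Ω ×ˢ (univ : Set ℝ) := fun q hq h =>
    (hopen.frontier_eq ▸ h.1).2 hq
  rcases D.closure_sheets_subset hp with h0 | ⟨i, hi, hpi⟩
  · refine ⟨fun q => q.2, ⟨univ, isOpen_univ, mem_univ _, contDiff_snd.contDiffOn⟩, ?_, ?_⟩
    · intro h
      have h1 := congrArg (fun L : Space →L[ℝ] ℝ => L (0, 1)) h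
      rw [show fderiv ℝ (fun q : Space => q.2) p = ContinuousLinearMap.snd ℝ Plane ℝ from
        hasFDerivAt_snd.fderiv] at h1
      simp at h1
    · have hlow : ∀ᶠ q : Space in 𝓝 p, q.2 < H :=
        continuousAt_snd.eventually (gt_mem_nhds (by rw [h0]; exact D.height_pos))
      filter_upwards [hnear, hlow] with q hq1 hq2
      refine ⟨fun hq => ?_, fun hq => ⟨subset_closure ⟨subset_closure hq1, Or.inl hq⟩, hΩf q hq1⟩⟩
      rcases D.closure_sheets_subset hq.1 with h | ⟨j, -, h⟩
      · exact h
      · linarith [D.le_cone j q.1]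
  · have hi' : p.1 ∈ D.disc i := by
      refine lt_of_le_of_ne (Metric.mem_closedBall.1 hi) fun h => hcon (mem_iUnion.2 ⟨i, ?_⟩)
      obtain ⟨t, ht, htp⟩ := sphere_subset_circleArc _ _ h
      refine ⟨t, ht, ?_⟩
      ext1
      · exact htp
      · simp only [htp]; exact hpi.symm
    have hsm : ContDiffAt ℝ r (fun q : Space => q.2 - D.cone i q.1) p :=
      contDiffAt_snd.sub ((D.contDiffAt_cone hi).comp p contDiffAt_fst)
    refine ⟨fun q => q.2 - D.cone i q.1, ⟨Prod.fst ⁻¹' D.disc i,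
      Metric.isOpen_ball.preimage continuous_fst, hi', fun q hq => ?_⟩, ?_, ?_⟩
    · exact (contDiffAt_snd.sub ((D.contDiffAt_cone (D.disc_subset_closedBall i hq)).comp q
        contDiffAt_fst)).contDiffWithinAt
    · intro h
      have hd : DifferentiableAt ℝ (fun q : Space => q.2 - D.cone i q.1) p :=
        hsm.differentiableAt (by rintro rfl; simp at hr)
      have h1 := hd.hasFDerivAt.hasLineDerivAt (0, 1)
      rw [h] at h1
      have h2 : HasLineDerivAt ℝ (fun q : Space => q.2 - D.cone i q.1) 1 p (0, 1) := by
        have : (fun t : ℝ => (p + t • ((0, 1) : Space)).2 - D.cone i (p + t • ((0, 1) : Space)).1) =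
            fun t => t + (p.2 - D.cone i p.1) := by
          funext t
          simp only [Prod.fst_add, Prod.snd_add, Prod.smul_fst, Prod.smul_snd, smul_zero, add_zero,
            smul_eq_mul, mul_one]
          ring
        rw [HasLineDerivAt, this]
        exact (hasDerivAt_id (0 : ℝ)).add_const _
      have := h1.unique h2
      simp at this
    · have hup : ∀ᶠ q : Space in 𝓝 p, 0 < q.2 :=
        continuousAt_snd.eventually (lt_mem_nhds (by
          rw [hpi]; exact D.height_pos.trans_le (D.le_cone i p.1)))
      have hin : ∀ᶠ q : Space in 𝓝 p, q.1 ∈ D.disc i :=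
        continuousAt_fst.eventually (Metric.isOpen_ball.mem_nhds hi')
      filter_upwards [hnear, hup, hin] with q hq1 hq2 hq3
      rw [sub_eq_zero]
      refine ⟨fun hq => ?_, fun hq => ⟨subset_closure ⟨subset_closure hq1, Or.inr ?_⟩, hΩf q hq1⟩⟩
      · rcases D.closure_sheets_subset hq.1 with h | ⟨j, hj, h⟩
        · linarith
        · rw [D.eq_of_mem (D.disc_subset_closedBall i hq3) hj]
          exact h
      · rw [hq, D.height_of_mem hq3]

theorem sheets_mem_classSigma [Finite ι] {r : WithTop ℕ∞} (hr : 1 ≤ r) (hconv : Convex ℝ Ω)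
    (hopen : IsOpen Ω) (hM : 0 < M) :
    D.sheets ∈ classSigma r Ω M ∧
      resistance r Ω D.sheets = ∫ x in Ω, 1 / (1 + ‖gradient D.height x‖ ^ 2) := by
  obtain ⟨h1, h2⟩ := regularScattering_of_SIC hr hconv hopen (D.sic (r := r)) (B := D.sheets)
    (fun p hp => ⟨hp.1, hp.2.elim (fun h => h ▸ D.height_nonneg _) (fun h => h.le)⟩)
    (fun x hx => ⟨subset_closure hx, Or.inr rfl⟩)
  refine ⟨⟨⟨D.piecewiseSmoothSurface_sheets hr hopen, ?_, ?_, h1⟩, ?_⟩, h2⟩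
  · rintro p ⟨hp, h0⟩
    exact ⟨hp, Or.inl h0⟩
  · rintro p ⟨hp, h | h⟩
    · exact ⟨hp, by rw [h]; exact ⟨le_rfl, hM.le⟩⟩
    · exact ⟨hp, by rw [h]; exact ⟨D.height_nonneg _, D.height_le_top hM.le _⟩⟩
  · rw [D.upperEnvelope_sheets]
    exact D.sic

end Mirrors
end MinRes

namespace MinRes

/-! ### A Besicovitch-type bundle of segments -/

/-- The common second coordinate of the end points, on the line `s = 1`, of all segments that start
on the line `s = 0` from the `i`-th of the `N ^ N` equal parts of `[0, 1]`: the mean of the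
roundings of `i / N ^ N` down to the multiples of `N⁻¹, N⁻², …, N⁻ᴺ`. -/
noncomputable def bundleApex (N i : ℕ) : ℝ :=
  1 / N * ∑ j ∈ Finset.range N, ((i / N ^ (N - (j + 1)) : ℕ) : ℝ) / N ^ (j + 1)

variable {N : ℕ}

theorem round_mem (hN : 0 < N) (i : ℕ) {k : ℕ} (hk : k ≤ N) :
    0 ≤ (i : ℝ) / N ^ N - ((i / N ^ (N - k) : ℕ) : ℝ) / N ^ k ∧
      (i : ℝ) / N ^ N - ((i / N ^ (N - k) : ℕ) : ℝ) / N ^ k ≤ 1 / N ^ k := by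
  have hNpos : (0 : ℝ) < N := by exact_mod_cast hN
  set D := N ^ (N - k) with hD
  have hDpos : 0 < D := pow_pos hN _
  have hDpos' : (0 : ℝ) < D := by exact_mod_cast hDpos
  have h1 : (N : ℝ) ^ N = D * N ^ k := by
    rw [hD]; push_cast; rw [← pow_add, Nat.sub_add_cancel hk]
  have h2 : (D : ℝ) * (i / D : ℕ) + (i % D : ℕ) = i := by exact_mod_cast Nat.div_add_mod i D
  have h3 : ((i % D : ℕ) : ℝ) ≤ D := by exact_mod_cast (Nat.mod_lt i hDpos).le
  have h4 : (i : ℝ) / N ^ N - ((i / D : ℕ) : ℝ) / N ^ k = (i % D : ℕ) / (D * N ^ k) := by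
    rw [h1, ← h2]
    field_simp
    simp
  rw [h4]
  refine ⟨by positivity, ?_⟩
  rw [div_le_div_iff₀ (by positivity) (by positivity)]
  have : (0 : ℝ) < N ^ k := by positivity
  nlinarith

theorem bundleApex_mono {i j : ℕ} (h : i ≤ j) : bundleApex N i ≤ bundleApex N j := by
  unfold bundleApex
  gcongr

theorem bundleApex_nonneg (i : ℕ) : 0 ≤ bundleApex N i := by
  unfold bundleApex
  positivity

theorem bundleApex_le (hN : 0 < N) (i : ℕ) : bundleApex N i ≤ i / N ^ N := by
  have hNpos : (0 : ℝ) < N := by exact_mod_cast hN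
  have : ∑ j ∈ Finset.range N, ((i / N ^ (N - (j + 1)) : ℕ) : ℝ) / N ^ (j + 1) ≤
      ∑ _j ∈ Finset.range N, (i : ℝ) / N ^ N :=
    Finset.sum_le_sum fun j hj => by
      linarith [(round_mem hN i (k := j + 1) (by have := Finset.mem_range.1 hj; omega)).1]
  rw [Finset.sum_const, Finset.card_range, nsmul_eq_mul] at this
  rw [bundleApex, one_div, inv_mul_le_iff₀ hNpos]
  exact this

theorem le_bundleApex (hN : 0 < N) (i : ℕ) : (i : ℝ) / N ^ N - 1 / N ≤ bundleApex N i := by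
  have hNpos : (0 : ℝ) < N := by exact_mod_cast hN
  have h1N : (1 : ℝ) ≤ N := by exact_mod_cast hN
  have : ∑ _j ∈ Finset.range N, ((i : ℝ) / N ^ N - 1 / N) ≤
      ∑ j ∈ Finset.range N, ((i / N ^ (N - (j + 1)) : ℕ) : ℝ) / N ^ (j + 1) :=
    Finset.sum_le_sum fun j hj => by
      have h1 := (round_mem hN i (k := j + 1) (by have := Finset.mem_range.1 hj; omega)).2
      have h2 : (1 : ℝ) / N ^ (j + 1) ≤ 1 / N := by
        apply one_div_le_one_div_of_le hNpos
        exact le_self_pow₀ h1N (by omega)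
      linarith
  rw [Finset.sum_const, Finset.card_range, nsmul_eq_mul] at this
  rw [bundleApex, one_div, le_inv_mul_iff₀ hNpos]
  simpa using this

/-- At the scale `N⁻ᵏ` the coarse roundings of `i / N ^ N` depend only on its rounding `m / N ^ k`,
and the fine ones are close to `i / N ^ N` itself. -/
theorem bundleApex_split (hN : 0 < N) {k : ℕ} (hkN : k < N) (i : ℕ) :
    ∃ E : ℝ, 0 ≤ E ∧ E ≤ 1 / N ^ (k + 1) ∧
      bundleApex N i = 1 / N * ∑ j ∈ Finset.range k,
        ((i / N ^ (N - k) / N ^ (k - (j + 1)) : ℕ) : ℝ) / N ^ (j + 1) +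
          (1 - k / N) * (i / N ^ N) - E := by
  have hNpos : (0 : ℝ) < N := by exact_mod_cast hN
  have h1N : (1 : ℝ) ≤ N := by exact_mod_cast hN
  set x : ℝ := (i : ℝ) / N ^ N with hxdef
  have hcoarse : ∑ j ∈ Finset.range k, ((i / N ^ (N - (j + 1)) : ℕ) : ℝ) / N ^ (j + 1) =
      ∑ j ∈ Finset.range k, ((i / N ^ (N - k) / N ^ (k - (j + 1)) : ℕ) : ℝ) / N ^ (j + 1) := by
    refine Finset.sum_congr rfl fun j hj => ?_
    have hj' := Finset.mem_range.1 hj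
    rw [Nat.div_div_eq_div_mul, ← pow_add]
    congr 4
    omega
  set E := ∑ j ∈ Finset.Ico k N, (x - ((i / N ^ (N - (j + 1)) : ℕ) : ℝ) / N ^ (j + 1)) with hE
  have hfine : ∑ j ∈ Finset.Ico k N, ((i / N ^ (N - (j + 1)) : ℕ) : ℝ) / N ^ (j + 1) =
      (N - k) * x - E := by
    rw [hE, Finset.sum_sub_distrib, Finset.sum_const, Nat.card_Ico, nsmul_eq_mul,
      Nat.cast_sub hkN.le]
    ring
  have hE0 : 0 ≤ E := Finset.sum_nonneg fun j hj =>
    (round_mem hN i (k := j + 1) (by have := (Finset.mem_Ico.1 hj).2; omega)).1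
  have hE1 : E ≤ N * (1 / N ^ (k + 1)) := by
    have h1 : E ≤ ∑ _j ∈ Finset.Ico k N, (1 : ℝ) / N ^ (k + 1) := by
      refine Finset.sum_le_sum fun j hj => ?_
      have hj' := Finset.mem_Ico.1 hj
      refine (round_mem hN i (k := j + 1) (by omega)).2.trans ?_
      exact one_div_le_one_div_of_le (by positivity) (pow_le_pow_right₀ h1N (by omega))
    rw [Finset.sum_const, Nat.card_Ico, nsmul_eq_mul] at h1
    refine h1.trans ?_
    gcongr
    exact Nat.sub_le N k
  refine ⟨E / N, by positivity, by rw [div_le_iff₀ hNpos]; linarith, ?_⟩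
  rw [bundleApex, ← Finset.sum_range_add_sum_Ico _ hkN.le, hcoarse, hfine]
  field_simp
  ring

/-- Beyond the line `s = 1`, at the distance `τ` from it, the segments of the bundle are
concentrated near few points: at the scale `N⁻ᵏ` for which `1 - k / N` is close to `τ / (1 + τ)`,
all segments from one interval of length `N⁻ᵏ` are within `3 (1 + τ) N⁻ᵏ⁻¹` of one point. -/
theorem exists_concentration (hN : 0 < N) {τ : ℝ} (hτ : 0 ≤ τ) :
    ∃ k < N, ∃ c : ℕ → ℝ, ∀ i < N ^ N, ∀ y ∈ Icc ((i : ℝ) / N ^ N) ((i + 1) / N ^ N),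
      i / N ^ (N - k) < N ^ k ∧
      |(1 + τ) * bundleApex N i - τ * y - c (i / N ^ (N - k))| ≤ 3 * (1 + τ) / N ^ (k + 1) := by
  have hNpos : (0 : ℝ) < N := by exact_mod_cast hN
  have h1N : (1 : ℝ) ≤ N := by exact_mod_cast hN
  have hx : 0 < (N : ℝ) / (1 + τ) := by positivity
  obtain ⟨k, hk⟩ : ∃ k, ⌈(N : ℝ) / (1 + τ)⌉₊ = k + 1 :=
    ⟨⌈(N : ℝ) / (1 + τ)⌉₊ - 1, by have := Nat.ceil_pos.2 hx; omega⟩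
  have hk1 : (k : ℝ) < N / (1 + τ) := Nat.lt_ceil.1 (by omega)
  have hk2 : (N : ℝ) / (1 + τ) ≤ k + 1 := by
    have := Nat.le_ceil ((N : ℝ) / (1 + τ))
    rw [hk] at this
    exact_mod_cast this
  rw [lt_div_iff₀ (by positivity)] at hk1
  rw [div_le_iff₀ (by positivity)] at hk2
  have hkN : k < N := by
    have : (k : ℝ) < N := by nlinarith [(Nat.cast_nonneg k : (0 : ℝ) ≤ k)]
    exact_mod_cast this
  refine ⟨k, hkN, fun m => (1 + τ) * (1 / N * ∑ j ∈ Finset.range k,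
    ((m / N ^ (k - (j + 1)) : ℕ) : ℝ) / N ^ (j + 1) + (1 - k / N) * (m / N ^ k)) -
      τ * (m / N ^ k), fun i hi y hy => ⟨?_, ?_⟩⟩
  · rw [Nat.div_lt_iff_lt_mul (pow_pos hN _), ← pow_add, Nat.add_sub_cancel' hkN.le]
    exact hi
  obtain ⟨E, hE0, hE1, hp⟩ := bundleApex_split hN hkN i
  obtain ⟨hδ0, hδ1⟩ := round_mem hN i hkN.le
  rw [hp]
  beta_reduce
  generalize i / N ^ (N - k) = m at *
  generalize ∑ j ∈ Finset.range k, ((m / N ^ (k - (j + 1)) : ℕ) : ℝ) / N ^ (j + 1) = S at *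
  have hyw : ((i : ℝ) + 1) / N ^ N = i / N ^ N + 1 / N ^ N := add_div _ _ _
  rw [hyw] at hy
  have hw : (1 : ℝ) / N ^ N ≤ 1 / N ^ (k + 1) :=
    one_div_le_one_div_of_le (by positivity) (pow_le_pow_right₀ h1N (by omega))
  have hkε : (1 : ℝ) / N ^ k = N * (1 / N ^ (k + 1)) := by rw [pow_succ]; field_simp
  have hεpos : (0 : ℝ) < 1 / N ^ (k + 1) := by positivity
  rw [hkε] at hδ1
  rw [← mul_one_div (3 * (1 + τ))]
  generalize (i : ℝ) / N ^ N = x at *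
  generalize (m : ℝ) / N ^ k = z at *
  generalize (1 : ℝ) / N ^ (k + 1) = ε at *
  generalize (1 : ℝ) / N ^ N = ε' at *
  have hdiff : (1 + τ) * (1 / N * S + (1 - k / N) * x - E) - τ * y -
      ((1 + τ) * (1 / N * S + (1 - k / N) * z) - τ * z) =
      (1 - (1 + τ) * k / N) * (x - z) - (1 + τ) * E - τ * (y - x) := by
    ring
  rw [hdiff]
  have hb1 : 0 ≤ (1 - (1 + τ) * k / N) * (x - z) := by
    refine mul_nonneg ?_ hδ0
    rw [sub_nonneg, div_le_one hNpos]
    linarith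
  have hb2 : (1 - (1 + τ) * k / N) * (x - z) ≤ (1 + τ) * ε := by
    have h1 : 1 - (1 + τ) * k / N ≤ (1 + τ) / N := by
      rw [sub_le_iff_le_add, ← add_div, le_div_iff₀ hNpos]
      linarith
    calc (1 - (1 + τ) * k / N) * (x - z) ≤ (1 + τ) / N * (N * ε) := by
          refine mul_le_mul h1 hδ1 hδ0 (by positivity)
      _ = (1 + τ) * ε := by field_simp
  have hb5 : (1 + τ) * E ≤ (1 + τ) * ε := mul_le_mul_of_nonneg_left hE1 (by linarith)
  have hb6 : 0 ≤ (1 + τ) * E := by positivity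
  have hb7 : τ * (y - x) ≤ τ * ε := mul_le_mul_of_nonneg_left (by linarith [hy.2]) hτ
  have hb8 : 0 ≤ τ * (y - x) := mul_nonneg hτ (by linarith [hy.1])
  rw [abs_le]
  constructor <;> linarith

/-- The continuations, beyond the line `s = 1` up to the line `s = 1 + Λ`, of the segments of
the bundle. -/
def bundleTail (N : ℕ) (Λ : ℝ) : Set (ℝ × ℝ) :=
  ⋃ i : Fin (N ^ N), (fun q : ℝ × ℝ => (1 + q.1, (1 + q.1) * bundleApex N i - q.1 * q.2)) ''
    (Icc 0 Λ ×ˢ Icc ((i : ℝ) / N ^ N) ((i + 1) / N ^ N))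

theorem isCompact_bundleTail (N : ℕ) (Λ : ℝ) : IsCompact (bundleTail N Λ) :=
  isCompact_iUnion fun _ => (isCompact_Icc.prod isCompact_Icc).image (by fun_prop)

theorem volume_bundleTail_le (hN : 0 < N) {Λ : ℝ} (hΛ : 0 ≤ Λ) :
    volume (bundleTail N Λ) ≤ ENNReal.ofReal (6 * Λ * (1 + Λ) / N) := by
  have hNpos : (0 : ℝ) < N := by exact_mod_cast hN
  rw [Measure.volume_eq_prod, Measure.prod_apply (isCompact_bundleTail N Λ).measurableSet]
  have hsec : ∀ s : ℝ, volume (Prod.mk s ⁻¹' bundleTail N Λ) ≤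
      (Icc (1 : ℝ) (1 + Λ)).indicator (fun _ => ENNReal.ofReal (6 * (1 + Λ) / N)) s := by
    intro s
    by_cases hs : s ∈ Icc (1 : ℝ) (1 + Λ)
    · rw [indicator_of_mem hs]
      have hτ : 0 ≤ s - 1 := by linarith [hs.1]
      obtain ⟨k, hk, c, hc⟩ := exists_concentration hN hτ
      set R := 3 * (1 + (s - 1)) / (N : ℝ) ^ (k + 1) with hR
      have hRnn : 0 ≤ R := by rw [hR]; positivity
      have hsub : Prod.mk s ⁻¹' bundleTail N Λ ⊆
          ⋃ m ∈ Finset.range (N ^ k), Icc (c m - R) (c m + R) := by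
        intro z hz
        obtain ⟨i, ⟨q, ⟨hq1, hq2⟩, hq⟩⟩ := mem_iUnion.1 hz
        obtain ⟨h1, h2⟩ := Prod.mk.inj hq
        obtain ⟨h3, h4⟩ := hc i i.2 q.2 hq2
        refine mem_iUnion₂.2 ⟨_, Finset.mem_range.2 h3, ?_⟩
        have h5 : q.1 = s - 1 := by linarith
        rw [h5] at h2
        rw [h2] at h4
        obtain ⟨h6, h7⟩ := abs_le.1 h4
        constructor <;> linarith
      refine (measure_mono hsub).trans ((measure_biUnion_finset_le _ _).trans ?_)
      simp only [Real.volume_Icc]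
      have h8 : ∀ m, c m + R - (c m - R) = 2 * R := fun m => by ring
      simp only [h8, Finset.sum_const, Finset.card_range]
      rw [nsmul_eq_mul, ← ENNReal.ofReal_natCast, ← ENNReal.ofReal_mul (by positivity)]
      refine ENNReal.ofReal_le_ofReal ?_
      rw [hR]
      push_cast
      have h9 : (N : ℝ) ^ k * (2 * (3 * (1 + (s - 1)) / N ^ (k + 1))) = 6 * s / N := by
        rw [pow_succ]; field_simp; ring
      rw [h9]
      gcongr
      exact hs.2
    · have hempty : Prod.mk s ⁻¹' bundleTail N Λ = ∅ := ?_
      · rw [indicator_of_notMem hs, hempty, measure_empty]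
      rw [eq_empty_iff_forall_notMem]
      intro z hz
      obtain ⟨i, ⟨q, ⟨hq1, -⟩, hq⟩⟩ := mem_iUnion.1 hz
      obtain ⟨h1, -⟩ := Prod.mk.inj hq
      exact hs ⟨by linarith [hq1.1], by linarith [hq1.2]⟩
  refine (lintegral_mono hsec).trans ?_
  rw [lintegral_indicator measurableSet_Icc, setLIntegral_const, Real.volume_Icc,
    ← ENNReal.ofReal_mul (by positivity)]
  refine ENNReal.ofReal_le_ofReal (le_of_eq ?_)
  field_simp
  ring

/-- The triangle filled by the `i`-th part of the bundle between the lines `s = 0` and `s = 1`. -/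
def bundleCell (N i : ℕ) : Set (ℝ × ℝ) :=
  {p | p.1 ∈ Ioo (0 : ℝ) 1 ∧
    p.2 ∈ Ioo ((i : ℝ) / N ^ N * (1 - p.1) + bundleApex N i * p.1)
      ((i + 1) / N ^ N * (1 - p.1) + bundleApex N i * p.1)}

theorem isOpen_bundleCell (N i : ℕ) : IsOpen (bundleCell N i) := by
  have h1 : IsOpen {p : ℝ × ℝ | (i : ℝ) / N ^ N * (1 - p.1) + bundleApex N i * p.1 < p.2} :=
    isOpen_lt (by fun_prop) (by fun_prop)
  have h2 : IsOpen {p : ℝ × ℝ | p.2 < ((i : ℝ) + 1) / N ^ N * (1 - p.1) + bundleApex N i * p.1} :=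
    isOpen_lt (by fun_prop) (by fun_prop)
  exact (isOpen_Ioo.preimage continuous_fst).inter (h1.inter h2)

theorem convex_bundleCell (N i : ℕ) : Convex ℝ (bundleCell N i) := by
  rintro p ⟨⟨h1, h2⟩, h3, h4⟩ q ⟨⟨h5, h6⟩, h7, h8⟩ a b ha hb hab
  obtain rfl : b = 1 - a := by linarith
  set l := (i : ℝ) / N ^ N
  set m := ((i : ℝ) + 1) / N ^ N
  set c := bundleApex N i
  have hcomb : ∀ {u v u' v' : ℝ}, u < u' → v < v' → a * u + (1 - a) * v < a * u' + (1 - a) * v' := by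
    intro u v u' v' hu hv
    rcases eq_or_lt_of_le ha with rfl | ha
    · simpa using hv
    · exact add_lt_add_of_lt_of_le (mul_lt_mul_of_pos_left hu ha) (mul_le_mul_of_nonneg_left hv.le hb)
  simp only [bundleCell, Set.mem_ofPred_eq, mem_Ioo, Prod.fst_add, Prod.snd_add, Prod.smul_fst,
    Prod.smul_snd, smul_eq_mul]
  refine ⟨⟨?_, ?_⟩, ?_, ?_⟩
  · simpa using hcomb h1 h5
  · have := hcomb h2 h6; linarith
  · have := hcomb h3 h7; linarith
  · have := hcomb h4 h8; linarith

theorem disjoint_bundleCell {i j : ℕ} (hij : i ≠ j) :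
    Disjoint (bundleCell N i) (bundleCell N j) := by
  wlog h : i < j generalizing i j
  · exact (this hij.symm (by omega)).symm
  rw [disjoint_left]
  rintro p ⟨⟨h1, h2⟩, -, h4⟩ ⟨-, h7, -⟩
  have h8 : ((i : ℝ) + 1) / N ^ N ≤ j / N ^ N := by
    gcongr
    exact_mod_cast h
  have h9 := bundleApex_mono (N := N) h.le
  nlinarith

theorem bundleCell_subset (hN : 0 < N) {i : ℕ} (hi : i < N ^ N) :
    bundleCell N i ⊆ Ioo 0 1 ×ˢ Ioo 0 1 := by
  rintro p ⟨⟨h1, h2⟩, h3, h4⟩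
  have hNpos : (0 : ℝ) < N := by exact_mod_cast hN
  have h5 : ((i : ℝ) + 1) / N ^ N ≤ 1 := by
    rw [div_le_one (by positivity)]
    exact_mod_cast hi
  have h6 := bundleApex_nonneg (N := N) i
  have h7 := bundleApex_le hN i
  have h8 : (i : ℝ) / N ^ N ≤ (i + 1) / N ^ N := by gcongr; linarith
  have h9 : 0 ≤ (i : ℝ) / N ^ N := by positivity
  refine ⟨⟨h1, h2⟩, ?_, ?_⟩ <;> nlinarith

theorem volume_bundleCell (hN : 0 < N) (i : ℕ) :
    volume (bundleCell N i) = ENNReal.ofReal (1 / (2 * N ^ N)) := by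
  have hNpos : (0 : ℝ) < N := by exact_mod_cast hN
  have h1 : bundleCell N i = regionBetween
      (fun s => (i : ℝ) / N ^ N * (1 - s) + bundleApex N i * s)
      (fun s => ((i : ℝ) + 1) / N ^ N * (1 - s) + bundleApex N i * s) (Ioo 0 1) := rfl
  have hc : ∀ l : ℝ, IntegrableOn (fun s : ℝ => l * (1 - s) + bundleApex N i * s) (Ioo 0 1) :=
    fun l => (Continuous.integrableOn_Icc (by fun_prop)).mono_set Ioo_subset_Icc_self
  rw [h1, Measure.volume_eq_prod, volume_regionBetween_eq_integral (hc _) (hc _) measurableSet_Ioo]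
  · congr 1
    have : ∀ s : ℝ, ((fun s => ((i : ℝ) + 1) / N ^ N * (1 - s) + bundleApex N i * s) -
        fun s => (i : ℝ) / N ^ N * (1 - s) + bundleApex N i * s) s = 1 / N ^ N * (1 - s) := by
      intro s
      simp only [Pi.sub_apply]
      ring
    simp only [this]
    rw [← integral_Ioc_eq_integral_Ioo, ← intervalIntegral.integral_of_le zero_le_one,
      intervalIntegral.integral_const_mul, intervalIntegral.integral_sub (by simp) (by simp)]
    simp
    ring
  · intro s hs
    have : (i : ℝ) / N ^ N ≤ (i + 1) / N ^ N := by gcongr; linarith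
    have := mul_le_mul_of_nonneg_right this (by linarith [hs.2] : (0 : ℝ) ≤ 1 - s)
    linarith

theorem volume_iUnion_bundleCell (hN : 0 < N) :
    volume (⋃ i : Fin (N ^ N), bundleCell N i) = ENNReal.ofReal (1 / 2) := by
  have hNpos : (0 : ℝ) < N := by exact_mod_cast hN
  rw [measure_iUnion (fun i j hij => disjoint_bundleCell fun h => hij (Fin.ext h))
    fun i => (isOpen_bundleCell N i).measurableSet]
  simp only [volume_bundleCell hN, tsum_fintype, Finset.sum_const, Finset.card_univ,
    Fintype.card_fin]
  rw [nsmul_eq_mul, ← ENNReal.ofReal_natCast, ← ENNReal.ofReal_mul (by positivity)]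
  congr 1
  push_cast
  field_simp

/-- Every point of a triangle lies on a segment of the bundle; the tilt of the segments
is at most `2 / N`. -/
theorem exists_start_of_mem_bundleCell (hN : 0 < N) {i : ℕ} {p : ℝ × ℝ} (hp : p ∈ bundleCell N i) :
    ∃ y ∈ Ioo ((i : ℝ) / N ^ N) ((i + 1) / N ^ N),
      p.2 = (1 - p.1) * y + p.1 * bundleApex N i ∧ |bundleApex N i - y| ≤ 2 / N := by
  obtain ⟨⟨h1, h2⟩, h3, h4⟩ := hp
  have hNpos : (0 : ℝ) < N := by exact_mod_cast hN
  have h1N : (1 : ℝ) ≤ N := by exact_mod_cast hN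
  have hs : 0 < 1 - p.1 := by linarith
  refine ⟨(p.2 - p.1 * bundleApex N i) / (1 - p.1), ⟨?_, ?_⟩, ?_, ?_⟩
  · rw [lt_div_iff₀ hs]; linarith
  · rw [div_lt_iff₀ hs]; linarith
  · field_simp; ring
  · have ha : (i : ℝ) / N ^ N < (p.2 - p.1 * bundleApex N i) / (1 - p.1) := by
      rw [lt_div_iff₀ hs]; linarith
    have hb : (p.2 - p.1 * bundleApex N i) / (1 - p.1) < (i + 1) / N ^ N := by
      rw [div_lt_iff₀ hs]; linarith
    have hc := bundleApex_le hN i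
    have hd := le_bundleApex hN i
    have he : (1 : ℝ) / N ^ N ≤ 1 / N :=
      one_div_le_one_div_of_le hNpos (le_self_pow₀ h1N (by omega))
    rw [add_div] at hb
    have hf : (2 : ℝ) / N = 1 / N + 1 / N := by ring
    rw [abs_le, hf]
    constructor <;> linarith

end MinRes

namespace MinRes

/-! ### Coordinates in the plane -/

/-- The coordinates of a point of the plane in the orthonormal frame `b`, with origin `c` and
unit of length `l`. -/
noncomputable def frame (b : OrthonormalBasis (Fin 2) ℝ Plane) (c : Plane) (l : ℝ) (x : Plane) :
    ℝ × ℝ :=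
  (l⁻¹ * inner ℝ (b 0) (x - c), l⁻¹ * inner ℝ (b 1) (x - c))

/-- The point of the plane with given coordinates. -/
noncomputable def unframe (b : OrthonormalBasis (Fin 2) ℝ Plane) (c : Plane) (l : ℝ) (q : ℝ × ℝ) :
    Plane :=
  c + l • (q.1 • b 0 + q.2 • b 1)

variable (b : OrthonormalBasis (Fin 2) ℝ Plane) (c : Plane) {l : ℝ}

theorem frame_unframe (hl : 0 < l) (q : ℝ × ℝ) : frame b c l (unframe b c l q) = q := by
  have h00 : inner ℝ (b 0) (b 0) = 1 := by simp
  have h11 : inner ℝ (b 1) (b 1) = 1 := by simp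
  have h01 : inner ℝ (b 0) (b 1) = 0 := b.orthonormal.2 (by simp)
  have h10 : inner ℝ (b 1) (b 0) = 0 := b.orthonormal.2 (by simp)
  ext1
  · simp only [frame, unframe, add_sub_cancel_left, inner_smul_right, inner_add_right, h00, h01]
    field_simp
    ring
  · simp only [frame, unframe, add_sub_cancel_left, inner_smul_right, inner_add_right, h10, h11]
    field_simp
    ring

theorem unframe_frame (hl : 0 < l) (x : Plane) : unframe b c l (frame b c l x) = x := by
  have h := b.sum_repr' (x - c)
  rw [Fin.sum_univ_two] at h
  simp only [frame, unframe]
  rw [smul_add, smul_smul, smul_smul, mul_inv_cancel_left₀ hl.ne', mul_inv_cancel_left₀ hl.ne', h]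
  abel

theorem continuous_frame : Continuous (frame b c l) := by
  unfold frame
  fun_prop

theorem continuous_unframe : Continuous (unframe b c l) := by
  unfold unframe
  fun_prop

theorem frame_add_smul (a x : Plane) (s : ℝ) :
    frame b c l (a + s • (x - a)) = frame b c l a + s • (frame b c l x - frame b c l a) := by
  have h : a + s • (x - a) - c = (a - c) + s • ((x - c) - (a - c)) := by
    rw [sub_sub_sub_cancel_right]; abel
  ext1
  · simp only [frame, h, inner_add_right, inner_smul_right, inner_sub_right (𝕜 := ℝ) (b 0) (x - c),
      Prod.fst_add, Prod.smul_fst, Prod.fst_sub, smul_eq_mul]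
    ring
  · simp only [frame, h, inner_add_right, inner_smul_right, inner_sub_right (𝕜 := ℝ) (b 1) (x - c),
      Prod.snd_add, Prod.smul_snd, Prod.snd_sub, smul_eq_mul]
    ring

theorem inner_sub_eq_frame (hl : 0 < l) (x y : Plane) :
    inner ℝ (b 0) (x - y) = l * ((frame b c l x).1 - (frame b c l y).1) := by
  have h : x - y = (x - c) - (y - c) := by abel
  rw [h, inner_sub_right]
  simp only [frame]
  field_simp

theorem dist_sq_eq_frame (hl : 0 < l) (x y : Plane) :
    dist x y ^ 2 = l ^ 2 * (((frame b c l x).1 - (frame b c l y).1) ^ 2 +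
      ((frame b c l x).2 - (frame b c l y).2) ^ 2) := by
  have h : x - y = (x - c) - (y - c) := by abel
  rw [dist_eq_norm, ← b.sum_sq_norm_inner_right, Fin.sum_univ_two, h, inner_sub_right (b 0) (x - c),
    inner_sub_right (b 1) (x - c)]
  simp only [frame, Real.norm_eq_abs, sq_abs]
  field_simp

theorem convex_preimage_frame {S : Set (ℝ × ℝ)} (hS : Convex ℝ S) :
    Convex ℝ (frame b c l ⁻¹' S) := by
  intro x hx y hy s t hs ht hst
  have h : s • x + t • y = x + t • (y - x) := by
    obtain rfl : s = 1 - t := by linarith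
    module
  rw [mem_preimage, h, frame_add_smul]
  have := hS hx hy hs ht hst
  convert this using 1
  obtain rfl : s = 1 - t := by linarith
  module

theorem volume_preimage_frame (hl : 0 < l) {S : Set (ℝ × ℝ)} (hS : MeasurableSet S) :
    volume (frame b c l ⁻¹' S) = ENNReal.ofReal (l ^ 2) * volume S := by
  let P : Plane → ℝ × ℝ := fun x => (inner ℝ (b 0) x, inner ℝ (b 1) x)
  have hP : MeasurePreserving P volume volume := by
    have h := (volume_preserving_finTwoArrow ℝ).comp
      ((EuclideanSpace.volume_preserving_symm_measurableEquiv_toLp (Fin 2)).comp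
        b.measurePreserving_repr)
    convert h using 1
    funext x
    simp [P, OrthonormalBasis.repr_apply_apply, MeasurableEquiv.finTwoArrow]
  have h1 : frame b c l ⁻¹' S = (fun x => x + -c) ⁻¹' ((fun x => l⁻¹ • x) ⁻¹' (P ⁻¹' S)) := by
    ext x
    simp only [mem_preimage, frame, P, ← sub_eq_add_neg, inner_smul_right]
  rw [h1, measure_preimage_add_right, Measure.addHaar_preimage_smul _ (inv_pos.2 hl).ne',
    hP.measure_preimage hS.nullMeasurableSet]
  congr 2
  rw [finrank_euclideanSpace_fin, abs_of_nonneg (by positivity)]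
  field_simp

theorem subset_closedBall_of_frame (hl : 0 < l) :
    frame b c l ⁻¹' (Ioo 0 1 ×ˢ Ioo 0 1) ⊆ Metric.ball c (2 * l) := by
  rintro x ⟨⟨h1, h2⟩, h3, h4⟩
  have h0 : frame b c l c = 0 := by simp [frame]
  have h := dist_sq_eq_frame b c hl x c
  rw [h0] at h
  simp only [Prod.fst_zero, Prod.snd_zero, sub_zero] at h
  rw [Metric.mem_ball]
  refine lt_of_pow_lt_pow_left₀ 2 (by positivity) ?_
  rw [h, mul_pow, mul_comm]
  refine mul_lt_mul_of_pos_right ?_ (by positivity)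
  nlinarith

/-! ### Fans of cells with thin tails -/

/-- A family of disjoint open convex cells in `G`, each with an apex at distance at most `l` from
the points of the cell. The rays from the points of a cell to its apex stay in the cell, and
beyond the apex they stay, up to the distance `L`, in the compact set `tail`. -/
structure Fan (L l : ℝ) (G : Set Plane) (ι : Type) where
  cell : ι → Set Plane
  apex : ι → Plane
  tail : Set Plane
  isOpen_cell : ∀ i, IsOpen (cell i)
  convex_cell : ∀ i, Convex ℝ (cell i)
  cell_subset : ∀ i, cell i ⊆ G
  disjoint : Pairwise fun i j => Disjoint (cell i) (cell j)
  ne_apex : ∀ i, ∀ x ∈ cell i, x ≠ apex i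
  near : ∀ i, ∀ x ∈ cell i, dist x (apex i) ≤ l
  star : ∀ i, ∀ x ∈ cell i, ∀ s : ℝ, 0 < s → s ≤ 1 → apex i + s • (x - apex i) ∈ cell i
  isCompact_tail : IsCompact tail
  tail_mem : ∀ i, ∀ x ∈ cell i, ∀ s ≤ (0 : ℝ), -s * dist x (apex i) ≤ L →
    apex i + s • (x - apex i) ∈ tail

namespace Fan

variable {L l : ℝ} {G : Set Plane} {ι : Type}

/-- The rays of the fan have the direction `e`, up to the tolerance `θ` in the cosine of the
angle. -/
def Follows (F : Fan L l G ι) (e : Plane) (θ : ℝ) : Prop :=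
  ∀ i, ∀ x ∈ F.cell i, (1 - θ) * dist x (F.apex i) ≤ inner ℝ e (F.apex i - x)

/-- The union of finitely many fans in disjoint sets. -/
def sigma {κ : Type} [Finite κ] {ι : κ → Type} {l : κ → ℝ} {l' : ℝ} (hl : ∀ k, l k ≤ l')
    {G : κ → Set Plane} {G' : Set Plane} (hG : ∀ k, G k ⊆ G')
    (hdisj : Pairwise fun k k' => Disjoint (G k) (G k')) (F : ∀ k, Fan L (l k) (G k) (ι k)) :
    Fan L l' G' (Σ k, ι k) where
  cell i := (F i.1).cell i.2
  apex i := (F i.1).apex i.2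
  tail := ⋃ k, (F k).tail
  isOpen_cell i := (F i.1).isOpen_cell i.2
  convex_cell i := (F i.1).convex_cell i.2
  cell_subset i := ((F i.1).cell_subset i.2).trans (hG i.1)
  disjoint := by
    rintro ⟨k, i⟩ ⟨k', i'⟩ h
    rcases eq_or_ne k k' with rfl | hk
    · exact (F k).disjoint fun h' => h (congrArg (Sigma.mk k) h')
    · exact (hdisj hk).mono ((F k).cell_subset i) ((F k').cell_subset i')
  ne_apex i := (F i.1).ne_apex i.2
  near i x hx := ((F i.1).near i.2 x hx).trans (hl i.1)
  star i := (F i.1).star i.2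
  isCompact_tail := isCompact_iUnion fun k => (F k).isCompact_tail
  tail_mem i x hx s hs h := mem_iUnion.2 ⟨i.1, (F i.1).tail_mem i.2 x hx s hs h⟩

/-- The union of two fans, the second one in a set disjoint from the cells of the first one. -/
def sum {ι' : Type} (F : Fan L l G ι) {G' : Set Plane} (hG : G' ⊆ G)
    (hdisj : ∀ i, Disjoint (F.cell i) G') (F' : Fan L l G' ι') : Fan L l G (ι ⊕ ι') where
  cell := Sum.elim F.cell F'.cell
  apex := Sum.elim F.apex F'.apex
  tail := F.tail ∪ F'.tail
  isOpen_cell i := i.rec F.isOpen_cell F'.isOpen_cell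
  convex_cell i := i.rec F.convex_cell F'.convex_cell
  cell_subset i := i.rec F.cell_subset fun j => (F'.cell_subset j).trans hG
  disjoint := by
    rintro (i | i) (j | j) h
    · exact F.disjoint fun h' => h (by rw [h'])
    · exact (hdisj i).mono_right (F'.cell_subset j)
    · exact ((hdisj j).mono_right (F'.cell_subset i)).symm
    · exact F'.disjoint fun h' => h (by rw [h'])
  ne_apex i := i.rec F.ne_apex F'.ne_apex
  near i := i.rec F.near F'.near
  star i := i.rec F.star F'.star
  isCompact_tail := F.isCompact_tail.union F'.isCompact_tail
  tail_mem i := i.rec (fun j x hx s hs h => Or.inl (F.tail_mem j x hx s hs h))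
    fun j x hx s hs h => Or.inr (F'.tail_mem j x hx s hs h)

end Fan

/-- In every square there is a fan that follows one of its sides, fills half of the square, and has a
tail of arbitrarily small area: the bundle of segments for a large `N`. -/
theorem exists_fan_square (hl : 0 < l) {L : ℝ} (hL : 0 ≤ L) {θ : ℝ} (hθ : 0 < θ) (hθ1 : θ < 1)
    {η : ℝ} (hη : 0 < η) :
    ∃ (n : ℕ) (F : Fan L (2 * l) (frame b c l ⁻¹' (Ioo 0 1 ×ˢ Ioo 0 1)) (Fin n)),
      F.Follows (b 0) θ ∧ volume F.tail ≤ ENNReal.ofReal η ∧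
        volume (⋃ i, F.cell i) = ENNReal.ofReal (l ^ 2 / 2) := by
  set Λ := L / l with hΛ
  have hΛ0 : 0 ≤ Λ := by positivity
  obtain ⟨N, hN⟩ := exists_nat_gt (max (2 / θ) (l ^ 2 * (6 * Λ * (1 + Λ)) / η))
  obtain ⟨hN1, hN2⟩ := max_lt_iff.1 hN
  have hNpos : (0 : ℝ) < N := lt_of_le_of_lt (by positivity) hN1
  have hN0 : 0 < N := by exact_mod_cast hNpos
  have hNθ : 2 / (N : ℝ) ≤ θ := by
    rw [div_lt_iff₀ hθ] at hN1
    rw [div_le_iff₀ hNpos]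
    linarith
  -- the coordinates of the points of the cells and of the apices
  have hkey : ∀ i x, frame b c l x ∈ bundleCell N i →
      ∃ y ∈ Icc ((i : ℝ) / N ^ N) ((i + 1) / N ^ N),
        let a := unframe b c l (1, bundleApex N i)
        let σ := 1 - (frame b c l x).1
        0 < σ ∧ σ ≤ 1 ∧ inner ℝ (b 0) (a - x) = l * σ ∧ l * σ ≤ dist x a ∧
          dist x a ≤ l * σ * (1 + θ) ∧
          ∀ s : ℝ, frame b c l (a + s • (x - a)) =
            (1 - s * σ, bundleApex N i + s * σ * (y - bundleApex N i)) := by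
    intro i x hx
    obtain ⟨y, hy, hxy, htilt⟩ := exists_start_of_mem_bundleCell hN0 hx
    refine ⟨y, Ioo_subset_Icc_self hy, ?_⟩
    intro a σ
    have hσ : 0 < σ := by have := hx.1.2; simp only [σ]; linarith
    have hσ1 : σ ≤ 1 := by have := hx.1.1; simp only [σ]; linarith
    have ha : frame b c l a = (1, bundleApex N i) := frame_unframe b c hl _
    have hd := dist_sq_eq_frame b c hl x a
    have h1 : (frame b c l x).1 - (frame b c l a).1 = -σ := by simp [ha, σ]
    have h2 : (frame b c l x).2 - (frame b c l a).2 = σ * (y - bundleApex N i) := by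
      rw [ha, hxy]
      simp only [σ]
      ring
    rw [h1, h2] at hd
    refine ⟨hσ, hσ1, ?_, ?_, ?_, ?_⟩
    · rw [inner_sub_eq_frame b c hl, ← neg_sub, h1, neg_neg]
    · refine le_of_sq_le_sq ?_ dist_nonneg
      rw [hd, mul_pow]
      refine mul_le_mul_of_nonneg_left ?_ (by positivity)
      nlinarith [sq_nonneg (σ * (y - bundleApex N i))]
    · refine le_of_sq_le_sq ?_ (by positivity)
      have h3 : (y - bundleApex N i) ^ 2 ≤ θ ^ 2 := by
        rw [← sq_abs, abs_sub_comm]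
        exact pow_le_pow_left₀ (abs_nonneg _) (htilt.trans hNθ) 2
      have h4 : (-σ) ^ 2 + (σ * (y - bundleApex N i)) ^ 2 =
          σ ^ 2 * (1 + (y - bundleApex N i) ^ 2) := by ring
      have h5 : (l * σ * (1 + θ)) ^ 2 = l ^ 2 * (σ ^ 2 * (1 + θ) ^ 2) := by ring
      rw [hd, h4, h5]
      refine mul_le_mul_of_nonneg_left (mul_le_mul_of_nonneg_left ?_ ?_) ?_
      · nlinarith
      · positivity
      · positivity
    · intro s
      rw [frame_add_smul, ha]
      ext1
      · simp [σ]; ring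
      · simp only [Prod.snd_add, Prod.smul_snd, Prod.snd_sub, smul_eq_mul]
        rw [hxy]
        simp only [σ]
        ring
  refine ⟨N ^ N, ⟨fun i => frame b c l ⁻¹' bundleCell N i,
    fun i => unframe b c l (1, bundleApex N i), frame b c l ⁻¹' bundleTail N Λ,
    fun i => (isOpen_bundleCell N i).preimage (continuous_frame b c),
    fun i => convex_preimage_frame b c (convex_bundleCell N i),
    fun i => preimage_mono (bundleCell_subset hN0 i.2),
    fun i j hij => (disjoint_bundleCell fun h => hij (Fin.ext h)).preimage _,
    fun i x hx => ?_, fun i x hx => ?_, fun i x hx s hs hs1 => ?_, ?_,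
    fun i x hx s hs hsL => ?_⟩, fun i x hx => ?_, ?_, ?_⟩
  · obtain ⟨y, hy, h1, h2, h3, h4, h5, h6⟩ := hkey i x hx
    exact dist_pos.1 (lt_of_lt_of_le (by positivity) h4)
  · obtain ⟨y, hy, h1, h2, h3, h4, h5, h6⟩ := hkey i x hx
    refine h5.trans ?_
    nlinarith [mul_pos hl h1]
  · obtain ⟨y, hy, hxy, -⟩ := exists_start_of_mem_bundleCell hN0 hx
    rw [mem_preimage, frame_add_smul, frame_unframe b c hl]
    have h1 := hx.1.1
    have h2 := hx.1.2
    set q := frame b c l x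
    have h3 : 0 < s * (1 - q.1) := mul_pos hs (by linarith)
    have h4 : s * (1 - q.1) < 1 := by nlinarith
    refine ⟨⟨?_, ?_⟩, ?_, ?_⟩
    · simp only [Prod.fst_add, Prod.smul_fst, Prod.fst_sub, smul_eq_mul]; linarith
    · simp only [Prod.fst_add, Prod.smul_fst, Prod.fst_sub, smul_eq_mul]; linarith
    · simp only [Prod.fst_add, Prod.smul_fst, Prod.fst_sub, Prod.snd_add, Prod.smul_snd,
        Prod.snd_sub, smul_eq_mul]
      rw [hxy]
      have := mul_lt_mul_of_pos_left hy.1 h3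
      linarith
    · simp only [Prod.fst_add, Prod.smul_fst, Prod.fst_sub, Prod.snd_add, Prod.smul_snd,
        Prod.snd_sub, smul_eq_mul]
      rw [hxy]
      have := mul_lt_mul_of_pos_left hy.2 h3
      linarith
  · have : frame b c l ⁻¹' bundleTail N Λ = unframe b c l '' bundleTail N Λ := by
      ext x
      constructor
      · exact fun hx => ⟨_, hx, unframe_frame b c hl x⟩
      · rintro ⟨q, hq, rfl⟩
        rwa [mem_preimage, frame_unframe b c hl]
    rw [this]
    exact (isCompact_bundleTail N Λ).image (continuous_unframe b c)
  · obtain ⟨y, hy, h1, h2, h3, h4, h5, h6⟩ := hkey i x hx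
    rw [mem_preimage, h6]
    set σ := 1 - (frame b c l x).1
    refine mem_iUnion.2 ⟨i, ⟨(-s * σ, y), ⟨⟨mul_nonneg (by linarith) h1.le, ?_⟩, hy⟩, ?_⟩⟩
    · rw [hΛ, le_div_iff₀ hl]
      have := mul_le_mul_of_nonneg_left h4 (by linarith : 0 ≤ -s)
      linarith
    · ext1
      · simp only; ring
      · simp only; ring
  · obtain ⟨y, hy, h1, h2, h3, h4, h5, h6⟩ := hkey i x hx
    rw [h3]
    have h7 := mul_le_mul_of_nonneg_left h5 (by linarith : 0 ≤ 1 - θ)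
    nlinarith [mul_pos hl h1, sq_nonneg θ]
  · rw [volume_preimage_frame b c hl (isCompact_bundleTail N Λ).measurableSet]
    refine (mul_le_mul_right (volume_bundleTail_le hN0 hΛ0) _).trans ?_
    rw [← ENNReal.ofReal_mul (by positivity)]
    refine ENNReal.ofReal_le_ofReal ?_
    rw [div_lt_iff₀ hη] at hN2
    rw [← mul_div_assoc, div_le_iff₀ hNpos]
    linarith
  · have h1 : (⋃ i : Fin (N ^ N), frame b c l ⁻¹' bundleCell N i) =
        frame b c l ⁻¹' ⋃ i : Fin (N ^ N), bundleCell N i := preimage_iUnion.symm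
    rw [h1, volume_preimage_frame b c hl (S := ⋃ i : Fin (N ^ N), bundleCell N i)
      (MeasurableSet.iUnion fun i => (isOpen_bundleCell N i).measurableSet),
      volume_iUnion_bundleCell hN0, ← ENNReal.ofReal_mul (by positivity)]
    congr 1
    ring

end MinRes

namespace MinRes

/-! ### Exhausting an open set by fans -/

/-- An open set of finite area is filled, up to a small area, by finitely many disjoint small closed
discs. -/
theorem exists_finite_closedBalls {G : Set Plane} (hG : IsOpen G) (hfin : volume G ≠ ⊤) {R : ℝ}
    (hR : 0 < R) {δ : ℝ} (hδ : 0 < δ) :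
    ∃ (t : Finset Plane) (ρ : Plane → ℝ),
      (∀ x ∈ t, 0 < ρ x ∧ ρ x < R ∧ Metric.closedBall x (ρ x) ⊆ G) ∧
      (t : Set Plane).PairwiseDisjoint (fun x => Metric.closedBall x (ρ x)) ∧
      volume (G \ ⋃ x ∈ t, Metric.closedBall x (ρ x)) ≤ ENNReal.ofReal δ := by
  classical
  obtain ⟨t, ρ, htc, -, hρ, hcov, hdisj⟩ := Besicovitch.exists_disjoint_closedBall_covering_ae
    volume (fun x => {ρ : ℝ | Metric.closedBall x ρ ⊆ G}) G (fun x hx δ hδ => by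
      obtain ⟨ε, hε, hball⟩ := Metric.isOpen_iff.1 hG x hx
      refine ⟨min ε δ / 2, ?_, by positivity, ?_⟩
      · refine (Metric.closedBall_subset_ball ?_).trans hball
        linarith [min_le_left ε δ, lt_min hε hδ]
      · linarith [min_le_right ε δ, lt_min hε hδ]) (fun _ => R) (fun _ _ => hR)
  rcases t.eq_empty_or_nonempty with rfl | hne
  · refine ⟨∅, ρ, by simp, by simp, ?_⟩
    simp only [mem_empty_iff_false, iUnion_of_empty, iUnion_empty, sdiff_empty] at hcov
    simp [hcov]
  obtain ⟨f, rfl⟩ := htc.exists_eq_range hne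
  let S : ℕ → Set Plane := fun n => G \ ⋃ k < n, Metric.closedBall (f k) (ρ (f k))
  have hmeas : ∀ n, NullMeasurableSet (S n) volume := fun n =>
    (hG.measurableSet.diff (MeasurableSet.biUnion (Set.to_countable _)
      fun k _ => Metric.isClosed_closedBall.measurableSet)).nullMeasurableSet
  have hanti : Antitone S := fun m n hmn => sdiff_subset_sdiff_right
    (biUnion_subset_biUnion_left fun k (hk : k < m) => lt_of_lt_of_le hk hmn)
  have hlim := tendsto_measure_iInter_atTop hmeas hanti
    ⟨0, ((measure_mono sdiff_subset).trans_lt hfin.lt_top).ne⟩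
  have hzero : volume (⋂ n, S n) = 0 := by
    refine measure_mono_null (fun x hx => ?_) hcov
    refine ⟨(mem_iInter.1 hx 0).1, fun h => ?_⟩
    obtain ⟨_, ⟨k, rfl⟩, hk⟩ := mem_iUnion₂.1 h
    exact (mem_iInter.1 hx (k + 1)).2 (mem_iUnion₂.2 ⟨k, by omega, hk⟩)
  rw [hzero] at hlim
  obtain ⟨n, hn⟩ := (hlim.eventually (gt_mem_nhds (ENNReal.ofReal_pos.2 hδ))).exists
  refine ⟨(Finset.range n).image f, ρ, fun x hx => ?_, hdisj.subset fun x hx => ?_, ?_⟩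
  · obtain ⟨k, -, rfl⟩ := Finset.mem_image.1 hx
    have := hρ (f k) ⟨k, rfl⟩
    exact ⟨this.2.1, this.2.2, this.1⟩
  · obtain ⟨k, -, rfl⟩ := Finset.mem_image.1 hx
    exact ⟨k, rfl⟩
  · refine le_trans (measure_mono ?_) hn.le
    refine sdiff_subset_sdiff_right fun x hx => ?_
    obtain ⟨k, hk, hxk⟩ := mem_iUnion₂.1 hx
    exact mem_iUnion₂.2 ⟨f k, Finset.mem_image_of_mem f (Finset.mem_range.2 hk), hxk⟩

/-- The empty fan. -/
def Fan.empty (L l : ℝ) (G : Set Plane) : Fan L l G Empty where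
  cell := Empty.elim
  apex := Empty.elim
  tail := ∅
  isOpen_cell := fun i => i.elim
  convex_cell := fun i => i.elim
  cell_subset := fun i => i.elim
  disjoint := fun i => i.elim
  ne_apex := fun i => i.elim
  near := fun i => i.elim
  star := fun i => i.elim
  isCompact_tail := isCompact_empty
  tail_mem := fun i => i.elim

theorem exists_orthonormalBasis_zero_eq {e : Plane} (he : ‖e‖ = 1) :
    ∃ b : OrthonormalBasis (Fin 2) ℝ Plane, b 0 = e := by
  have h : Orthonormal ℝ (({0} : Set (Fin 2)).domRestrict fun _ => e) := by
    refine ⟨fun _ => he, fun i j hij => (hij ?_).elim⟩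
    exact Subtype.ext (i.2.trans j.2.symm)
  obtain ⟨b, hb⟩ := h.exists_orthonormalBasis_extension_of_card_eq (by simp)
  exact ⟨b, hb 0 rfl⟩

/-- A fan with a small tail that fills a fixed part of a given open set: it is composed of fans in
squares inscribed into the discs of a packing. -/
theorem exists_fan_part {e : Plane} (he : ‖e‖ = 1) {L : ℝ} (hL : 0 ≤ L) {θ : ℝ} (hθ : 0 < θ)
    (hθ1 : θ < 1) {l : ℝ} (hl : 0 < l) {G : Set Plane} (hG : IsOpen G) (hfin : volume G ≠ ⊤)
    {η : ℝ} (hη : 0 < η) :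
    ∃ (ι : Type) (_ : Finite ι) (F : Fan L l G ι), F.Follows e θ ∧
      volume F.tail ≤ ENNReal.ofReal η ∧ volume G ≤ 64 * volume (⋃ i, F.cell i) := by
  obtain ⟨b, hb⟩ := exists_orthonormalBasis_zero_eq he
  rcases eq_or_ne (volume G) 0 with h0 | h0
  · exact ⟨Empty, inferInstance, Fan.empty L l G, fun i => i.elim, by simp [Fan.empty], by simp [h0]⟩
  have hpos : 0 < (volume G).toReal := ENNReal.toReal_pos h0 hfin
  obtain ⟨t, ρ, hρ, hdisj, hcov⟩ := exists_finite_closedBalls hG hfin hl (half_pos hpos)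
  set η' := η / (t.card + 1) with hη'
  have hη'pos : 0 < η' := by positivity
  have hsq : ∀ x : t, 0 < ρ x / 2 := fun x => half_pos (hρ x x.2).1
  choose n F hF1 hF2 hF3 using fun x : t =>
    exists_fan_square b (x : Plane) (hsq x) hL hθ hθ1 hη'pos
  have hball : ∀ x : t, frame b (x : Plane) (ρ x / 2) ⁻¹' (Ioo 0 1 ×ˢ Ioo 0 1) ⊆
      Metric.closedBall (x : Plane) (ρ x) := fun x => by
    refine (subset_closedBall_of_frame b (x : Plane) (hsq x)).trans ?_
    rw [mul_div_cancel₀ _ two_ne_zero]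
    exact Metric.ball_subset_closedBall
  have hd : Pairwise fun x y : t => Disjoint
      (frame b (x : Plane) (ρ x / 2) ⁻¹' (Ioo 0 1 ×ˢ Ioo 0 1))
      (frame b (y : Plane) (ρ y / 2) ⁻¹' (Ioo 0 1 ×ˢ Ioo 0 1)) := fun x y hxy =>
    (hdisj x.2 y.2 fun h => hxy (Subtype.ext h)).mono (hball x) (hball y)
  let F' := Fan.sigma (l' := l) (G' := G)
    (fun x : t => by rw [mul_div_cancel₀ _ two_ne_zero]; exact (hρ x x.2).2.1.le)
    (fun x => (hball x).trans (hρ x x.2).2.2) hd F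
  refine ⟨_, inferInstance, F', fun i x hx => ?_, ?_, ?_⟩
  · rw [← hb]
    exact hF1 i.1 i.2 x hx
  · refine (measure_iUnion_le _).trans ?_
    rw [tsum_fintype]
    refine (Finset.sum_le_sum fun x _ => hF2 x).trans ?_
    rw [Finset.sum_const, Finset.card_univ, Fintype.card_coe, nsmul_eq_mul,
      ← ENNReal.ofReal_natCast, ← ENNReal.ofReal_mul (by positivity)]
    refine ENNReal.ofReal_le_ofReal ?_
    rw [hη', ← mul_div_assoc, div_le_iff₀ (by positivity)]
    nlinarith
  · have hcells : volume (⋃ i, F'.cell i) = ∑ x : t, volume (⋃ j, (F x).cell j) := by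
      have h1 : (⋃ i, F'.cell i) = ⋃ x : t, ⋃ j, (F x).cell j := iUnion_sigma _
      rw [h1, measure_iUnion, tsum_fintype]
      · intro x y hxy
        exact (hd hxy).mono (iUnion_subset (F x).cell_subset) (iUnion_subset (F y).cell_subset)
      · exact fun x => (isOpen_iUnion (F x).isOpen_cell).measurableSet
    have hone : ∀ x : t, volume (Metric.closedBall (x : Plane) (ρ x)) ≤
        32 * volume (⋃ j, (F x).cell j) := by
      intro x
      rw [hF3, EuclideanSpace.volume_closedBall_fin_two, ← ENNReal.ofReal_pow (hρ x x.2).1.le]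
      have h32 : (32 : ENNReal) = ENNReal.ofReal 32 := by simp
      rw [h32, ← ENNReal.ofReal_mul (by positivity), ← ENNReal.ofReal_mul (by positivity)]
      refine ENNReal.ofReal_le_ofReal ?_
      nlinarith [Real.pi_le_four, sq_nonneg (ρ x)]
    have hsum : volume (⋃ x ∈ t, Metric.closedBall x (ρ x)) ≤ 32 * volume (⋃ i, F'.cell i) := by
      refine (measure_biUnion_finset_le _ _).trans ?_
      rw [hcells, Finset.mul_sum, ← Finset.sum_coe_sort]
      exact Finset.sum_le_sum fun x _ => hone x
    have hhalf : volume G ≤ volume G / 2 + 32 * volume (⋃ i, F'.cell i) := by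
      calc volume G ≤ volume (G \ ⋃ x ∈ t, Metric.closedBall x (ρ x)) +
            volume (⋃ x ∈ t, Metric.closedBall x (ρ x)) := by
            refine le_trans (measure_mono fun x hx => ?_) (measure_union_le _ _)
            by_cases h : x ∈ ⋃ x ∈ t, Metric.closedBall x (ρ x)
            · exact Or.inr h
            · exact Or.inl ⟨hx, h⟩
        _ ≤ volume G / 2 + 32 * volume (⋃ i, F'.cell i) := by
            refine add_le_add (hcov.trans_eq ?_) hsum
            rw [ENNReal.ofReal_div_of_pos two_pos, ENNReal.ofReal_toReal hfin]
            simp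
    have h2 : volume G / 2 ≤ 32 * volume (⋃ i, F'.cell i) := by
      have h3 : volume G / 2 ≠ ⊤ := ENNReal.div_ne_top hfin two_ne_zero
      refine (ENNReal.add_le_add_iff_left h3).1 ?_
      rwa [ENNReal.add_halves]
    calc volume G = volume G / 2 + volume G / 2 := (ENNReal.add_halves _).symm
      _ ≤ 32 * volume (⋃ i, F'.cell i) + 32 * volume (⋃ i, F'.cell i) := add_le_add h2 h2
      _ = 64 * volume (⋃ i, F'.cell i) := by rw [← add_mul]; norm_num

/-- Filling again and again a fixed part of what is left. -/
theorem exists_fan_rounds {e : Plane} (he : ‖e‖ = 1) {L : ℝ} (hL : 0 ≤ L) {θ : ℝ} (hθ : 0 < θ)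
    (hθ1 : θ < 1) {l : ℝ} (hl : 0 < l) {G : Set Plane} (hG : IsOpen G) (hfin : volume G ≠ ⊤)
    (n : ℕ) {η : ℝ} (hη : 0 < η) :
    ∃ (ι : Type) (_ : Finite ι) (F : Fan L l G ι), F.Follows e θ ∧
      volume F.tail ≤ ENNReal.ofReal η ∧
      (volume (G \ ⋃ i, F.cell i)).toReal ≤ (63 / 64) ^ n * (volume G).toReal := by
  induction n generalizing η with
  | zero =>
    refine ⟨Empty, inferInstance, Fan.empty L l G, fun i => i.elim, by simp [Fan.empty], ?_⟩
    simp
  | succ n ih =>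
    obtain ⟨ι, _, F, hF1, hF2, hF3⟩ := ih (half_pos hη)
    set G' := G \ closure (⋃ i, F.cell i) with hG'
    have hG'o : IsOpen G' := hG.sdiff isClosed_closure
    have hsub : G' ⊆ G := sdiff_subset
    have hfin' : volume G' ≠ ⊤ := ((measure_mono hsub).trans_lt hfin.lt_top).ne
    obtain ⟨ι', _, F', hF1', hF2', hF3'⟩ := exists_fan_part he hL hθ hθ1 hl hG'o hfin' (half_pos hη)
    have hdisj : ∀ i, Disjoint (F.cell i) G' := fun i => by
      rw [disjoint_left]
      exact fun x hx hx' => hx'.2 (subset_closure (mem_iUnion.2 ⟨i, hx⟩))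
    refine ⟨_, inferInstance, F.sum hsub hdisj F', ?_, ?_, ?_⟩
    · rintro (i | i)
      · exact hF1 i
      · exact hF1' i
    · refine (measure_union_le _ _).trans ?_
      rw [← add_halves η, ENNReal.ofReal_add (by positivity) (by positivity)]
      exact add_le_add hF2 hF2'
    · have hleft : volume (G \ ⋃ i, (F.sum hsub hdisj F').cell i) ≤
          volume (G' \ ⋃ i, F'.cell i) := by
        have hfr : volume (⋃ i, frontier (F.cell i)) = 0 :=
          measure_iUnion_null fun i => (F.convex_cell i).addHaar_frontier volume
        refine (measure_mono (t := (G' \ ⋃ i, F'.cell i) ∪ ⋃ i, frontier (F.cell i)) ?_).trans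
          ((measure_union_le _ _).trans_eq (by rw [hfr, add_zero]))
        rintro x ⟨hxG, hx⟩
        rw [mem_iUnion, not_exists] at hx
        by_cases hcl : x ∈ closure (⋃ i, F.cell i)
        · right
          rw [closure_iUnion_of_finite] at hcl
          obtain ⟨i, hi⟩ := mem_iUnion.1 hcl
          exact mem_iUnion.2 ⟨i, hi, fun h => hx (Sum.inl i) (interior_subset h)⟩
        · left
          refine ⟨⟨hxG, hcl⟩, fun h => ?_⟩
          obtain ⟨i, hi⟩ := mem_iUnion.1 h
          exact hx (Sum.inr i) hi
      have hcells : volume (⋃ i, F'.cell i) ≠ ⊤ :=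
        ((measure_mono (iUnion_subset F'.cell_subset)).trans_lt hfin'.lt_top).ne
      have hpart : (volume (G' \ ⋃ i, F'.cell i)).toReal ≤ 63 / 64 * (volume G').toReal := by
        rw [measure_sdiff (iUnion_subset F'.cell_subset)
          (isOpen_iUnion F'.isOpen_cell).measurableSet.nullMeasurableSet hcells,
          ENNReal.toReal_sub_of_le (measure_mono (iUnion_subset F'.cell_subset)) hfin']
        have h1 := ENNReal.toReal_mono (ENNReal.mul_ne_top (by simp) hcells) hF3'
        rw [ENNReal.toReal_mul] at h1
        norm_num at h1
        linarith
      have hG'le : (volume G').toReal ≤ (volume (G \ ⋃ i, F.cell i)).toReal :=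
        ENNReal.toReal_mono ((measure_mono sdiff_subset).trans_lt hfin.lt_top).ne
          (measure_mono (sdiff_subset_sdiff_right subset_closure))
      calc _ ≤ (volume (G' \ ⋃ i, F'.cell i)).toReal :=
            ENNReal.toReal_mono ((measure_mono sdiff_subset).trans_lt hfin'.lt_top).ne hleft
        _ ≤ 63 / 64 * (volume G').toReal := hpart
        _ ≤ 63 / 64 * ((63 / 64) ^ n * (volume G).toReal) := by
            linarith
        _ = (63 / 64) ^ (n + 1) * (volume G).toReal := by ring

/-- In an open set of finite area there is a fan with a given direction that fills almost the whole
set and has a tail of arbitrarily small area. -/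
theorem exists_fan {e : Plane} (he : ‖e‖ = 1) {L : ℝ} (hL : 0 ≤ L) {θ : ℝ} (hθ : 0 < θ)
    (hθ1 : θ < 1) {l : ℝ} (hl : 0 < l) {G : Set Plane} (hG : IsOpen G) (hfin : volume G ≠ ⊤)
    {η : ℝ} (hη : 0 < η) :
    ∃ (ι : Type) (_ : Finite ι) (F : Fan L l G ι), F.Follows e θ ∧
      volume F.tail ≤ ENNReal.ofReal η ∧ volume (G \ ⋃ i, F.cell i) ≤ ENNReal.ofReal η := by
  have hlim : Tendsto (fun n : ℕ => (63 / 64 : ℝ) ^ n * (volume G).toReal) atTop (𝓝 0) := by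
    simpa using (tendsto_pow_atTop_nhds_zero_of_lt_one (by norm_num : (0 : ℝ) ≤ 63 / 64)
      (by norm_num)).mul_const (volume G).toReal
  obtain ⟨n, hn⟩ := (hlim.eventually (gt_mem_nhds hη)).exists
  obtain ⟨ι, hι, F, h1, h2, h3⟩ := exists_fan_rounds he hL hθ hθ1 hl hG hfin n hη
  refine ⟨ι, hι, F, h1, h2, ?_⟩
  rw [← ENNReal.ofReal_toReal ((measure_mono sdiff_subset).trans_lt hfin.lt_top).ne]
  exact ENNReal.ofReal_le_ofReal (h3.trans hn.le)

end MinRes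

namespace MinRes

/-! ### The mirrors that almost attain the infimum -/

/-- A convex domain lies in a half-plane that comes as close to a given inner point as
the boundary of the domain. -/
theorem exists_support {Ω : Set Plane} (hconv : Convex ℝ Ω) (hopen : IsOpen Ω)
    (hbdd : Bornology.IsBounded Ω) {x : Plane} (hx : x ∈ Ω) :
    ∃ v : Plane, ‖v‖ = 1 ∧ ∀ y ∈ closure Ω,
      inner ℝ v (y - x) ≤ Metric.infDist x (frontier Ω) := by
  have hne : (frontier Ω).Nonempty := by
    obtain ⟨t, -, ht⟩ := exists_ray_mem_frontier hopen hbdd hx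
      (g := EuclideanSpace.single 0 1) (by simp)
    exact ⟨_, ht⟩
  obtain ⟨p, hp, hxp⟩ := isClosed_frontier.exists_infDist_eq_dist hne x
  have hpΩ : p ∉ Ω := (hopen.frontier_eq ▸ hp).2
  obtain ⟨f, hf⟩ := geometric_hahn_banach_open_point hconv hopen hpΩ
  set w := (InnerProductSpace.toDual ℝ Plane).symm f with hw
  have hfw : ∀ y, f y = inner ℝ w y := fun y => by
    rw [hw, InnerProductSpace.toDual_symm_apply]
  have hw0 : w ≠ 0 := by
    intro h
    have := hf x hx
    rw [hfw, hfw, h] at this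
    simp at this
  have hwpos : 0 < ‖w‖ := norm_pos_iff.2 hw0
  refine ⟨‖w‖⁻¹ • w, norm_smul_inv_norm hw0, fun y hy => ?_⟩
  have hcl : inner ℝ w y ≤ inner ℝ w p := by
    have hc : IsClosed {z : Plane | inner ℝ w z ≤ inner ℝ w p} :=
      isClosed_le (by fun_prop) (by fun_prop)
    refine closure_minimal (fun z hz => ?_) hc hy
    have := hf z hz
    rw [hfw, hfw] at this
    exact this.le
  rw [hxp, real_inner_smul_left, inv_mul_le_iff₀ hwpos, dist_comm, dist_eq_norm]
  refine le_trans ?_ (real_inner_le_norm w (p - x))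
  rw [inner_sub_right, inner_sub_right]
  linarith

theorem one_div_sqrt_lipschitz (a b : ℝ) :
    1 / Real.sqrt (1 + a ^ 2) - |b - a| ≤ 1 / Real.sqrt (1 + b ^ 2) := by
  have ha : 1 ≤ Real.sqrt (1 + a ^ 2) := Real.one_le_sqrt.2 (by nlinarith [sq_nonneg a])
  have hb : 1 ≤ Real.sqrt (1 + b ^ 2) := Real.one_le_sqrt.2 (by nlinarith [sq_nonneg b])
  have ha2 := Real.sq_sqrt (show 0 ≤ 1 + a ^ 2 by positivity)
  have hab : |a| ≤ Real.sqrt (1 + a ^ 2) := Real.abs_le_sqrt (by linarith)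
  have h1 : Real.sqrt (1 + b ^ 2) ≤ Real.sqrt (1 + a ^ 2) + |b - a| := by
    rw [Real.sqrt_le_left (by positivity)]
    have h2 : a * (b - a) ≤ |a| * |b - a| := by rw [← abs_mul]; exact le_abs_self _
    have h3 := mul_le_mul_of_nonneg_right hab (abs_nonneg (b - a))
    nlinarith [sq_abs (b - a)]
  rw [sub_le_iff_le_add, ← sub_le_iff_le_add', div_sub_div _ _ (by positivity) (by positivity),
    div_le_iff₀ (by positivity)]
  nlinarith [abs_nonneg (b - a), mul_le_mul ha hb zero_le_one (by positivity)]

/-- The slope at which vertical particles are reflected so that they descend with the slope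
`σ`. -/
noncomputable def mirrorSlope (σ : ℝ) : ℝ := σ + Real.sqrt (1 + σ ^ 2)

theorem one_le_mirrorSlope {σ : ℝ} (hσ : 0 ≤ σ) : 1 ≤ mirrorSlope σ := by
  have : 1 ≤ Real.sqrt (1 + σ ^ 2) := Real.one_le_sqrt.2 (by nlinarith [sq_nonneg σ])
  unfold mirrorSlope
  linarith

theorem mirrorSlope_sq (σ : ℝ) : mirrorSlope σ ^ 2 - 1 = 2 * mirrorSlope σ * σ := by
  have := Real.sq_sqrt (show 0 ≤ 1 + σ ^ 2 by positivity)
  unfold mirrorSlope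
  linear_combination this

theorem one_div_one_add_mirrorSlope_sq {H D : ℝ} (hH : 0 < H) (hD : 0 < D) :
    1 / (1 + mirrorSlope (H / D) ^ 2) = 1 / 2 * (1 - 1 / Real.sqrt (1 + (D / H) ^ 2)) := by
  have h1 : Real.sqrt (1 + (D / H) ^ 2) = Real.sqrt (1 + (H / D) ^ 2) / (H / D) := by
    rw [eq_div_iff (by positivity), ← Real.sqrt_sq (show 0 ≤ H / D by positivity),
      ← Real.sqrt_mul (by positivity), Real.sqrt_sq (show 0 ≤ H / D by positivity)]
    congr 1
    field_simp
    ring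
  rw [h1]
  have h2 := Real.sq_sqrt (show 0 ≤ 1 + (H / D) ^ 2 by positivity)
  have hS : 0 < Real.sqrt (1 + (H / D) ^ 2) := by positivity
  have hσ : 0 < H / D := by positivity
  unfold mirrorSlope
  generalize Real.sqrt (1 + (H / D) ^ 2) = S at *
  generalize H / D = σ at *
  have h3 : 1 + (σ + S) ^ 2 = 2 * (S * (σ + S)) := by linear_combination -h2
  rw [h3]
  field_simp
  linear_combination -h2

theorem div_sqrt_eq {M d : ℝ} (hM : 0 < M) :
    M / Real.sqrt (M ^ 2 + d ^ 2) = 1 / Real.sqrt (1 + (d / M) ^ 2) := by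
  have h1 : Real.sqrt (M ^ 2 + d ^ 2) = M * Real.sqrt (1 + (d / M) ^ 2) := by
    rw [show M ^ 2 + d ^ 2 = M ^ 2 * (1 + (d / M) ^ 2) by field_simp, Real.sqrt_mul (by positivity),
      Real.sqrt_sq hM.le]
  have : 0 < Real.sqrt (1 + (d / M) ^ 2) := by positivity
  rw [h1]
  field_simp

/-- The choice of the tolerance `θ`: aiming from the height `(1 - θ) * M` at distances increased
by `2 * θ` and by the factor `(1 - θ)⁻¹` changes the resistance by less than `ε`. -/
theorem exists_tolerance {M ε : ℝ} (hM : 0 < M) (hε : 0 < ε) (L : ℝ) :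
    ∃ θ : ℝ, 0 < θ ∧ θ < 1 ∧ ∀ d d' : ℝ, 0 ≤ d → d ≤ L → 0 < d' → d' ≤ d + θ →
      1 / (1 + mirrorSlope ((1 - θ) * M / ((d' + θ) / (1 - θ))) ^ 2) ≤
        1 / 2 * (1 - M / Real.sqrt (M ^ 2 + d ^ 2)) + ε := by
  have hlim : Tendsto (fun θ : ℝ => ((L + 2 * θ) / (1 - θ) ^ 2 - L) / M) (𝓝[>] 0) (𝓝 0) := by
    have hc : ContinuousAt (fun θ : ℝ => ((L + 2 * θ) / (1 - θ) ^ 2 - L) / M) 0 := by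
      refine ContinuousAt.div_const (ContinuousAt.sub (ContinuousAt.div ?_ ?_ (by norm_num)) ?_) _
      · fun_prop
      · fun_prop
      · fun_prop
    have := hc.tendsto.mono_left (nhdsWithin_le_nhds (s := Ioi 0))
    simpa using this
  have hsm : ∀ᶠ θ in 𝓝[>] (0 : ℝ), θ < 1 := nhdsWithin_le_nhds (gt_mem_nhds one_pos)
  obtain ⟨θ, hθ, hθ1, hθ0 : 0 < θ⟩ :=
    ((hlim.eventually (gt_mem_nhds hε)).and (hsm.and self_mem_nhdsWithin)).exists
  refine ⟨θ, hθ0, hθ1, fun d d' hd hdL hd' hdd => ?_⟩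
  have hθ' : 0 < 1 - θ := by linarith
  have hD : 0 < (d' + θ) / (1 - θ) := by positivity
  rw [one_div_one_add_mirrorSlope_sq (mul_pos hθ' hM) hD, div_sqrt_eq hM]
  set a := d / M with ha
  set c := (d' + θ) / (1 - θ) / ((1 - θ) * M) with hc
  have ha0 : 0 ≤ a := by positivity
  have hc0 : 0 ≤ c := by positivity
  have hca : c ≤ a + ε := by
    have h1 : c ≤ (d + 2 * θ) / (1 - θ) ^ 2 / M := by
      have h0 : d' + θ ≤ d + 2 * θ := by linarith
      rw [hc, div_div, div_div, ← mul_assoc, ← sq]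
      gcongr
    have h2 : (d + 2 * θ) / (1 - θ) ^ 2 - d ≤ (L + 2 * θ) / (1 - θ) ^ 2 - L := by
      have h3 : 1 ≤ 1 / (1 - θ) ^ 2 := by
        rw [le_div_iff₀ (by positivity)]
        nlinarith
      have h4 : (L + 2 * θ) / (1 - θ) ^ 2 - (d + 2 * θ) / (1 - θ) ^ 2 =
          (L - d) * (1 / (1 - θ) ^ 2) := by ring
      nlinarith
    rw [div_lt_iff₀ hM] at hθ
    have h5 : c ≤ (d + ε * M) / M := h1.trans (by gcongr; linarith)
    rwa [add_div, mul_div_cancel_right₀ _ hM.ne'] at h5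
  have hmono : 1 / Real.sqrt (1 + (a + ε) ^ 2) ≤ 1 / Real.sqrt (1 + c ^ 2) := by
    gcongr
  have hlip := one_div_sqrt_lipschitz a (a + ε)
  rw [add_sub_cancel_left, abs_of_pos hε] at hlip
  linarith

/-- Finite systems of mirrors over almost all of `Ω`, of a slope at which the particles are
reflected almost towards the nearest boundary point at the foot of the body. -/
theorem exists_mirrors {Ω : Set Plane} (hconv : Convex ℝ Ω) (hopen : IsOpen Ω)
    (hbdd : Bornology.IsBounded Ω) {M : ℝ} (hM : 0 < M) {ε : ℝ} (hε : 0 < ε) :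
    ∃ (H : ℝ) (ι : Type) (_ : Finite ι) (D : Mirrors Ω M H ι),
      (∀ i, ∀ x ∈ D.disc i, 1 / (1 + D.slope i ^ 2) ≤
        1 / 2 * (1 - M / Real.sqrt (M ^ 2 + Metric.infDist x (frontier Ω) ^ 2)) + ε) ∧
      volume (Ω \ ⋃ i, D.disc i) ≤ ENNReal.ofReal ε := by
  have hfin : volume Ω ≠ ⊤ := hbdd.measure_lt_top.ne
  set L := Metric.diam (closure Ω) with hL
  have hL0 : 0 ≤ L := Metric.diam_nonneg
  have hdist : ∀ x ∈ closure Ω, ∀ y ∈ closure Ω, dist x y ≤ L := fun x hx y hy =>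
    Metric.dist_le_diam_of_mem hbdd.closure hx hy
  have hsub := subset_closure (s := Ω)
  obtain ⟨θ, hθ, hθ1, htol⟩ := exists_tolerance hM hε L
  have hθ' : 0 < 1 - θ := by linarith
  -- small discs in which the direction to the boundary is almost constant
  have hε4 : 0 < ε / 4 := by positivity
  obtain ⟨t, ρ, hρ, hdisj, hcov⟩ := exists_finite_closedBalls hopen hfin hθ hε4
  have htΩ : ∀ x : t, (x : Plane) ∈ Ω := fun x =>
    (hρ x x.2).2.2 (Metric.mem_closedBall_self (hρ x x.2).1.le)
  set d : t → ℝ := fun x => Metric.infDist (x : Plane) (frontier Ω) with hd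
  have hdpos : ∀ x, 0 < d x := fun x => by
    have h1 : (frontier Ω).Nonempty := by
      obtain ⟨s, -, hs⟩ := exists_ray_mem_frontier hopen hbdd (htΩ x)
        (g := EuclideanSpace.single 0 1) (by simp)
      exact ⟨_, hs⟩
    refine (isClosed_frontier.notMem_iff_infDist_pos h1).1 fun h => ?_
    exact (hopen.frontier_eq ▸ h).2 (htΩ x)
  choose v hv1 hv using fun x : t => exists_support hconv hopen hbdd (htΩ x)
  -- the distance to be covered, and the slope of the mirrors that send the particles so far
  set D : t → ℝ := fun x => (d x + θ) / (1 - θ) with hD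
  have hDpos : ∀ x, 0 < D x := fun x => by have := hdpos x; positivity
  set H := (1 - θ) * M with hH
  have hHpos : 0 < H := by positivity
  set g : t → ℝ := fun x => mirrorSlope (H / D x) with hg
  have hg1 : ∀ x, 1 ≤ g x := fun x => one_le_mirrorSlope (by have := hDpos x; positivity)
  have hg0 : ∀ x, 0 < g x := fun x => one_pos.trans_le (hg1 x)
  set η := ε / 4 / (t.card + 1) with hη
  have hηpos : 0 < η := by positivity
  have hηsum : ∑ _x : t, ENNReal.ofReal η ≤ ENNReal.ofReal (ε / 4) := by
    rw [Finset.sum_const, Finset.card_univ, Fintype.card_coe, nsmul_eq_mul,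
      ← ENNReal.ofReal_natCast, ← ENNReal.ofReal_mul (by positivity)]
    refine ENNReal.ofReal_le_ofReal ?_
    rw [hη, ← mul_div_assoc, div_le_iff₀ (by positivity)]
    nlinarith
  have hballfin : ∀ x : t, volume (Metric.ball (x : Plane) (ρ x)) ≠ ⊤ := fun x =>
    Metric.isBounded_ball.measure_lt_top.ne
  have hlpos : ∀ x : t, 0 < θ * M / g x := fun x => by have := hg0 x; positivity
  choose ι hι F hF1 hF2 hF3 using fun x : t => exists_fan (hv1 x) hL0 hθ hθ1
    (hlpos x) (Metric.isOpen_ball (x := (x : Plane)) (ε := ρ x)) (hballfin x) hηpos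
  have hballsub : ∀ x : t, Metric.ball (x : Plane) (ρ x) ⊆ Ω := fun x =>
    Metric.ball_subset_closedBall.trans (hρ x x.2).2.2
  have hd' : Pairwise fun x y : t =>
      Disjoint (Metric.ball (x : Plane) (ρ x)) (Metric.ball (y : Plane) (ρ y)) := fun x y hxy =>
    (hdisj x.2 y.2 fun h => hxy (Subtype.ext h)).mono Metric.ball_subset_closedBall
      Metric.ball_subset_closedBall
  let F' : Fan L (θ * M) Ω (Σ x, ι x) := Fan.sigma (fun x : t => div_le_self (by positivity) (hg1 x))
    hballsub hd' F
  -- what is left of the cells without the tails is filled by discs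
  set U : Set Plane := (⋃ j, F'.cell j) \ F'.tail with hU
  have hUo : IsOpen U := (isOpen_iUnion F'.isOpen_cell).sdiff F'.isCompact_tail.isClosed
  have hUΩ : U ⊆ Ω := sdiff_subset.trans (iUnion_subset F'.cell_subset)
  obtain ⟨T, R, hR, hTdisj, hTcov⟩ := exists_finite_closedBalls hUo
    ((measure_mono hUΩ).trans_lt hfin.lt_top).ne one_pos hε4
  have hcell : ∀ i : T, ∃ j, Metric.closedBall (i : Plane) (R i) ⊆ F'.cell j := fun i => by
    obtain ⟨h0, -, h1⟩ := hR i i.2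
    have hi := Metric.mem_closedBall_self (x := (i : Plane)) h0.le
    obtain ⟨j, hj⟩ := mem_iUnion.1 (h1 hi).1
    refine ⟨j, ?_⟩
    refine (convex_closedBall (i : Plane) (R i)).isPreconnected.subset_left_of_subset_union
      (F'.isOpen_cell j) (isOpen_biUnion fun k (_ : k ≠ j) => F'.isOpen_cell k) ?_ (fun x hx => ?_)
      ⟨i, hi, hj⟩
    · exact disjoint_iUnion₂_right.2 fun k hk => F'.disjoint (Ne.symm hk)
    · obtain ⟨k, hk⟩ := mem_iUnion.1 (h1 hx).1
      by_cases hkj : k = j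
      · exact Or.inl (hkj ▸ hk)
      · exact Or.inr (mem_iUnion₂.2 ⟨k, hkj, hk⟩)
  choose j hj using hcell
  have htail : ∀ i : T, ∀ x ∈ Metric.closedBall (i : Plane) (R i), x ∉ F'.tail := fun i x hx =>
    ((hR i i.2).2.2 hx).2
  have hpt : ∀ (a x : Plane) (s : ℝ), x - (a + s • (x - a)) = (1 - s) • (x - a) := fun a x s => by
    module
  have hptdist : ∀ (a x : Plane) (s : ℝ), s < 1 →
      dist x (a + s • (x - a)) = (1 - s) * dist x a := fun a x s hs => by
    rw [dist_eq_norm, hpt, norm_smul, Real.norm_eq_abs, abs_of_pos (by linarith), dist_eq_norm]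
  let Mir : Mirrors Ω M H T :=
  { center := fun i => i
    radius := fun i => R i
    apex := fun i => F'.apex (j i)
    slope := fun i => g (j i).1
    radius_pos := fun i => (hR i i.2).1
    slope_pos := fun i => hg0 _
    height_pos := hHpos
    closedBall_subset := fun i => (hR i i.2).2.2.trans hUΩ
    disjoint := fun i k hik => hTdisj i.2 k.2 fun h => hik (Subtype.ext h)
    apex_notMem := fun i hi => F'.ne_apex (j i) _ (hj i hi) rfl
    height_le := fun i x hx => by
      have h1 : dist x (F'.apex (j i)) ≤ θ * M / g (j i).1 :=
        (F (j i).1).near (j i).2 x (hj i hx)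
      rw [le_div_iff₀ (hg0 _)] at h1
      rw [hH]
      linarith
    ray := fun i x hx s hs k hy hyk => by
      have hx' := Metric.ball_subset_closedBall hx
      have hyk' := Metric.ball_subset_closedBall hyk
      have hxcell := hj i hx'
      have hs0 : 0 < s := by
        by_contra! h
        refine htail k _ hyk' (F'.tail_mem (j i) x hxcell s h ?_)
        have h1 := hdist x (hsub (F'.cell_subset _ hxcell)) _ hy
        rw [hptdist _ _ _ hs] at h1
        nlinarith [dist_nonneg (x := x) (y := F'.apex (j i))]
      have hjk : j k = j i := by
        by_contra h
        exact disjoint_left.1 (F'.disjoint h) (hj k hyk') (F'.star (j i) x hxcell s hs0 hs.le)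
      exact ⟨hs0, by rw [hjk], by rw [hjk]⟩
    exit := fun i x hx s hs hy => by
      have hxcell := hj i (Metric.ball_subset_closedBall hx)
      set q := (j i).1 with hq
      have h1 : (1 - θ) * dist x (F'.apex (j i)) ≤ inner ℝ (v q) (F'.apex (j i) - x) :=
        hF1 q (j i).2 x hxcell
      have h2 := hv q _ hy
      have hxq : x ∈ Metric.ball (q : Plane) (ρ q) := (F q).cell_subset (j i).2 hxcell
      have h3 : -inner ℝ (v q) (x - q) ≤ θ := by
        have h4 := abs_real_inner_le_norm (v q) (x - q)
        rw [hv1, one_mul, ← dist_eq_norm] at h4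
        have h5 := Metric.mem_ball.1 hxq
        linarith [neg_abs_le (inner ℝ (v q) (x - q)), (hρ q q.2).2.1]
      have h4 : F'.apex (j i) + s • (x - F'.apex (j i)) - q =
          (x - q) + (1 - s) • (F'.apex (j i) - x) := by
        module
      rw [h4, inner_add_right, inner_smul_right] at h2
      have h5 : (1 - s) * dist x (F'.apex (j i)) ≤ D q := by
        rw [hD, le_div_iff₀ hθ']
        have := mul_le_mul_of_nonneg_left h1 (by linarith : 0 ≤ 1 - s)
        linarith
      have h6 : g q ^ 2 - 1 = 2 * g q * (H / D q) := mirrorSlope_sq _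
      rw [h6]
      have h7 : (1 - s) * dist x (F'.apex (j i)) * (2 * g q * (H / D q)) ≤
          D q * (2 * g q * (H / D q)) := by
        refine mul_le_mul_of_nonneg_right h5 ?_
        have := hg0 q
        have := hDpos q
        positivity
      refine h7.trans_eq ?_
      have := (hDpos q).ne'
      field_simp }
  refine ⟨H, T, inferInstance, Mir, fun i x hx => ?_, ?_⟩
  · have hxcell := hj i (Metric.ball_subset_closedBall hx)
    set q := (j i).1 with hq
    have hxq : x ∈ Metric.ball (q : Plane) (ρ q) := (F q).cell_subset (j i).2 hxcell
    have hxΩ : x ∈ Ω := hballsub q hxq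
    refine htol _ (d q) Metric.infDist_nonneg ?_ (hdpos q) ?_
    · obtain ⟨s, -, hs⟩ := exists_ray_mem_frontier hopen hbdd hxΩ
        (g := EuclideanSpace.single 0 1) (by simp)
      exact (Metric.infDist_le_dist_of_mem hs).trans
        (hdist _ (hsub hxΩ) _ (frontier_subset_closure hs))
    · have h1 := Metric.infDist_le_infDist_add_dist (x := (q : Plane)) (y := x) (s := frontier Ω)
      have h2 := Metric.mem_ball.1 hxq
      rw [dist_comm] at h2
      have h3 := (hρ q q.2).2.1
      simp only [hd]
      linarith
  · have hsph1 : volume (⋃ x : t, Metric.sphere (x : Plane) (ρ x)) = 0 :=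
      measure_iUnion_null fun x => Measure.addHaar_sphere _ _ _
    have hsph2 : volume (⋃ i : T, Metric.sphere (i : Plane) (R i)) = 0 :=
      measure_iUnion_null fun i => Measure.addHaar_sphere _ _ _
    have hcover : Ω \ ⋃ i, Mir.disc i ⊆
        (Ω \ ⋃ x ∈ t, Metric.closedBall x (ρ x)) ∪ (⋃ x : t, Metric.sphere (x : Plane) (ρ x)) ∪
        (⋃ x : t, Metric.ball (x : Plane) (ρ x) \ ⋃ i, (F x).cell i) ∪ F'.tail ∪
        (U \ ⋃ x ∈ T, Metric.closedBall x (R x)) ∪ ⋃ i : T, Metric.sphere (i : Plane) (R i) := by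
      rintro x ⟨hxΩ, hx⟩
      by_contra hcon
      simp only [mem_union, not_or] at hcon
      obtain ⟨⟨⟨⟨⟨h1, h2⟩, h3⟩, h4⟩, h5⟩, h6⟩ := hcon
      have h1' : x ∈ ⋃ x ∈ t, Metric.closedBall x (ρ x) := by
        by_contra h
        exact h1 ⟨hxΩ, h⟩
      obtain ⟨q, hq, hxq⟩ := mem_iUnion₂.1 h1'
      have hxq' : x ∈ Metric.ball q (ρ q) :=
        lt_of_le_of_ne (Metric.mem_closedBall.1 hxq) fun h => h2 (mem_iUnion.2 ⟨⟨q, hq⟩, h⟩)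
      have h3' : x ∈ ⋃ i, (F ⟨q, hq⟩).cell i := by
        by_contra h
        exact h3 (mem_iUnion.2 ⟨⟨q, hq⟩, hxq', h⟩)
      obtain ⟨i, hi⟩ := mem_iUnion.1 h3'
      have hxU : x ∈ U := ⟨mem_iUnion.2 ⟨⟨⟨q, hq⟩, i⟩, hi⟩, h4⟩
      have h5' : x ∈ ⋃ x ∈ T, Metric.closedBall x (R x) := by
        by_contra h
        exact h5 ⟨hxU, h⟩
      obtain ⟨p, hp, hxp⟩ := mem_iUnion₂.1 h5'
      refine hx (mem_iUnion.2 ⟨⟨p, hp⟩, ?_⟩)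
      exact lt_of_le_of_ne (Metric.mem_closedBall.1 hxp) fun h => h6 (mem_iUnion.2 ⟨⟨p, hp⟩, h⟩)
    have hcellsum : volume (⋃ x : t, Metric.ball (x : Plane) (ρ x) \ ⋃ i, (F x).cell i) ≤
        ENNReal.ofReal (ε / 4) := by
      refine (measure_iUnion_le _).trans ?_
      rw [tsum_fintype]
      exact (Finset.sum_le_sum fun x _ => hF3 x).trans hηsum
    have htailsum : volume F'.tail ≤ ENNReal.ofReal (ε / 4) := by
      refine (measure_iUnion_le _).trans ?_
      rw [tsum_fintype]
      exact (Finset.sum_le_sum fun x _ => hF2 x).trans hηsum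
    refine (measure_mono hcover).trans ((measure_union_le _ _).trans ?_)
    rw [hsph2, add_zero]
    refine (measure_union_le _ _).trans ?_
    refine (add_le_add ((measure_union_le _ _).trans (add_le_add ((measure_union_le _ _).trans
      (add_le_add ((measure_union_le _ _).trans_eq (by rw [hsph1, add_zero])) hcellsum))
        htailsum)) hTcov).trans ?_
    refine (add_le_add (add_le_add (add_le_add hcov le_rfl) le_rfl) le_rfl).trans_eq ?_
    rw [← ENNReal.ofReal_add hε4.le hε4.le, ← ENNReal.ofReal_add (by positivity) hε4.le,
      ← ENNReal.ofReal_add (by positivity) hε4.le]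
    congr 1
    ring

theorem integral_height_le {Ω : Set Plane} (hopen : IsOpen Ω)
    (hbdd : Bornology.IsBounded Ω) {M : ℝ} (hM : 0 < M) {ε : ℝ} (hε : 0 < ε) {H : ℝ} {ι : Type}
    [Finite ι] (D : Mirrors Ω M H ι)
    (h1 : ∀ i, ∀ x ∈ D.disc i, 1 / (1 + D.slope i ^ 2) ≤
      1 / 2 * (1 - M / Real.sqrt (M ^ 2 + Metric.infDist x (frontier Ω) ^ 2)) + ε)
    (h2 : volume (Ω \ ⋃ i, D.disc i) ≤ ENNReal.ofReal ε) :
    ∫ x in Ω, 1 / (1 + ‖gradient D.height x‖ ^ 2) ≤ phi Ω M + ε * (volume.real Ω + 1) := by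
  have hfm : IsFiniteMeasure (volume.restrict Ω) := ⟨by simpa using hbdd.measure_lt_top⟩
  set N : Set Plane := Ω \ ⋃ i, D.disc i with hN
  have hNm : MeasurableSet N :=
    hopen.measurableSet.diff (isOpen_iUnion fun i => Metric.isOpen_ball).measurableSet
  have hi1 := integrableOn_phi hbdd hM
  have hi2 : IntegrableOn (fun _ : Plane => ε) Ω := integrable_const ε
  have hi3 : IntegrableOn (N.indicator fun _ : Plane => (1 : ℝ)) Ω :=
    (integrable_const (1 : ℝ)).indicator hNm
  have hle : ∀ x ∈ Ω, 1 / (1 + ‖gradient D.height x‖ ^ 2) ≤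
      1 / 2 * (1 - M / Real.sqrt (M ^ 2 + Metric.infDist x (frontier Ω) ^ 2)) + ε +
        N.indicator (fun _ : Plane => (1 : ℝ)) x := by
    intro x hx
    by_cases hd : ∃ i, x ∈ D.disc i
    · obtain ⟨i, hi⟩ := hd
      have hxN : x ∉ N := fun h => h.2 (mem_iUnion.2 ⟨i, hi⟩)
      rw [indicator_of_notMem hxN, add_zero, D.norm_gradient_of_mem hi]
      exact h1 i x hi
    · have hxN : x ∈ N := ⟨hx, fun h => hd (mem_iUnion.1 h)⟩
      rw [indicator_of_mem hxN]
      have h3 : 1 / (1 + ‖gradient D.height x‖ ^ 2) ≤ 1 := by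
        rw [div_le_one (by positivity)]
        nlinarith [sq_nonneg ‖gradient D.height x‖]
      have h4 := (integrand_mem (d := Metric.infDist x (frontier Ω)) hM).1
      linarith
  have hint : IntegrableOn (fun x => 1 / (1 + ‖gradient D.height x‖ ^ 2)) Ω := by
    refine Integrable.of_bound (C := 1) ?_ (Eventually.of_forall fun x => ?_)
    · exact (measurable_const.div (measurable_const.add
        ((measurable_gradient D.height).norm.pow_const 2))).aestronglyMeasurable
    · rw [Real.norm_eq_abs, abs_of_nonneg (by positivity), div_le_one (by positivity)]
      nlinarith [sq_nonneg ‖gradient D.height x‖]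
  have hNint : ∫ x in Ω, N.indicator (fun _ : Plane => (1 : ℝ)) x ≤ ε := by
    rw [setIntegral_indicator hNm, inter_eq_self_of_subset_right sdiff_subset, setIntegral_const,
      smul_eq_mul, mul_one]
    exact ENNReal.toReal_le_of_le_ofReal hε.le h2
  have hi12 : IntegrableOn (fun x : Plane =>
      1 / 2 * (1 - M / Real.sqrt (M ^ 2 + Metric.infDist x (frontier Ω) ^ 2)) + ε) Ω volume :=
    hi1.add hi2
  calc ∫ x in Ω, 1 / (1 + ‖gradient D.height x‖ ^ 2)
      ≤ ∫ x in Ω, (1 / 2 * (1 - M / Real.sqrt (M ^ 2 + Metric.infDist x (frontier Ω) ^ 2)) + ε +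
        N.indicator (fun _ : Plane => (1 : ℝ)) x) :=
        setIntegral_mono_on hint (hi12.add hi3) hopen.measurableSet hle
    _ = phi Ω M + ε * volume.real Ω + ∫ x in Ω, N.indicator (fun _ : Plane => (1 : ℝ)) x := by
        rw [integral_add hi12 hi3, integral_add hi1 hi2, setIntegral_const, smul_eq_mul,
          mul_comm ε, phi]
    _ ≤ phi Ω M + ε * (volume.real Ω + 1) := by linarith

end MinRes

theorem theorem2 (r : WithTop ℕ∞) (hr : 1 ≤ r) (Ω : Set MinRes.Plane) (hconv : Convex ℝ Ω)
    (hopen : IsOpen Ω) (hbdd : Bornology.IsBounded Ω) (M : ℝ) (hM : 0 < M) :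
    IsGLB {a : ℝ | ∃ u ∈ MinRes.classU r Ω M,
      a = MinRes.resistance r Ω (MinRes.subgraph Ω u)} (MinRes.phi Ω M) ∧
    IsGLB {a : ℝ | ∃ B ∈ MinRes.classSigma r Ω M, a = MinRes.resistance r Ω B}
      (MinRes.phi Ω M) := by
  have key : ∀ ε > 0, ∃ (H : ℝ) (ι : Type) (_ : Finite ι) (D : MinRes.Mirrors Ω M H ι),
      ∫ x in Ω, 1 / (1 + ‖gradient D.height x‖ ^ 2) ≤ MinRes.phi Ω M + ε := by
    intro ε hε
    have hpos : 0 < volume.real Ω + 1 := by positivity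
    obtain ⟨H, ι, hι, D, h1, h2⟩ := MinRes.exists_mirrors hconv hopen hbdd hM (div_pos hε hpos)
    refine ⟨H, ι, hι, D, ?_⟩
    have := MinRes.integral_height_le hopen hbdd hM (div_pos hε hpos) D h1 h2
    rwa [div_mul_cancel₀ _ hpos.ne'] at this
  refine ⟨⟨?_, fun b hb => ?_⟩, ⟨?_, fun b hb => ?_⟩⟩
  · rintro _ ⟨u, hu, rfl⟩
    exact MinRes.phi_le_of_mem_classU hr hconv hopen hbdd hM hu
  · refine le_of_forall_pos_le_add fun ε hε => ?_
    obtain ⟨H, ι, hι, D, hD⟩ := key ε hε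
    obtain ⟨h1, h2⟩ := D.mem_classU hr hconv hopen hM
    exact (hb ⟨_, h1, rfl⟩).trans (h2.trans_le hD)
  · rintro _ ⟨B, hB, rfl⟩
    exact MinRes.phi_le_of_mem_classSigma hr hopen hbdd hM hB
  · refine le_of_forall_pos_le_add fun ε hε => ?_
    obtain ⟨H, ι, hι, D, hD⟩ := key ε hε
    obtain ⟨h1, h2⟩ := D.sheets_mem_classSigma hr hconv hopen hM
    exact (hb ⟨_, h1, rfl⟩).trans (h2.trans_le hD)
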